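/- Let $T$ be a torus over $\mathbb{C}$ with character lattice $X$ (so $T=\operatorname{Spec}\mathbb{C}[X]$), let $A$ be a finitely generated commutative $\mathbb{C}$-algebra with an action of $T$ on $Y=\operatorname{Spec}A$, let $c\in Y(\mathbb{C})$ be a point with trivial stabilizer in $T$, written as a homomorphism $A\to\mathbb{C}$, $a\mapsto a(c)$, and let $\sigma:X\to\mathbb{Z}$ be a coweight of $T$. For $\lambda\in X$ let $A_\lambda=\{a\in A: a(ty)=\lambda(t)a(y)\}$ be the weight space, and for $n\in\mathbb{Z}$ put $A_n=\bigoplus_{\sigma(\lambda)=n}A_\lambda$. Let $\mathbb{C}[x,y]_n$ be the space of homogeneous polynomials of degree $n$ in two variables ($0$ if $n<0$), and let $\beta_\infty\in\mathbb{C}[x,y]_n^*$ be $\beta_\infty(p)=p(0,1)$. Define $$A^\sigma=\operatorname{Sym}\Big(\bigoplus_{n\in\mathbb{Z}}A_n\otimes\mathbb{C}[x,y]_n^*\Big)\Big/J,$$ where $J$ is the ideal generated by all $(a_1a_2)\otimes\beta-\sum(a_1\otimes\beta_1)(a_2\otimes\beta_2)$ with $a_i\in A_{n_i}$, $\beta\in\mathbb{C}[x,y]_{n_1+n_2}^*$,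 and $\sum\beta_1\otimes\beta_2\in\mathbb{C}[x,y]_{n_1}^*\otimes\mathbb{C}[x,y]_{n_2}^*$ the tensor with $\beta(pq)=\sum\beta_1(p)\beta_2(q)$; and define $$A^\sigma_c=A^\sigma\big/\big(a\otimes\beta_\infty-a(c): a\in A_\lambda,\ \lambda\in X\big).$$ Let $\operatorname{QM}^\sigma_c(\mathbb{P}^1,[Y/T])$ be the stack over affine $\mathbb{C}$-schemes whose objects over $S$ are the triples $(P,s,\psi)$ of a principal $T$-bundle $P$ on $\mathbb{P}^1\times S$ of degree $\sigma$, a $T$-equivariant morphism $s:P\to Y$, and a trivialization $\psi:S\times T\to P|_{\{\infty\}\times S}$ with $s(\psi(S,1))=c$. Here $\infty=[0:1]$, and $P$ has degree $\sigma$ if on every fibre $\mathbb{P}^1_K$, for $K$ a field and $\operatorname{Spec}K\to S$ a morphism, it is isomorphic to $((\mathbb{A}^2\smallsetminus 0)\times T)/\mathbb{G}_m$, with $\mathbb{G}_m$ acting by inverse scaling on $\mathbb{A}^2\smallsetminus 0$ and through $\sigma$ on $T$. (1) The stack $\operatorname{QM}^\sigma_c(\mathbb{P}^1,[Y/T])$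 is isomorphic to the affine scheme $\operatorname{Spec}A^\sigma_c$. (2) Suppose that $a(c)=0$ whenever $a\in A_\lambda$ and $\sigma(\lambda)<0$. Then there is a point $c$ of $\operatorname{Spec}A^\sigma_c$ given by $a\otimes\beta\mapsto a(c)\beta(y^n)$ for $n\ge 0$, $a\in A_n$, $\beta\in\mathbb{C}[x,y]_n^*$, and there is an action of $\mathbb{C}^\times$ on $\operatorname{Spec}A^\sigma_c$ for which $a\otimes(x^iy^j)^*$ has weight $i$ (that is, $x$ has degree $1$ and $y$ has degree $0$). This action contracts $\operatorname{Spec}A^\sigma_c\cong\operatorname{QM}^\sigma_c(\mathbb{P}^1,[Y/T])$ to the point $c$: it extends to a morphism $\mathbb{A}^1\times\operatorname{Spec}A^\sigma_c\to\operatorname{Spec}A^\sigma_c$ which is constant with value $c$ on $\{0\}\times\operatorname{Spec}A^\sigma_c$. -/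

import Mathlib

open CategoryTheory AlgebraicGeometry MonoidalCategory CartesianMonoidalCategory
open scoped TensorProduct DirectSum

noncomputable section

namespace BasedQuasimap

/-! ### Affine schemes over `ℂ`, tori and weights

All schemes are schemes over `Spec ℂ`, that is, objects of `Over (Spec ℂ)`; the product `Y ⊗ Z` in
`Over (Spec ℂ)` is the fibre product over `Spec ℂ`. -/

/-- The base scheme `Spec ℂ`. -/
abbrev SpecC : Scheme.{0} := Spec (.of ℂ)

/-- `Spec A` as a scheme over `ℂ`. -/
abbrev specOver (A : Type) [CommRing A] [Algebra ℂ A] : Over SpecC :=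
  (Spec (.of A)).asOver SpecC

/-- The morphism `Spec B ⟶ Spec A` given by a homomorphism `A → B` of `ℂ`-algebras. -/
def specMap {A B : Type} [CommRing A] [Algebra ℂ A] [CommRing B] [Algebra ℂ B] (f : A →ₐ[ℂ] B) :
    specOver B ⟶ specOver A :=
  (Spec.map (CommRingCat.ofHom f.toRingHom)).asOver SpecC

/-- The torus `T = Spec ℂ[X]` with character lattice `X`, a group scheme over `ℂ`
(`X` is a free abelian group of finite rank in all uses). -/
abbrev Torus (X : Type) [AddCommGroup X] : Over SpecC := specOver (AddMonoidAlgebra ℂ X)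

/-- The pulled back function `y^* a`, for a morphism `y : Z ⟶ Spec A` and `a ∈ A`. -/
def pullFun {A : Type} [CommRing A] [Algebra ℂ A] {Z : Over SpecC} (y : Z ⟶ specOver A) :
    A →+* Γ(Z.left, ⊤) :=
  (Scheme.Hom.appTop (X := Z.left) (Y := Spec (.of A)) y.left).hom.comp
    (Scheme.ΓSpecIso (.of A)).inv.hom

/-- The invertible function `χ^l(t)`, for a point `t : Z ⟶ T` and a character `l ∈ X`. -/
def character {X : Type} [AddCommGroup X] {Z : Over SpecC} (t : Z ⟶ Torus X) (l : X) :
    Γ(Z.left, ⊤) :=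
  pullFun t (AddMonoidAlgebra.single l 1)

/-- The one-parameter subgroup `σ` (a coweight, seen as a homomorphism from the character
lattice to `ℤ`) evaluated at an invertible function `u` on `Spec B`: the point `σ(u)` of `T` with
`χ^l(σ(u)) = u ^ σ(l)`. -/
def coweightPoint {X : Type} [AddCommGroup X] (σ : X →+ ℤ) {B : Type} [CommRing B] [Algebra ℂ B]
    (u : Bˣ) : specOver B ⟶ Torus X :=
  specMap (AddMonoidAlgebra.lift ℂ B X
    ((Units.coeHom B).comp ((zpowersHom Bˣ u).comp (AddMonoidHom.toMultiplicative σ))))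

lemma comp_appTop_specAlgebraMap {A : Type} [CommRing A] [Algebra ℂ A] {Z : Scheme.{0}}
    (y : Z ⟶ Spec (.of A)) :
    CommRingCat.ofHom (algebraMap ℂ A) ≫ (Scheme.ΓSpecIso (.of A)).inv ≫ y.appTop =
      (Scheme.ΓSpecIso (.of ℂ)).inv ≫
        (y ≫ Spec.map (CommRingCat.ofHom (algebraMap ℂ A))).appTop := by
  have h3 := Scheme.ΓSpecIso_inv_naturality (CommRingCat.ofHom (algebraMap ℂ A))
  rw [Scheme.Hom.comp_appTop, reassoc_of% h3]

lemma pullFun_algebraMap {A : Type} [CommRing A] [Algebra ℂ A] {Z : Over SpecC}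
    (y y' : Z ⟶ specOver A) (r : ℂ) :
    pullFun y (algebraMap ℂ A r) = pullFun y' (algebraMap ℂ A r) := by
  have key : ∀ y : Z ⟶ specOver A, (pullFun y).comp (algebraMap ℂ A) =
      ((Scheme.ΓSpecIso (.of ℂ)).inv ≫ Scheme.Hom.appTop (Y := SpecC) Z.hom).hom := by
    intro y
    have h : y.left ≫ Spec.map (CommRingCat.ofHom (algebraMap ℂ A)) = Z.hom := Over.w y
    rw [← h]
    exact congrArg CommRingCat.Hom.hom (comp_appTop_specAlgebraMap (A := A) y.left)
  have h1 := congrArg (fun k => k r) (key y)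
  have h2 := congrArg (fun k => k r) (key y')
  exact h1.trans h2.symm

/-- The weight space `A_l` for an action of the torus `T` on `Spec A`: the functions `a` with
`a(t y) = χ^l(t) a(y)` for all points `t` of `T` and `y` of `Spec A`. -/
def weightSpace {X : Type} [AddCommGroup X] (A : Type) [CommRing A] [Algebra ℂ A]
    [ModObj (Torus X) (specOver A)] (l : X) : Submodule ℂ A where
  carrier := {a | ∀ (Z : Over SpecC) (t : Z ⟶ Torus X) (y : Z ⟶ specOver A),
    pullFun (t • y) a = character t l * pullFun y a}
  add_mem' {a b} ha hb Z t y := by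
    rw [map_add, map_add, ha Z t y, hb Z t y, mul_add]
  zero_mem' Z t y := by simp
  smul_mem' r a ha Z t y := by
    rw [Algebra.smul_def, map_mul, map_mul, ha Z t y, pullFun_algebraMap (t • y) y]
    ring

open scoped MonObj in
/-- The point `c` of `Spec A` has trivial stabilizer in `T`. (As stabilizers are closed subgroup
schemes of `T` and the characteristic is `0`, it suffices to consider the `ℂ`-points of `T`.) -/
def TrivialStabilizer (X : Type) [AddCommGroup X] {A : Type} [CommRing A] [Algebra ℂ A]
    [ModObj (Torus X) (specOver A)] (c : A →ₐ[ℂ] ℂ) : Prop :=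
  ∀ t : specOver ℂ ⟶ Torus X, t • specMap c = specMap c → t = 1

section Algebra

variable {X : Type} [AddCommGroup X] (σ : X →+ ℤ) (A : Type) [CommRing A] [Algebra ℂ A]
  [ModObj (Torus X) (specOver A)]

lemma weightSpace_mul_mem {l m : X} {a b : A} (ha : a ∈ weightSpace A l)
    (hb : b ∈ weightSpace A m) : a * b ∈ weightSpace A (l + m) := by
  intro Z t y
  have hc : character t (l + m) = character t l * character t m := by
    rw [character, character, character, ← map_mul, AddMonoidAlgebra.single_mul_single, mul_one]
  rw [map_mul, map_mul, ha Z t y, hb Z t y, hc]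
  ring

/-- The collapsed grading `A_n = ⨁_{σ(l) = n} A_l`, for `n ∈ ℤ`. -/
def degreePart (n : ℤ) : Submodule ℂ A := ⨆ (l : X) (_ : σ l = n), weightSpace A l

variable {A} in
lemma weightSpace_le_degreePart {l : X} {a : A} (ha : a ∈ weightSpace A l) :
    a ∈ degreePart σ A (σ l) :=
  (le_iSup₂_of_le (f := fun (m : X) (_ : σ m = σ l) => weightSpace A m) l rfl le_rfl) ha

variable {A} in
lemma degreePart_mul_mem {m n : ℤ} {a b : A} (ha : a ∈ degreePart σ A m)
    (hb : b ∈ degreePart σ A n) : a * b ∈ degreePart σ A (m + n) := by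
  have h : degreePart σ A m * degreePart σ A n ≤ degreePart σ A (m + n) := by
    simp only [degreePart, Submodule.iSup_mul, Submodule.mul_iSup]
    refine iSup₂_le fun l hl => iSup₂_le fun k hk => Submodule.mul_le.2 fun x hx y hy => ?_
    subst hl hk
    rw [← map_add]
    exact weightSpace_le_degreePart σ (weightSpace_mul_mem A (by assumption) (by assumption))
  exact h (Submodule.mul_mem_mul ha hb)

/-- The product `A_m × A_n → A_{m+n}`. -/
def degreePartMul {m n : ℤ} (a : degreePart σ A m) (b : degreePart σ A n) :
    degreePart σ A (m + n) :=
  ⟨a.1 * b.1, degreePart_mul_mem σ a.2 b.2⟩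

/-- The space `ℂ[x,y]_n` of homogeneous polynomials of degree `n ∈ ℤ` in two variables
`x = X 0`, `y = X 1`; it is `0` if `n < 0`. -/
def homogPoly (n : ℤ) : Submodule ℂ (MvPolynomial (Fin 2) ℂ) where
  carrier := {p | ∀ d ∈ p.support, ((d 0 + d 1 : ℕ) : ℤ) = n}
  add_mem' {p q} hp hq d hd := by
    classical
    rcases Finset.mem_union.1 (MvPolynomial.support_add hd) with h | h
    exacts [hp d h, hq d h]
  zero_mem' d hd := by simp at hd
  smul_mem' r p hp d hd := hp d (MvPolynomial.support_smul hd)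

/-- The product `ℂ[x,y]_m × ℂ[x,y]_n → ℂ[x,y]_{m+n}`. -/
def homogPolyMul {m n : ℤ} (p : homogPoly m) (q : homogPoly n) : homogPoly (m + n) :=
  ⟨p.1 * q.1, by
    classical
    intro d hd
    obtain ⟨d₁, h₁, d₂, h₂, rfl⟩ := Finset.mem_add.1 (MvPolynomial.support_mul _ _ hd)
    have e₁ := p.2 d₁ h₁
    have e₂ := q.2 d₂ h₂
    simp only [Finsupp.add_apply]
    push_cast at *
    linarith⟩

/-- The dual space `ℂ[x,y]_n^*`. -/
abbrev homogDual (n : ℤ) : Type := Module.Dual ℂ (homogPoly n)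

/-- The functional `β_∞(p) = p(0,1)` on `ℂ[x,y]_n`. -/
def betaInfty (n : ℤ) : homogDual n :=
  (MvPolynomial.aeval (R := ℂ) ![(0 : ℂ), 1]).toLinearMap ∘ₗ (homogPoly n).subtype

/-- The functional `(x^i y^j)^*` on `ℂ[x,y]_n` taking the coefficient of `x^i y^j`
(it vanishes unless `i + j = n`). -/
def monomialDual (n : ℤ) (i j : ℕ) : homogDual n :=
  MvPolynomial.lcoeff ℂ (Finsupp.single 0 i + Finsupp.single 1 j) ∘ₗ (homogPoly n).subtype

/-- The monomial `y^n` as an element of `ℂ[x,y]_n`. -/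
def yPow (n : ℕ) : homogPoly (n : ℤ) :=
  ⟨MvPolynomial.X 1 ^ n, by
    intro d hd
    rw [MvPolynomial.support_X_pow, Finset.mem_singleton] at hd
    subst hd
    simp⟩

/-- The vector space `⨁_{n ∈ ℤ} A_n ⊗ ℂ[x,y]_n^*`. -/
abbrev GenSpace : Type := ⨁ n : ℤ, (degreePart σ A n ⊗[ℂ] homogDual n)

variable {A} in
/-- The element `a ⊗ β` of `Sym(⨁ₙ A_n ⊗ ℂ[x,y]_n^*)`, for `a ∈ A_n` and `β ∈ ℂ[x,y]_n^*`. -/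
def symGen (n : ℤ) (a : degreePart σ A n) (β : homogDual n) : SymmetricAlgebra ℂ (GenSpace σ A) :=
  SymmetricAlgebra.ι ℂ _ (DirectSum.lof ℂ ℤ (fun n => degreePart σ A n ⊗[ℂ] homogDual n) n
    (a ⊗ₜ[ℂ] β))

/-- The ideal `J` generated by the elements `(a₁ a₂) ⊗ β - ∑ (a₁ ⊗ β₁) (a₂ ⊗ β₂)`, where
`∑ β₁ ⊗ β₂ ∈ ℂ[x,y]_{n₁}^* ⊗ ℂ[x,y]_{n₂}^*` is the coproduct of `β`, that is, the tensor with
`β(p q) = ∑ β₁(p) β₂(q)` for all `p ∈ ℂ[x,y]_{n₁}` and `q ∈ ℂ[x,y]_{n₂}`. -/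
def idealJ : Ideal (SymmetricAlgebra ℂ (GenSpace σ A)) :=
  Ideal.span {z | ∃ (n₁ n₂ : ℤ) (a₁ : degreePart σ A n₁) (a₂ : degreePart σ A n₂)
    (β : homogDual (n₁ + n₂)) (k : ℕ) (β₁ : Fin k → homogDual n₁) (β₂ : Fin k → homogDual n₂),
    (∀ (p : homogPoly n₁) (q : homogPoly n₂), β (homogPolyMul p q) = ∑ i, β₁ i p * β₂ i q) ∧
    z = symGen σ (n₁ + n₂) (degreePartMul σ A a₁ a₂) β -
      ∑ i, symGen σ n₁ a₁ (β₁ i) * symGen σ n₂ a₂ (β₂ i)}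

/-- The algebra `A^σ = Sym(⨁ₙ A_n ⊗ ℂ[x,y]_n^*) / J`. -/
abbrev Asigma : Type := SymmetricAlgebra ℂ (GenSpace σ A) ⧸ idealJ σ A

variable {A} in
/-- The ideal of `A^σ` generated by the elements `a ⊗ β_∞ - a(c)`, for `a ∈ A_l` and `l ∈ X`. -/
def idealC (c : A →ₐ[ℂ] ℂ) : Ideal (Asigma σ A) :=
  Ideal.span {z | ∃ (l : X) (a : A) (ha : a ∈ weightSpace A l),
    z = Ideal.Quotient.mk (idealJ σ A)
        (symGen σ (σ l) ⟨a, weightSpace_le_degreePart σ ha⟩ (betaInfty (σ l))) -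
      algebraMap ℂ (Asigma σ A) (c a)}

variable {A} in
/-- The algebra `A^σ_c = A^σ / (a ⊗ β_∞ - a(c))`. -/
abbrev AsigmaC (c : A →ₐ[ℂ] ℂ) : Type := Asigma σ A ⧸ idealC σ c

variable {A} in
/-- The class of `a ⊗ β` in `A^σ_c`. -/
def gen (c : A →ₐ[ℂ] ℂ) (n : ℤ) (a : degreePart σ A n) (β : homogDual n) : AsigmaC σ c :=
  Ideal.Quotient.mk (idealC σ c) (Ideal.Quotient.mk (idealJ σ A) (symGen σ n a β))

end Algebra

/-! ### The projective line -/

instance gradedHomogeneous : GradedAlgebra (MvPolynomial.homogeneousSubmodule (Fin 2) ℂ) :=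
  MvPolynomial.gradedAlgebra

/-- The projective line `ℙ¹ = Proj ℂ[x,y]` over `ℂ`. -/
def P1 : Over SpecC :=
  Over.mk (Proj.toSpecZero (MvPolynomial.homogeneousSubmodule (Fin 2) ℂ) ≫
    Spec.map (CommRingCat.ofHom
      (algebraMap ℂ (MvPolynomial.homogeneousSubmodule (Fin 2) ℂ 0))))

section Points

variable {B : Type} [CommRing B] [Algebra ℂ B]

/-- Evaluation of polynomials in `x, y` at functions `f, g` on `Spec B`. -/
def evalAt (f g : B) : MvPolynomial (Fin 2) ℂ →+* Γ(Spec (.of B), ⊤) :=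
  (Scheme.ΓSpecIso (.of B)).inv.hom.comp (MvPolynomial.aeval (R := ℂ) ![f, g]).toRingHom

lemma map_irrelevant_evalAt (f g : B) (h : IsCoprime f g) :
    (HomogeneousIdeal.irrelevant
      (MvPolynomial.homogeneousSubmodule (Fin 2) ℂ)).toIdeal.map (evalAt f g) = ⊤ := by
  have hX : ∀ i : Fin 2, (MvPolynomial.X i : MvPolynomial (Fin 2) ℂ) ∈
      (HomogeneousIdeal.irrelevant (MvPolynomial.homogeneousSubmodule (Fin 2) ℂ)).toIdeal := by
    intro i
    change MvPolynomial.X i ∈ HomogeneousIdeal.irrelevant _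
    rw [HomogeneousIdeal.mem_irrelevant_iff]
    rw [GradedRing.proj_apply]
    exact DirectSum.decompose_of_mem_ne _
      ((MvPolynomial.mem_homogeneousSubmodule _ _).2 (MvPolynomial.isHomogeneous_X ℂ i)) one_ne_zero
  obtain ⟨u, v, huv⟩ := h
  rw [Ideal.eq_top_iff_one]
  have h0 := Ideal.mem_map_of_mem (evalAt f g) (hX 0)
  have h1 := Ideal.mem_map_of_mem (evalAt f g) (hX 1)
  have h2 := Ideal.add_mem _
    (Ideal.mul_mem_left _ ((Scheme.ΓSpecIso (.of B)).inv.hom u) h0)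
    (Ideal.mul_mem_left _ ((Scheme.ΓSpecIso (.of B)).inv.hom v) h1)
  convert h2 using 1
  have e0 : evalAt f g (MvPolynomial.X 0) = (Scheme.ΓSpecIso (.of B)).inv.hom f := by
    simp [evalAt]
  have e1 : evalAt f g (MvPolynomial.X 1) = (Scheme.ΓSpecIso (.of B)).inv.hom g := by
    simp [evalAt]
  rw [e0, e1, ← map_mul, ← map_mul, ← map_add, huv, map_one]

lemma fromOfGlobalSections_comp (f g : B) (h : IsCoprime f g) :
    Proj.fromOfGlobalSections (MvPolynomial.homogeneousSubmodule (Fin 2) ℂ)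
      (evalAt f g) (map_irrelevant_evalAt f g h) ≫
      Proj.toSpecZero (MvPolynomial.homogeneousSubmodule (Fin 2) ℂ) ≫
      Spec.map (CommRingCat.ofHom
        (algebraMap ℂ (MvPolynomial.homogeneousSubmodule (Fin 2) ℂ 0))) =
    Spec.map (CommRingCat.ofHom (algebraMap ℂ B)) := by
  rw [Proj.fromOfGlobalSections_toSpecZero_assoc, ← Spec.map_comp]
  have e : CommRingCat.ofHom (algebraMap ℂ (MvPolynomial.homogeneousSubmodule (Fin 2) ℂ 0)) ≫
      CommRingCat.ofHom ((evalAt f g).comp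
        (algebraMap (MvPolynomial.homogeneousSubmodule (Fin 2) ℂ 0) (MvPolynomial (Fin 2) ℂ))) =
      CommRingCat.ofHom (algebraMap ℂ B) ≫ (Scheme.ΓSpecIso (.of B)).inv := by
    ext r
    change (Scheme.ΓSpecIso (.of B)).inv.hom
      (MvPolynomial.aeval (R := ℂ) ![f, g] (algebraMap ℂ (MvPolynomial (Fin 2) ℂ) r)) =
      (Scheme.ΓSpecIso (.of B)).inv.hom (algebraMap ℂ B r)
    rw [AlgHom.commutes]
  rw [e, Spec.map_comp, toSpecΓ_SpecMap_ΓSpecIso_inv_assoc]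

/-- The point `[f : g] : Spec B ⟶ ℙ¹` with homogeneous coordinates `x = f` and `y = g`, for
`f, g ∈ B` generating the unit ideal. -/
def P1.point (f g : B) (h : IsCoprime f g) : specOver B ⟶ P1 :=
  Over.homMk (Proj.fromOfGlobalSections (X := Spec (.of B))
    (MvPolynomial.homogeneousSubmodule (Fin 2) ℂ)
    (evalAt f g) (map_irrelevant_evalAt f g h)) (fromOfGlobalSections_comp f g h)

end Points

/-! ### Principal bundles and their degree -/

/-- `π : P ⟶ B` is a principal `T`-bundle: `T` acts on `P` along the fibres of `π`, the action is
simply transitive on the points of `P` (with values in any scheme) over a given point of `B`, and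
`π` has sections locally on `B`, so that `P` is locally on `B` isomorphic to `T × B`. Local means
local in the Zariski topology; as `T` is a split torus, the étale topology gives the same bundles
(Hilbert's theorem 90). -/
structure IsPrincipalBundle (X : Type) [AddCommGroup X] {P B : Over SpecC} [ModObj (Torus X) P]
    (π : P ⟶ B) : Prop where
  smul_comp : ∀ (Z : Over SpecC) (t : Z ⟶ Torus X) (p : Z ⟶ P), (t • p) ≫ π = p ≫ π
  simply_transitive : ∀ (Z : Over SpecC) (p q : Z ⟶ P), p ≫ π = q ≫ π →
    ∃! t : Z ⟶ Torus X, t • p = q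
  locally_trivial : ∀ b : B.left, ∃ U : B.left.Opens, b ∈ U ∧
    ∃ τ : U.toScheme ⟶ P.left, τ ≫ π.left = U.ι

section Degree

open Polynomial LaurentPolynomial

variable (K : Type) [Field K] [Algebra ℂ K]

/-- The inclusion `Spec K[t, t⁻¹] ⟶ Spec K[t]`. -/
def overlapMap : specOver K[T;T⁻¹] ⟶ specOver K[X] :=
  specMap ((Polynomial.aeval (R := K) (LaurentPolynomial.T 1 : K[T;T⁻¹])).restrictScalars ℂ)

/-- The morphism `Spec K[t, t⁻¹] ⟶ Spec K[t]` given by `t ↦ t⁻¹`. -/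
def overlapMapInv : specOver K[T;T⁻¹] ⟶ specOver K[X] :=
  specMap ((Polynomial.aeval (R := K) (LaurentPolynomial.T (-1) : K[T;T⁻¹])).restrictScalars ℂ)

/-- The coordinate `t` as a unit of `K[t, t⁻¹]`. -/
def coordUnit : (K[T;T⁻¹])ˣ where
  val := LaurentPolynomial.T 1
  inv := LaurentPolynomial.T (-1)
  val_inv := by rw [← LaurentPolynomial.T_add]; simp
  inv_val := by rw [← LaurentPolynomial.T_add]; simp

variable {K} {R : Type} [CommRing R] [Algebra ℂ R]

/-- The morphism `Spec K[t] ⟶ ℙ¹ × Spec R` with components `p : Spec K[t] ⟶ ℙ¹` and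
`Spec K[t] ⟶ Spec K ⟶ Spec R`, the latter given by a `K`-valued point `x` of `Spec R`. -/
def fibreChart (x : R →ₐ[ℂ] K) (p : specOver K[X] ⟶ P1) : specOver K[X] ⟶ P1 ⊗ specOver R :=
  lift p (specMap ((IsScalarTower.toAlgHom ℂ K K[X]).comp x))

/-- A principal `T`-bundle `P` on `ℙ¹ × Spec R` has degree `σ` if its restriction to the fibre
`ℙ¹_K` over every point of `Spec R` with values in a field `K` has degree `σ`. The latter means
that `P|_{ℙ¹_K}` has sections `e` over the chart `[t : 1]` around `∞ = [0 : 1]` and `e'` over the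
chart `[1 : t]` which are glued by `σ`, that is, `e([t : 1]) = σ(t) e'([1 : t⁻¹])`. In other
words, `P|_{ℙ¹_K}` is isomorphic to `((𝔸² ∖ 0) × T) / 𝔾ₘ`, where `𝔾ₘ` acts by inverse scaling on
`𝔸² ∖ 0` and by `σ` on `T`; the functions of weight `l` on it are the homogeneous polynomials of
degree `σ(l)`. -/
def HasDegree {X : Type} [AddCommGroup X] (σ : X →+ ℤ) {P : Over SpecC} [ModObj (Torus X) P]
    (π : P ⟶ P1 ⊗ specOver R) : Prop :=
  ∀ (K : Type) [Field K] [Algebra ℂ K] (x : R →ₐ[ℂ] K),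
    ∃ e e' : specOver K[X] ⟶ P,
      e ≫ π = fibreChart x (P1.point Polynomial.X 1 isCoprime_one_right) ∧
      e' ≫ π = fibreChart x (P1.point 1 Polynomial.X isCoprime_one_left) ∧
      overlapMap K ≫ e = coweightPoint σ (coordUnit K) • (overlapMapInv K ≫ e')

end Degree

/-! ### The stack of based quasimaps -/

/-- The category of affine schemes over `ℂ`, presented as the opposite of the category of
commutative `ℂ`-algebras; the algebra `R` stands for `S = Spec R`. -/
abbrev AffC : Type 1 := (CommAlgCat.{0} ℂ)ᵒᵖ

/-- The section `{∞} × S ⟶ ℙ¹ × S` at `∞ = [0 : 1]`, for `S = Spec R`. -/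
def inftySection (R : Type) [CommRing R] [Algebra ℂ R] : specOver R ⟶ P1 ⊗ specOver R :=
  lift (P1.point (0 : R) 1 isCoprime_one_right) (𝟙 (specOver R))

/-- The constant morphism `S ⟶ Spec A` with value the `ℂ`-point `c`, for `S = Spec R`. -/
def constMap {A : Type} [CommRing A] [Algebra ℂ A] (c : A →ₐ[ℂ] ℂ) (R : Type) [CommRing R]
    [Algebra ℂ R] : specOver R ⟶ specOver A :=
  specMap ((Algebra.ofId ℂ R).comp c)

section Stack

variable {X : Type} [AddCommGroup X] (σ : X →+ ℤ) (A : Type) [CommRing A] [Algebra ℂ A]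
  [ModObj (Torus X) (specOver A)] (c : A →ₐ[ℂ] ℂ)

/-- A based quasimap of degree `σ` from `ℙ¹` to `[Spec A / T]`, over an affine scheme
`S = Spec R`: a principal `T`-bundle `P` on `ℙ¹ × S` of degree `σ`, a `T`-equivariant morphism
`s : P ⟶ Spec A`, and a trivialization `ψ` of `P` over `{∞} × S` with `s(ψ(S, 1)) = c`. The
trivialization `ψ : S × T ⟶ P|_{∞ × S}` is given by the section `e = ψ(-, 1)`. -/
structure BasedQM where
  base : AffC
  P : Over SpecC
  [action : ModObj (Torus X) P]
  π : P ⟶ P1 ⊗ specOver base.unop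
  principal : IsPrincipalBundle X π
  degree : HasDegree σ π
  s : P ⟶ specOver A
  equivariant : IsModHom (Torus X) s
  e : specOver base.unop ⟶ P
  e_π : e ≫ π = inftySection base.unop
  e_s : e ≫ s = constMap c base.unop

attribute [instance] BasedQM.action

variable {σ A c}

/-- A morphism of based quasimaps over a morphism `S ⟶ S'` of affine schemes: an equivariant
morphism `P ⟶ P'` over `ℙ¹ × S ⟶ ℙ¹ × S'` compatible with the maps to `Spec A` and with the
trivializations. As an equivariant morphism between principal bundles it identifies `P` with the
pullback of `P'`, and over the identity of `S` it is an isomorphism. -/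
@[ext]
structure BasedQM.Hom (q q' : BasedQM σ A c) where
  base : q.base ⟶ q'.base
  map : q.P ⟶ q'.P
  equivariant : IsModHom (Torus X) map
  map_π : map ≫ q'.π = q.π ≫ (P1 ◁ specMap base.unop.hom)
  map_s : map ≫ q'.s = q.s
  e_map : q.e ≫ map = specMap base.unop.hom ≫ q'.e

lemma specMap_id (B : Type) [CommRing B] [Algebra ℂ B] :
    specMap (AlgHom.id ℂ B) = 𝟙 (specOver B) := by
  ext1
  exact Spec.map_id _

lemma specMap_comp {B C D : Type} [CommRing B] [Algebra ℂ B] [CommRing C] [Algebra ℂ C]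
    [CommRing D] [Algebra ℂ D] (f : B →ₐ[ℂ] C) (g : C →ₐ[ℂ] D) :
    specMap (g.comp f) = specMap g ≫ specMap f := by
  ext1
  exact Spec.map_comp (CommRingCat.ofHom f.toRingHom) (CommRingCat.ofHom g.toRingHom)

instance : Category (BasedQM σ A c) where
  Hom := BasedQM.Hom
  id q :=
    { base := 𝟙 _
      map := 𝟙 _
      equivariant := inferInstance
      map_π := by
        have h : specMap (𝟙 q.base : q.base ⟶ q.base).unop.hom = 𝟙 (specOver q.base.unop) :=
          specMap_id _
        rw [h, MonoidalCategory.whiskerLeft_id, Category.comp_id, Category.id_comp]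
      map_s := Category.id_comp _
      e_map := by
        have h : specMap (𝟙 q.base : q.base ⟶ q.base).unop.hom = 𝟙 (specOver q.base.unop) :=
          specMap_id _
        rw [h, Category.comp_id, Category.id_comp] }
  comp {q q' q''} f g :=
    { base := f.base ≫ g.base
      map := f.map ≫ g.map
      equivariant := by
        have := f.equivariant
        have := g.equivariant
        infer_instance
      map_π := by
        have h : specMap (f.base ≫ g.base).unop.hom =
            specMap f.base.unop.hom ≫ specMap g.base.unop.hom := specMap_comp _ _
        rw [h, Category.assoc, g.map_π, reassoc_of% f.map_π, MonoidalCategory.whiskerLeft_comp]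
      map_s := by rw [Category.assoc, g.map_s, f.map_s]
      e_map := by
        have h : specMap (f.base ≫ g.base).unop.hom =
            specMap f.base.unop.hom ≫ specMap g.base.unop.hom := specMap_comp _ _
        rw [h, Category.assoc, ← g.e_map, reassoc_of% f.e_map] }
  id_comp f := BasedQM.Hom.ext (Category.id_comp _) (Category.id_comp _)
  comp_id f := BasedQM.Hom.ext (Category.comp_id _) (Category.comp_id _)
  assoc f g h := BasedQM.Hom.ext (Category.assoc _ _ _) (Category.assoc _ _ _)

variable (σ A c)

/-- The projection of a based quasimap over `S` to `S`. -/
def BasedQM.proj : BasedQM σ A c ⥤ AffC where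
  obj q := q.base
  map f := f.base

/-- The stack `QM^σ_c(ℙ¹, [Spec A / T])` of based quasimaps of degree `σ`, as a category over the
category of affine schemes over `ℂ`. -/
def QMStack : BasedCategory AffC := BasedCategory.ofFunctor (BasedQM.proj σ A c)

end Stack

/-- The affine scheme `Spec B`, as a stack: the category of affine schemes over `Spec B`, with the
functor which forgets the morphism to `Spec B`. -/
def affineStack (B : Type) [CommRing B] [Algebra ℂ B] : BasedCategory AffC :=
  BasedCategory.ofFunctor (Over.forget (Opposite.op (CommAlgCat.of ℂ B) : AffC))

/-- Two stacks over affine schemes, seen as categories over `AffC`, are isomorphic if there is an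
equivalence of categories between them which commutes with the projections to `AffC`. -/
def IsoOfStacks (𝒳 𝒴 : BasedCategory AffC) : Prop :=
  ∃ F : BasedFunctor 𝒳 𝒴, F.toFunctor.IsEquivalence

/-! ### Contracting actions -/

/-- An action of `ℂ^× = Spec ℂ[ℤ]` on `Spec B` contracts `Spec B` to the point `z` if it extends to
a morphism `𝔸¹ × Spec B ⟶ Spec B` which is constant with value `z` on `{0} × Spec B`; that is, the
limit of `t y` as `t → 0` is `z` for all points `y`. -/
def ContractsTo (B : Type) [CommRing B] [Algebra ℂ B] [ModObj (Torus ℤ) (specOver B)]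
    (z : B →ₐ[ℂ] ℂ) : Prop :=
  ∃ m : specOver (Polynomial ℂ) ⊗ specOver B ⟶ specOver B,
    (∀ (Z : Over SpecC) (t : Z ⟶ Torus ℤ) (y : Z ⟶ specOver B),
      lift (t ≫ specMap (Polynomial.aeval (R := ℂ) (AddMonoidAlgebra.single (1 : ℤ) (1 : ℂ)))) y ≫ m
        = t • y) ∧
    lift (specMap (Polynomial.aeval (R := ℂ) (0 : B))) (𝟙 (specOver B)) ≫ m = constMap z B

end BasedQuasimap

end

open BasedQuasimap

/-! Write `S = Spec R`, with charts `[t : 1]` around `∞` and `[1 : t]` on `ℙ¹ × S`. A bundle of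
degree `σ` trivialized along `∞` has exactly one framing: sections `e₀`, `e₁` over the two charts
with `e₀ = σ(t) e₁` on the overlap, where `e₀` restricts to the given trivialization at `t = 0`. In
this frame an equivariant map `s` to `Spec A` is a homomorphism `Φ : A → R[t]`, namely `s ∘ e₀`. It
extends over the second chart exactly when `Φ(a)` has degree at most `σ(l)` for every `a` of weight
`l`, and the condition at `∞` says that the constant term of `Φ(a)` is `a(c)`. Such `Φ` are called
based (`IsBased`).

The algebra `A^σ_c` represents based homomorphisms (`exists_isUniversal`). The coefficient of `t^i`
in the universal `Φ(a)` is `a ⊗ (x^i y^(n-i))^*`, the ideal `J` expresses that `Φ` is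
multiplicative, and the relations with `β_∞` express the constant term. As framings are unique, a
morphism of based quasimaps is determined by its base (`BasedQM.hom_ext_of_base`). The stack is thus
equivalent to the functor of based homomorphisms, and (1) follows.

The main work is the existence of the framing, `IsPrincipalBundle.exists_framing`, because the
degree is only prescribed on fibres over fields. For a character `l`, the functions of weight `l` on
the bundle form an invertible sheaf. After a twist by `-σ(l)` it becomes trivial on every closed
fibre, and its trivialization at `∞` has to be extended to a global section. The obstruction lies in
`H¹` of a sheaf of degree `-1` on the fibres. This `H¹`, computed by Čech cochains on the two
charts, is a finitely generated `R`-module that vanishes modulo every maximal ideal, so it is zero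
by Nakayama's lemma (`exists_eq_add_of_local`, `IsChartSystem.exists_eq_add`). The normalized
sections are unique because functions on `ℙ¹ × S` that are regular on both charts are constant.
Uniqueness makes them multiplicative in `l`, and a multiplicative system of such sections is the
same as a framing of the torsor.

For (2), the substitution `t ↦ u t` preserves based homomorphisms for every `u`, invertible or not.
At `u = 0` only the constant terms `a(c)` survive. The constant homomorphism `c` satisfies the
degree bounds precisely because `a(c) = 0` in negative degrees. -/

noncomputable section

open CategoryTheory AlgebraicGeometry MonoidalCategory CartesianMonoidalCategory
open scoped TensorProduct DirectSum

namespace BasedQuasimap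

section

open scoped MonObj

/-! ### Morphisms to affine schemes as homomorphisms of algebras -/

section Functions

variable {A B D : Type} [CommRing A] [Algebra ℂ A] [CommRing B] [Algebra ℂ B]
  [CommRing D] [Algebra ℂ D] {Z Z' : Over SpecC}

/-- The algebra of global functions on a scheme over `ℂ`. -/
def Fn (Z : Over SpecC) : Type := Γ(Z.left, ⊤)

instance : CommRing (Fn Z) := inferInstanceAs (CommRing Γ(Z.left, ⊤))

instance : Algebra ℂ (Fn Z) :=
  RingHom.toAlgebra ((Scheme.ΓSpecIso (.of ℂ)).inv ≫ Scheme.Hom.appTop (Y := SpecC) Z.hom).hom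

lemma pullFun_algebraMap_eq (y : Z ⟶ specOver A) (r : ℂ) :
    pullFun y (algebraMap ℂ A r) = algebraMap ℂ (Fn Z) r := by
  have h : y.left ≫ Spec.map (CommRingCat.ofHom (algebraMap ℂ A)) = Z.hom := Over.w y
  have h2 : (pullFun y).comp (algebraMap ℂ A) = algebraMap ℂ (Fn Z) := by
    change _ = ((Scheme.ΓSpecIso (.of ℂ)).inv ≫ Scheme.Hom.appTop (Y := SpecC) Z.hom).hom
    rw [← h]
    exact congrArg CommRingCat.Hom.hom (comp_appTop_specAlgebraMap (A := A) y.left)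
  exact congrArg (fun k => k r) h2

/-- `pullFun` as a homomorphism of `ℂ`-algebras. -/
def pullAlg (y : Z ⟶ specOver A) : A →ₐ[ℂ] Fn Z :=
  { (pullFun y : A →+* Γ(Z.left, ⊤)) with commutes' := pullFun_algebraMap_eq y }

/-- Pullback of functions along a morphism. -/
def Fn.map (g : Z' ⟶ Z) : Fn Z →ₐ[ℂ] Fn Z' :=
  { (g.left.appTop.hom : Γ(Z.left, ⊤) →+* Γ(Z'.left, ⊤)) with
    commutes' := fun r => by
      have h : ((Scheme.ΓSpecIso (.of ℂ)).inv ≫ Scheme.Hom.appTop (Y := SpecC) Z.hom) ≫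
          g.left.appTop =
          (Scheme.ΓSpecIso (.of ℂ)).inv ≫ Scheme.Hom.appTop (Y := SpecC) Z'.hom := by
        rw [Category.assoc]
        exact congrArg ((Scheme.ΓSpecIso (.of ℂ)).inv ≫ ·)
          ((Scheme.Hom.comp_appTop g.left Z.hom).symm.trans
            (congrArg Scheme.Hom.appTop (Over.w g)))
      exact congrArg (fun k => k.hom r) h }

lemma pullAlg_comp (g : Z' ⟶ Z) (y : Z ⟶ specOver A) :
    pullAlg (g ≫ y) = (Fn.map g).comp (pullAlg y) := by
  ext a
  change ((g ≫ y).left.appTop.hom) _ = g.left.appTop.hom (y.left.appTop.hom _)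
  rw [Over.comp_left, Scheme.Hom.comp_appTop]
  rfl

lemma pullAlg_comp_specMap (y : Z ⟶ specOver A) (f : B →ₐ[ℂ] A) :
    pullAlg (y ≫ specMap f) = (pullAlg y).comp f := by
  ext b
  have h := Scheme.ΓSpecIso_inv_naturality (CommRingCat.ofHom f.toRingHom)
  have h2 := congrArg (fun k => y.left.appTop.hom (k.hom b)) h
  refine Eq.trans ?_ h2.symm
  change (y.left ≫ (specMap f).left).appTop.hom ((Scheme.ΓSpecIso (.of B)).inv.hom b) = _
  rw [Scheme.Hom.comp_appTop]
  rfl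

/-- The morphism to an affine scheme given by an algebra homomorphism to the functions. -/
def toSpecOver (f : A →ₐ[ℂ] Fn Z) : Z ⟶ specOver A :=
  Over.homMk (Z.left.toSpecΓ ≫ Spec.map (CommRingCat.ofHom (f.toRingHom : A →+* Γ(Z.left, ⊤)))) (by
    let φ : CommRingCat.of A ⟶ Γ(Z.left, ⊤) :=
      CommRingCat.ofHom (f.toRingHom : A →+* Γ(Z.left, ⊤))
    change (Z.left.toSpecΓ ≫ Spec.map φ) ≫ Spec.map (CommRingCat.ofHom (algebraMap ℂ A)) = Z.hom
    have h : CommRingCat.ofHom (algebraMap ℂ A) ≫ φ =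
        (Scheme.ΓSpecIso (.of ℂ)).inv ≫ Scheme.Hom.appTop (Y := SpecC) Z.hom := by
      ext r
      exact f.commutes r
    rw [Category.assoc, ← Spec.map_comp, h, Spec.map_comp, ← Scheme.toSpecΓ_naturality_assoc]
    exact (congrArg (Z.hom ≫ ·) (toSpecΓ_SpecMap_ΓSpecIso_inv (.of ℂ))).trans
      (Category.comp_id _))

lemma pullAlg_toSpecOver (f : A →ₐ[ℂ] Fn Z) : pullAlg (toSpecOver f) = f := by
  ext a
  change (Z.left.toSpecΓ ≫ Spec.map (CommRingCat.ofHom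
    (f.toRingHom : A →+* Γ(Z.left, ⊤)))).appTop.hom ((Scheme.ΓSpecIso (.of A)).inv.hom a) = _
  have h := Scheme.ΓSpecIso_inv_naturality (CommRingCat.ofHom (f.toRingHom : A →+* Γ(Z.left, ⊤)))
  rw [Scheme.Hom.comp_appTop]
  have h2 := congrArg (fun k => Z.left.toSpecΓ.appTop.hom (k.hom a)) h
  refine h2.symm.trans ?_
  simp only [CommRingCat.hom_comp, RingHom.comp_apply]
  rw [Scheme.toSpecΓ_appTop]
  have := Iso.inv_hom_id (Scheme.ΓSpecIso Γ(Z.left, ⊤))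
  exact congrArg (fun k => k.hom (f a)) this

lemma pullAlg_injective {y y' : Z ⟶ specOver A} (h : pullAlg y = pullAlg y') : y = y' := by
  ext1
  refine ext_to_Spec ?_
  ext a
  exact congrArg (fun k => k a) h

lemma toSpecOver_pullAlg (y : Z ⟶ specOver A) : toSpecOver (pullAlg y) = y :=
  pullAlg_injective (pullAlg_toSpecOver _)

/-- The canonical morphism to the spectrum of the functions. -/
def canon (Z : Over SpecC) : Z ⟶ specOver (Fn Z) := toSpecOver (AlgHom.id ℂ _)

lemma canon_comp_specMap (f : A →ₐ[ℂ] Fn Z) : canon Z ≫ specMap f = toSpecOver f := by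
  apply pullAlg_injective
  rw [pullAlg_comp_specMap, canon, pullAlg_toSpecOver, pullAlg_toSpecOver]
  rfl

/-- Functions on `Spec B`. -/
def fnSpec (B : Type) [CommRing B] [Algebra ℂ B] : B ≃ₐ[ℂ] Fn (specOver B) :=
  AlgEquiv.ofBijective (pullAlg (𝟙 (specOver B))) (by
    have h : ∀ b, pullAlg (𝟙 (specOver B)) b = (Scheme.ΓSpecIso (.of B)).inv.hom b := by
      intro b
      change (𝟙 (Spec (.of B)) : Spec (.of B) ⟶ _).appTop.hom _ = _
      rw [Scheme.Hom.id_appTop]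
      rfl
    have h2 : Function.Bijective (Scheme.ΓSpecIso (.of B)).inv.hom :=
      ConcreteCategory.bijective_of_isIso (Scheme.ΓSpecIso (.of B)).inv
    exact (funext h : ⇑(pullAlg (𝟙 (specOver B))) = _) ▸ h2)

lemma pullAlg_specMap (f : A →ₐ[ℂ] B) :
    pullAlg (specMap f) = (fnSpec B : B →ₐ[ℂ] Fn (specOver B)).comp f := by
  rw [← Category.id_comp (specMap f), pullAlg_comp_specMap]
  rfl

lemma pullAlg_specMap_apply (f : A →ₐ[ℂ] B) (a : A) :
    pullAlg (specMap f) a = fnSpec B (f a) := by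
  rw [pullAlg_specMap]; rfl

lemma Fn.map_specMap (f : A →ₐ[ℂ] B) (a : A) :
    Fn.map (specMap f) (fnSpec A a) = fnSpec B (f a) := by
  have := pullAlg_comp (specMap f) (𝟙 _)
  rw [Category.comp_id] at this
  rw [← pullAlg_specMap_apply, this]
  rfl

/-- The algebra homomorphism given by a morphism of affine schemes. -/
def algOf (y : specOver B ⟶ specOver A) : A →ₐ[ℂ] B :=
  ((fnSpec B).symm : Fn (specOver B) →ₐ[ℂ] B).comp (pullAlg y)

lemma specMap_algOf (y : specOver B ⟶ specOver A) : specMap (algOf y) = y := by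
  apply pullAlg_injective
  rw [pullAlg_specMap]
  ext a
  exact (fnSpec B).apply_symm_apply _

lemma algOf_specMap (f : A →ₐ[ℂ] B) : algOf (specMap f) = f := by
  ext a
  simp [algOf, pullAlg_specMap]

lemma pullAlg_eq_algOf (y : specOver B ⟶ specOver A) (a : A) :
    pullAlg y a = fnSpec B (algOf y a) := ((fnSpec B).apply_symm_apply _).symm

lemma algOf_comp (y : specOver B ⟶ specOver A) (z : specOver D ⟶ specOver B) :
    algOf (z ≫ y) = (algOf z).comp (algOf y) := by
  conv_lhs => rw [← specMap_algOf y, ← specMap_algOf z, ← specMap_comp, algOf_specMap]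

lemma specMap_injective {f g : A →ₐ[ℂ] B} (h : specMap f = specMap g) : f = g := by
  rw [← algOf_specMap f, h, algOf_specMap]

lemma exists_specMap_eq (y : specOver B ⟶ specOver A) : ∃ f : A →ₐ[ℂ] B, specMap f = y :=
  ⟨_, specMap_algOf y⟩

end Functions

/-! ### Points of the torus and their characters -/

section TorusPoints

variable {X : Type} [AddCommGroup X] {Z Z' : Over SpecC}

/-- Points of the spectrum of a Hopf algebra multiply by convolution, and `single l 1` is
group-like. -/
lemma algOf_mul {B : Type} [CommRing B] [Algebra ℂ B]
    (t t' : specOver B ⟶ Torus X) (l : X) :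
    algOf (t * t') (AddMonoidAlgebra.single l 1) =
      algOf t (AddMonoidAlgebra.single l 1) * algOf t' (AddMonoidAlgebra.single l 1) := by
  obtain ⟨f, rfl⟩ := exists_specMap_eq t
  obtain ⟨g, rfl⟩ := exists_specMap_eq t'
  have h : specMap f * specMap g =
      specMap (WithConv.toConv f * WithConv.toConv g : WithConv _).ofConv :=
    (map_mul (Spec.mapMulEquiv (R := ℂ) (S := AddMonoidAlgebra ℂ X) (T := B))
      (WithConv.toConv f) (WithConv.toConv g)).symm
  rw [h, algOf_specMap, algOf_specMap, algOf_specMap, AlgHom.convMul_def]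
  simp

lemma canon_comp_specMap_pullAlg {A : Type} [CommRing A] [Algebra ℂ A] (y : Z ⟶ specOver A) :
    canon Z ≫ specMap (pullAlg y) = y := by
  rw [canon_comp_specMap, toSpecOver_pullAlg]

/-- The value of a character at a point of the torus, as an element of `Fn Z`. -/
def chi (t : Z ⟶ Torus X) (l : X) : Fn Z := pullAlg t (AddMonoidAlgebra.single l 1)

lemma chi_comp (g : Z' ⟶ Z) (t : Z ⟶ Torus X) (l : X) :
    chi (g ≫ t) l = Fn.map g (chi t l) :=
  congrArg (fun k => k (AddMonoidAlgebra.single l 1)) (pullAlg_comp g t)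

/-- Both points factor through `canon Z`, which reduces the claim to the affine case `algOf_mul`. -/
lemma chi_mul (t t' : Z ⟶ Torus X) (l : X) :
    chi (t * t') l = chi t l * chi t' l := by
  obtain ⟨f, rfl⟩ : ∃ f, canon Z ≫ specMap f = t := ⟨_, canon_comp_specMap_pullAlg t⟩
  obtain ⟨g, rfl⟩ : ∃ f, canon Z ≫ specMap f = t' := ⟨_, canon_comp_specMap_pullAlg t'⟩
  rw [← MonObj.comp_mul, chi_comp, chi_comp, chi_comp]
  have h := algOf_mul (specMap f) (specMap g) l
  have := congrArg (fnSpec _) h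
  rw [map_mul, ← pullAlg_eq_algOf, ← pullAlg_eq_algOf, ← pullAlg_eq_algOf] at this
  rw [← map_mul]
  exact congrArg (Fn.map (canon Z)) this

lemma chi_zero (t : Z ⟶ Torus X) : chi t 0 = 1 :=
  map_one (pullAlg t)

lemma chi_add (t : Z ⟶ Torus X) (l m : X) :
    chi t (l + m) = chi t l * chi t m := by
  rw [chi, chi, chi, ← map_mul, AddMonoidAlgebra.single_mul_single, mul_one]

lemma torus_ext {t t' : Z ⟶ Torus X} (h : ∀ l, chi t l = chi t' l) :
    t = t' := by
  apply pullAlg_injective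
  exact AddMonoidAlgebra.algHom_ext h (Subsingleton.elim _ _)

/-- The value is idempotent because `1 * 1 = 1`, and invertible with inverse the value at `-l`. -/
lemma chi_one (l : X) : chi (1 : Z ⟶ Torus X) l = 1 := by
  have h := chi_mul (1 : Z ⟶ Torus X) 1 l
  rw [mul_one] at h
  have h2 := chi_add (1 : Z ⟶ Torus X) l (-l)
  rw [add_neg_cancel, chi_zero] at h2
  calc chi (1 : Z ⟶ Torus X) l = chi (1 : Z ⟶ Torus X) l * 1 := by rw [mul_one]
    _ = (chi (1 : Z ⟶ Torus X) l * chi (1 : Z ⟶ Torus X) l) *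
          chi (1 : Z ⟶ Torus X) (-l) := by rw [mul_assoc, ← h2, mul_one]
    _ = 1 := by rw [← h, ← h2]

/-- The point of the torus with given values of the chis. -/
def torusPoint (u : Multiplicative X →* Fn Z) : Z ⟶ Torus X :=
  toSpecOver (AddMonoidAlgebra.lift ℂ (Fn Z) X u)

lemma chi_torusPoint (u : Multiplicative X →* Fn Z) (l : X) :
    chi (torusPoint u) l = u (Multiplicative.ofAdd l) := by
  rw [chi, torusPoint, pullAlg_toSpecOver]
  simp

lemma torus_mul_comm (t t' : Z ⟶ Torus X) : t * t' = t' * t := by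
  apply torus_ext
  intro l
  rw [chi_mul, chi_mul, mul_comm]

/-! ### Actions described on points -/

section Weights

variable {A : Type} [CommRing A] [Algebra ℂ A] [ModObj (Torus X) (specOver A)]

lemma mem_weightSpace_iff {l : X} {a : A} : a ∈ weightSpace A l ↔
    ∀ (Z : Over SpecC) (t : Z ⟶ Torus X) (y : Z ⟶ specOver A),
      pullAlg (t • y) a = chi t l * pullAlg y a := Iff.rfl

lemma comp_smul {P : Over SpecC} [ModObj (Torus X) P] (g : Z' ⟶ Z) (t : Z ⟶ Torus X) (p : Z ⟶ P) :
    g ≫ (t • p) = (g ≫ t) • (g ≫ p) := ModObj.comp_smul g t p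

/-- Yoneda: the condition on all points is the condition on the universal point of `Torus X ⊗ P`. -/
lemma isModHom_iff {P Q : Over SpecC} [ModObj (Torus X) P] [ModObj (Torus X) Q] (f : P ⟶ Q) :
    IsModHom (Torus X) f ↔ ∀ (Z : Over SpecC) (t : Z ⟶ Torus X) (p : Z ⟶ P),
      (t • p) ≫ f = t • (p ≫ f) := by
  refine ⟨fun h Z t p => IsModHom.map_smul f t p, fun h => ⟨?_⟩⟩
  have := h _ (fst (Torus X) P) (snd (Torus X) P)
  rw [Hom.smul_def, Hom.smul_def] at this
  simpa using! this

/-- An action given on points, naturally. -/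
@[reducible] def modObjOfPoints {P : Over SpecC}
    (a : ∀ {Z : Over SpecC}, (Z ⟶ Torus X) → (Z ⟶ P) → (Z ⟶ P))
    (nat : ∀ {Z Z' : Over SpecC} (g : Z' ⟶ Z) (t : Z ⟶ Torus X) (p : Z ⟶ P),
      g ≫ a t p = a (g ≫ t) (g ≫ p))
    (one : ∀ {Z : Over SpecC} (p : Z ⟶ P), a 1 p = p)
    (mul : ∀ {Z : Over SpecC} (t t' : Z ⟶ Torus X) (p : Z ⟶ P), a (t * t') p = a t (a t' p)) :
    ModObj (Torus X) P where
  smul := a (fst _ _) (snd _ _)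
  one_smul := by
    change MonObj.one ▷ P ≫ a (fst _ _) (snd _ _) = (λ_ P).hom
    rw [nat, whiskerRight_fst, whiskerRight_snd, leftUnitor_hom,
      show fst (𝟙_ (Over SpecC)) P ≫ MonObj.one = (1 : _ ⟶ Torus X) by
        rw [Hom.one_def]; congr 1, one]
  mul_smul := by
    change MonObj.mul ▷ P ≫ a (fst _ _) (snd _ _) =
      (α_ _ _ _).hom ≫ _ ◁ a (fst _ _) (snd _ _) ≫ a (fst _ _) (snd _ _)
    rw [nat, nat, nat, whiskerRight_fst, whiskerRight_snd, whiskerLeft_fst, whiskerLeft_snd,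
      nat, nat]
    simp only [associator_hom_fst, associator_hom_snd_fst, associator_hom_snd_snd]
    rw [← mul]
    congr 1
    rw [Hom.mul_def]
    congr 1
    ext1 <;> simp

lemma modObjOfPoints_smul {P : Over SpecC}
    (a : ∀ {Z : Over SpecC}, (Z ⟶ Torus X) → (Z ⟶ P) → (Z ⟶ P))
    (nat : ∀ {Z Z' : Over SpecC} (g : Z' ⟶ Z) (t : Z ⟶ Torus X) (p : Z ⟶ P),
      g ≫ a t p = a (g ≫ t) (g ≫ p))
    (one : ∀ {Z : Over SpecC} (p : Z ⟶ P), a 1 p = p)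
    (mul : ∀ {Z : Over SpecC} (t t' : Z ⟶ Torus X) (p : Z ⟶ P), a (t * t') p = a t (a t' p))
    (t : Z ⟶ Torus X) (p : Z ⟶ P) :
    (letI := modObjOfPoints a nat one mul; t • p) = a t p := by
  let := modObjOfPoints a nat one mul
  change lift t p ≫ a (fst _ _) (snd _ _) = _
  rw [nat, lift_fst, lift_snd]

end Weights

end TorusPoints

end

section

open scoped MonObj

/-! ### The coaction and the decomposition into weight spaces -/

section Coaction

variable {X : Type} [AddCommGroup X] {A : Type} [CommRing A] [Algebra ℂ A] {Z : Over SpecC}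

/-- The universal point of the torus over `Spec A[X]`. -/
def univTorus (X A : Type) [AddCommGroup X] [CommRing A] [Algebra ℂ A] :
    specOver (AddMonoidAlgebra A X) ⟶ Torus X :=
  specMap (AddMonoidAlgebra.lift ℂ _ X (AddMonoidAlgebra.of A X))

/-- The universal point of `Spec A` over `Spec A[X]`. -/
def univPoint (X A : Type) [AddCommGroup X] [CommRing A] [Algebra ℂ A] :
    specOver (AddMonoidAlgebra A X) ⟶ specOver A :=
  specMap AddMonoidAlgebra.singleZeroAlgHom

/-- The homomorphism `A[X] → C` given by a homomorphism on `A` and one on `X`. -/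
def groupRingLift {C : Type} [CommRing C] [Algebra ℂ C] (g : A →ₐ[ℂ] C) (u : Multiplicative X →* C) :
    AddMonoidAlgebra A X →ₐ[ℂ] C :=
  AddMonoidAlgebra.liftNCAlgHom g u fun _ _ => Commute.all _ _

lemma groupRingLift_single {C : Type} [CommRing C] [Algebra ℂ C] (g : A →ₐ[ℂ] C)
    (u : Multiplicative X →* C) (l : X) (a : A) :
    groupRingLift g u (AddMonoidAlgebra.single l a) = g a * u (Multiplicative.ofAdd l) := by
  simp [groupRingLift]

/-- A point of the torus as a homomorphism on the characters. -/
def chiHom (t : Z ⟶ Torus X) : Multiplicative X →* Fn Z where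
  toFun l := chi t l.toAdd
  map_one' := chi_zero t
  map_mul' _ _ := chi_add t _ _

/-- `Spec A[X]` is the product of `T` and `Spec A`, so a pair of points is a pullback of the
universal pair. -/
lemma exists_univ (t : Z ⟶ Torus X) (y : Z ⟶ specOver A) :
    toSpecOver (groupRingLift (pullAlg y) (chiHom t)) ≫ univTorus X A = t ∧
      toSpecOver (groupRingLift (pullAlg y) (chiHom t)) ≫ univPoint X A = y := by
  constructor
  · apply torus_ext
    intro l
    rw [chi, univTorus, pullAlg_comp_specMap, pullAlg_toSpecOver]
    simp [groupRingLift_single, chiHom]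
  · apply pullAlg_injective
    rw [univPoint, pullAlg_comp_specMap, pullAlg_toSpecOver]
    ext a
    have : chi t 0 = 1 := chi_zero t
    simp [groupRingLift_single, chiHom, this]

lemma chi_univTorus (l : X) :
    chi (univTorus X A) l = fnSpec _ (AddMonoidAlgebra.single l (1 : A)) := by
  rw [chi, univTorus, pullAlg_specMap_apply]
  simp

variable [ModObj (Torus X) (specOver A)]

/-- The coaction `A → A[X]`. -/
def coact (X A : Type) [AddCommGroup X] [CommRing A] [Algebra ℂ A]
    [ModObj (Torus X) (specOver A)] : A →ₐ[ℂ] AddMonoidAlgebra A X :=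
  algOf (univTorus X A • univPoint X A)

/-- The component of weight `l`. -/
def comp (l : X) : A →ₗ[ℂ] A where
  toFun a := (coact X A a).coeff l
  map_add' a b := by rw [map_add]; rfl
  map_smul' r a := by rw [map_smul]; rfl

/-- By naturality it is enough to know the action on the universal pair, and this is the coaction.
-/
lemma pullAlg_smul (t : Z ⟶ Torus X) (y : Z ⟶ specOver A) (a : A) :
    pullAlg (t • y) a = ∑ l ∈ (coact X A a).coeff.support, pullAlg y (comp l a) * chi t l := by
  obtain ⟨h1, h2⟩ := exists_univ t y
  have h3 : t • y = toSpecOver (groupRingLift (pullAlg y) (chiHom t)) ≫ specMap (coact X A) := by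
    rw [coact, specMap_algOf, comp_smul, h1, h2]
  rw [h3, pullAlg_comp_specMap, pullAlg_toSpecOver, AlgHom.comp_apply]
  conv_lhs => rw [← (coact X A a).sum_coeff_single]
  rw [Finsupp.sum, map_sum]
  exact Finset.sum_congr rfl fun l _ => groupRingLift_single _ _ _ _

/-- The counit axiom: evaluate `pullAlg_smul` at the unit of the torus. -/
lemma sum_comp (a : A) : ∑ l ∈ (coact X A a).coeff.support, comp l a = a := by
  have h := pullAlg_smul (X := X) 1 (𝟙 (specOver A)) a
  have h1 : ∀ l, chi (1 : specOver A ⟶ Torus X) l = 1 := chi_one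
  simp only [one_smul, h1, mul_one, ← map_sum] at h
  exact ((fnSpec A).injective h).symm

lemma mem_weightSpace_iff_coact {l : X} {a : A} :
    a ∈ weightSpace A l ↔ coact X A a = AddMonoidAlgebra.single l a := by
  rw [mem_weightSpace_iff]
  constructor
  · intro h
    have h1 := h _ (univTorus X A) (univPoint X A)
    rw [pullAlg_eq_algOf, chi_univTorus, univPoint, pullAlg_specMap_apply, ← map_mul] at h1
    refine ((fnSpec _).injective h1).trans ?_
    simp [AddMonoidAlgebra.single_mul_single]
  · intro h Z t y
    have h3 : t • y = toSpecOver (groupRingLift (pullAlg y) (chiHom t)) ≫ specMap (coact X A) := by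
      rw [coact, specMap_algOf, comp_smul, (exists_univ t y).1, (exists_univ t y).2]
    rw [h3, pullAlg_comp_specMap, pullAlg_toSpecOver, AlgHom.comp_apply, h, groupRingLift_single,
      mul_comm]
    rfl

lemma comp_apply (l : X) (a : A) : comp l a = (coact X A a).coeff l := rfl

/-- Coassociativity. Over `A[X][X]` there are two independent universal points of the torus.
Computing the action of their product on `a` in two ways and comparing the coefficients of the outer
`χ^l` gives the claim. -/
lemma coact_comp (l : X) (a : A) : coact X A (comp l a) = AddMonoidAlgebra.single l (comp l a) := by
  classical
  let g := univPoint X (AddMonoidAlgebra A X)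
  let t' := univTorus X (AddMonoidAlgebra A X)
  have h := pullAlg_smul (t' * (g ≫ univTorus X A)) (g ≫ univPoint X A) a
  rw [mul_smul, pullAlg_smul] at h
  have e1 : ∀ b, pullAlg (g ≫ univTorus X A • g ≫ univPoint X A) b =
      fnSpec _ (AddMonoidAlgebra.single 0 (coact X A b)) := by
    intro b
    rw [← comp_smul, pullAlg_comp, AlgHom.comp_apply, pullAlg_eq_algOf]
    exact Fn.map_specMap _ _
  have e2 : ∀ b, pullAlg (g ≫ univPoint X A) b =
      fnSpec _ (AddMonoidAlgebra.single 0 (AddMonoidAlgebra.single 0 b)) := by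
    intro b
    rw [pullAlg_comp, AlgHom.comp_apply, univPoint, pullAlg_specMap_apply]
    exact Fn.map_specMap _ _
  have e3 : ∀ l, chi (g ≫ univTorus X A) l =
      fnSpec _ (AddMonoidAlgebra.single 0 (AddMonoidAlgebra.single l (1 : A))) := by
    intro l
    rw [chi_comp, chi_univTorus]
    exact Fn.map_specMap _ _
  simp only [e1, e2, chi_mul, e3, t', chi_univTorus, ← map_mul, ← map_sum,
    AddMonoidAlgebra.single_mul_single] at h
  have h2 := congrArg (fun z : AddMonoidAlgebra (AddMonoidAlgebra A X) X => z.coeff l) ((fnSpec _).injective h)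
  simp only [zero_add, mul_one, add_zero, one_mul, AddMonoidAlgebra.coeff_sum,
    AddMonoidAlgebra.coeff_single, Finsupp.coe_finsetSum, Finset.sum_apply,
    Finsupp.single_apply, Finset.sum_ite_eq', ] at h2
  by_cases hl : l ∈ (coact X A a).coeff.support
  · rw [if_pos hl, if_pos hl] at h2
    rw [AddMonoidAlgebra.single_mul_single, zero_add, mul_one] at h2
    exact h2
  · have : comp l a = 0 := Finsupp.notMem_support_iff.1 hl
    simp [this]

lemma comp_mem (l : X) (a : A) : comp l a ∈ weightSpace A l :=
  mem_weightSpace_iff_coact.2 (coact_comp l a)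

lemma comp_of_mem {l : X} {a : A} (h : a ∈ weightSpace A l) : comp l a = a := by
  rw [comp_apply, mem_weightSpace_iff_coact.1 h]
  simp

lemma comp_of_mem_ne {l m : X} {a : A} (h : a ∈ weightSpace A l) (hm : m ≠ l) : comp m a = 0 := by
  rw [comp_apply, mem_weightSpace_iff_coact.1 h]
  simp [hm.symm]

lemma one_mem_weightSpace : (1 : A) ∈ weightSpace A (0 : X) := by
  rw [mem_weightSpace_iff]
  intro Z t y
  rw [map_one, map_one, chi_zero, one_mul]

lemma weight_induction {p : A → Prop} (h0 : p 0) (hadd : ∀ a b, p a → p b → p (a + b))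
    (h : ∀ (l : X) (a : A), a ∈ weightSpace A l → p a) (a : A) : p a := by
  rw [← sum_comp (X := X) a]
  exact Finset.sum_induction _ p hadd h0 fun l _ => h l _ (comp_mem l a)

lemma comp_coeAddMonoidHom [DecidableEq X] (x : ⨁ l : X, weightSpace A l) (l : X) :
    comp l (DirectSum.coeAddMonoidHom (weightSpace A : X → Submodule ℂ A) x) = (x l : A) := by
  induction x using DirectSum.induction_on with
  | zero => simp
  | of m y =>
    rw [DirectSum.coeAddMonoidHom_of]
    by_cases hm : l = m
    · subst hm
      simp [comp_of_mem y.2]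
    · rw [comp_of_mem_ne y.2 hm, DirectSum.of_eq_of_ne _ _ _ hm]
      rfl
  | add a b ha hb => simp [ha, hb]

lemma sum_of_comp [DecidableEq X] (a : A) :
    DirectSum.coeAddMonoidHom (weightSpace A : X → Submodule ℂ A)
      (∑ l ∈ (coact X A a).coeff.support,
        DirectSum.of (fun l : X => weightSpace A l) l ⟨comp l a, comp_mem _ _⟩) = a := by
  simp only [map_sum, DirectSum.coeAddMonoidHom_of]
  exact sum_comp a

/-- The decomposition into weight spaces. -/
instance gradedWeight [DecidableEq X] : GradedAlgebra (weightSpace A : X → Submodule ℂ A) where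
  one_mem := one_mem_weightSpace
  mul_mem _ _ _ _ ha hb := weightSpace_mul_mem A ha hb
  decompose' a := ∑ l ∈ (coact X A a).coeff.support,
    DirectSum.of (fun l : X => weightSpace A l) l ⟨comp l a, comp_mem _ _⟩
  left_inv a := sum_of_comp a
  right_inv x := DFinsupp.ext fun l => Subtype.ext <| by
    rw [← comp_coeAddMonoidHom, ← comp_coeAddMonoidHom, sum_of_comp]

/-- An algebra homomorphism given on the weight spaces. -/
lemma exists_algHom_of_weights {C : Type} [CommRing C] [Algebra ℂ C]
    (f : ∀ l : X, weightSpace A l →ₗ[ℂ] C) (h1 : f 0 ⟨1, one_mem_weightSpace⟩ = 1)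
    (hm : ∀ l m (a : weightSpace A l) (b : weightSpace A m),
      f (l + m) ⟨a * b, weightSpace_mul_mem A a.2 b.2⟩ = f l a * f m b) :
    ∃ F : A →ₐ[ℂ] C, ∀ l (a : weightSpace A l), F a = f l a := by
  classical
  refine ⟨(DirectSum.toAlgebra ℂ (fun l : X => weightSpace A l) f h1 fun a b => hm _ _ a b).comp
    (DirectSum.decomposeAlgEquiv (weightSpace A : X → Submodule ℂ A) : A →ₐ[ℂ] _), ?_⟩
  intro l a
  simp [DirectSum.toSemiring]

end Coaction

end

/-! ### Functionals on binary forms and coefficients after dehomogenization -/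

section Homogeneous

/-- The monomial `x^i y^(n-i)`, or `0` if `i > n`. -/
def mono (n : ℤ) (i : ℕ) : homogPoly n :=
  if h : (i : ℤ) ≤ n then
    ⟨MvPolynomial.monomial (Finsupp.single 0 i + Finsupp.single 1 (n.toNat - i)) 1, by
      intro d hd
      have := Finset.mem_singleton.1 (MvPolynomial.support_monomial_subset hd)
      subst this
      simp
      omega⟩
  else 0

lemma mono_of_lt {n : ℤ} {i : ℕ} (h : n < i) : mono n i = 0 := dif_neg (by omega)

lemma mono_coe {n : ℤ} {i : ℕ} (h : (i : ℤ) ≤ n) : (mono n i : MvPolynomial (Fin 2) ℂ) =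
    MvPolynomial.monomial (Finsupp.single 0 i + Finsupp.single 1 (n.toNat - i)) 1 := by
  rw [mono, dif_pos h]

lemma homogPolyMul_mono {m n : ℤ} {i j : ℕ} (hi : (i : ℤ) ≤ m) (hj : (j : ℤ) ≤ n) :
    homogPolyMul (mono m i) (mono n j) = mono (m + n) (i + j) := by
  apply Subtype.ext
  change (mono m i : MvPolynomial (Fin 2) ℂ) * mono n j = _
  rw [mono_coe hi, mono_coe hj, mono_coe (by push_cast; omega), MvPolynomial.monomial_mul, one_mul]
  congr 1
  have : (m + n).toNat - (i + j) = (m.toNat - i) + (n.toNat - j) := by omega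
  rw [this, Finsupp.single_add, Finsupp.single_add, add_add_add_comm]

/-- Dehomogenization `p(x, y) ↦ p(t, 1)`. -/
def dehom : MvPolynomial (Fin 2) ℂ →ₐ[ℂ] Polynomial ℂ :=
  MvPolynomial.aeval ![Polynomial.X, 1]

/-- The functional taking `p(x, y)` to the coefficient of `t^i` in `p(t, 1)`. -/
def coeffDual (n : ℤ) (i : ℕ) : homogDual n :=
  Polynomial.lcoeff ℂ i ∘ₗ dehom.toLinearMap ∘ₗ (homogPoly n).subtype

lemma coeffDual_apply (n : ℤ) (i : ℕ) (p : homogPoly n) :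
    coeffDual n i p = (dehom p.1).coeff i := rfl

lemma dehom_coeff (p : MvPolynomial (Fin 2) ℂ) (i : ℕ) :
    (dehom p).coeff i = ∑ d ∈ p.support, if d 0 = i then p.coeff d else 0 := by
  rw [dehom, MvPolynomial.aeval_def, MvPolynomial.eval₂_eq', Polynomial.finsetSum_coeff]
  refine Finset.sum_congr rfl fun d _ => ?_
  simp [Fin.prod_univ_two, Polynomial.algebraMap_eq, Polynomial.coeff_C_mul, Polynomial.coeff_X_pow,
    eq_comm]

lemma coeffDual_of_lt {n : ℤ} {i : ℕ} (h : n < i) : coeffDual n i = 0 := by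
  ext p
  rw [coeffDual_apply, dehom_coeff]
  refine Finset.sum_eq_zero fun d hd => if_neg ?_
  have := p.2 d hd
  push_cast at this
  omega

/-- In a form of degree `n` the exponent of `x` determines that of `y`, so dehomogenization loses
nothing. -/
lemma coeffDual_eq_monomialDual {n : ℤ} {i j : ℕ} (h : (i : ℤ) + j = n) :
    coeffDual n i = monomialDual n i j := by
  ext p
  rw [coeffDual_apply, dehom_coeff]
  change _ = p.1.coeff (Finsupp.single 0 i + Finsupp.single 1 j)
  rw [Finset.sum_eq_single (Finsupp.single 0 i + Finsupp.single 1 j)]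
  · simp
  · intro d hd hne
    refine if_neg fun h0 => hne ?_
    have := p.2 d hd
    push_cast at this
    ext k
    fin_cases k
    · simp [h0]
    · simp
      omega
  · intro h0
    simp [MvPolynomial.notMem_support_iff.1 h0]

lemma monomialDual_of_ne {n : ℤ} {i j : ℕ} (h : (i : ℤ) + j ≠ n) : monomialDual n i j = 0 := by
  ext p
  change p.1.coeff (Finsupp.single 0 i + Finsupp.single 1 j) = 0
  by_contra h0
  have := p.2 _ (MvPolynomial.mem_support_iff.2 h0)
  apply h
  simpa using this

/-- `p(0, 1)` is the constant term of `p(t, 1)`, hence the relations at `∞` concern constant terms.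
-/
lemma betaInfty_eq (n : ℤ) : betaInfty n = coeffDual n 0 := by
  ext p
  change MvPolynomial.aeval (R := ℂ) ![(0 : ℂ), 1] p.1 = (dehom p.1).coeff 0
  rw [Polynomial.coeff_zero_eq_aeval_zero, ← AlgHom.comp_apply]
  congr 1
  apply MvPolynomial.algHom_ext
  intro i
  fin_cases i <;> simp [dehom]

/-- Dehomogenization is multiplicative, so the coproduct of a coefficient functional is the Cauchy
product. The sum runs over the whole antidiagonal because `coeffDual` makes sense, and vanishes,
beyond the degree. -/
lemma coeffDual_mul {m n : ℤ} (i : ℕ) (p : homogPoly m) (q : homogPoly n) :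
    coeffDual (m + n) i (homogPolyMul p q) =
      ∑ k ∈ Finset.HasAntidiagonal.antidiagonal i, coeffDual m k.1 p * coeffDual n k.2 q := by
  change (dehom (p.1 * q.1)).coeff i = _
  rw [map_mul, Polynomial.coeff_mul]
  rfl

lemma eq_sum_mono {n : ℤ} (p : homogPoly n) :
    p = ∑ i ∈ Finset.range (n.toNat + 1), coeffDual n i p • mono n i := by
  classical
  apply Subtype.ext
  ext d
  rw [AddSubmonoidClass.coe_finsetSum, MvPolynomial.coeff_sum]
  by_cases hd : ((d 0 + d 1 : ℕ) : ℤ) = n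
  · rw [Finset.sum_eq_single (d 0)]
    · rw [coeffDual_eq_monomialDual (i := d 0) (j := d 1) (by push_cast at hd; exact hd)]
      have e : Finsupp.single 0 (d 0) + Finsupp.single 1 (d 1) = d := by
        ext k; fin_cases k <;> simp
      have e2 : n.toNat - d 0 = d 1 := by omega
      change _ = p.1.coeff (Finsupp.single 0 (d 0) + Finsupp.single 1 (d 1)) *
        (mono n (d 0) : MvPolynomial (Fin 2) ℂ).coeff d
      rw [mono_coe (by omega), e2, e]
      simp
    · intro i hi hne
      change coeffDual n i p * (mono n i : MvPolynomial (Fin 2) ℂ).coeff d = 0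
      by_cases hin : (i : ℤ) ≤ n
      · rw [mono_coe hin, MvPolynomial.coeff_monomial, if_neg, mul_zero]
        rintro rfl
        simp at hne
      · rw [mono_of_lt (by omega)]
        simp
    · intro h
      exact absurd (Finset.mem_range.2 (by omega)) h
  · have h0 : p.1.coeff d = 0 := by
      by_contra h0
      exact hd (p.2 _ (MvPolynomial.mem_support_iff.2 h0))
    rw [h0]
    refine (Finset.sum_eq_zero fun i _ => ?_).symm
    have h1 : (mono n i : MvPolynomial (Fin 2) ℂ).coeff d = 0 := by
      by_contra h1
      exact hd ((mono n i).2 _ (MvPolynomial.mem_support_iff.2 h1))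
    change coeffDual n i p * (mono n i : MvPolynomial (Fin 2) ℂ).coeff d = 0
    rw [h1, mul_zero]

lemma eq_sum_coeffDual {n : ℤ} (β : homogDual n) :
    β = ∑ i ∈ Finset.range (n.toNat + 1), β (mono n i) • coeffDual n i := by
  refine LinearMap.ext fun p => ?_
  conv_lhs => rw [eq_sum_mono p]
  simp [mul_comm]

variable {C : Type} [CommRing C] [Algebra ℂ C]

/-- The pairing of a functional on homogeneous polynomials with a polynomial in `t = x / y`. -/
def pair {n : ℤ} (β : homogDual n) : Polynomial C →ₗ[ℂ] C :=
  Polynomial.lsum fun i => β (mono n i) • LinearMap.id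

lemma pair_monomial {n : ℤ} (β : homogDual n) (i : ℕ) (x : C) :
    pair β (Polynomial.monomial i x) = β (mono n i) • x := by
  simp [pair, Polynomial.lsum, Polynomial.sum_monomial_index]

lemma pair_eq_sum {n : ℤ} (β : homogDual n) (f : Polynomial C) :
    pair β f = ∑ i ∈ f.support, β (mono n i) • f.coeff i := by
  simp [pair, Polynomial.lsum, Polynomial.sum_def]

/-- Both sides are bilinear, so monomials suffice. The degree bounds are essential: beyond them
`mono` takes the default value `0` and no longer multiplies correctly. -/
lemma pair_mul {m n : ℤ} (β : homogDual (m + n)) {k : ℕ} (β₁ : Fin k → homogDual m)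
    (β₂ : Fin k → homogDual n)
    (h : ∀ p q, β (homogPolyMul p q) = ∑ i, β₁ i p * β₂ i q) {f g : Polynomial C}
    (hf : ∀ i : ℕ, m < i → f.coeff i = 0) (hg : ∀ i : ℕ, n < i → g.coeff i = 0) :
    pair β (f * g) = ∑ i, pair (β₁ i) f * pair (β₂ i) g := by
  simp_rw [pair_eq_sum (β₁ _), pair_eq_sum (β₂ _), Finset.sum_mul_sum]
  conv_lhs => rw [f.as_sum_support, g.as_sum_support, Finset.sum_mul_sum, map_sum]
  rw [Finset.sum_comm]
  refine Finset.sum_congr rfl fun i hi => ?_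
  rw [map_sum, Finset.sum_comm]
  refine Finset.sum_congr rfl fun j hj => ?_
  have hi' : (i : ℤ) ≤ m := by
    by_contra hlt
    exact (Polynomial.mem_support_iff.1 hi) (hf i (by omega))
  have hj' : (j : ℤ) ≤ n := by
    by_contra hlt
    exact (Polynomial.mem_support_iff.1 hj) (hg j (by omega))
  rw [Polynomial.monomial_mul_monomial, pair_monomial, ← homogPolyMul_mono hi' hj', h,
    Finset.sum_smul]
  refine Finset.sum_congr rfl fun r _ => ?_
  rw [smul_mul_smul_comm]

end Homogeneous

/-! ### `A^σ_c` represents based homomorphisms -/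

section Representability

section Instances

variable {X : Type} [AddCommGroup X] (σ : X →+ ℤ) (A : Type) [CommRing A] [Algebra ℂ A]
  [ModObj (Torus X) (specOver A)] (c : A →ₐ[ℂ] ℂ)

abbrev instCommRingAsigma : CommRing (Asigma σ A) := Ideal.Quotient.commRing _

attribute [local instance] instCommRingAsigma

abbrev instAlgebraAsigma : Algebra ℂ (Asigma σ A) := Ideal.instAlgebraQuotient _ _

attribute [local instance] instAlgebraAsigma

abbrev instCommRingAsigmaC : CommRing (AsigmaC σ c) := Ideal.Quotient.commRing _

attribute [local instance] instCommRingAsigmaC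

abbrev instAlgebraAsigmaC : Algebra ℂ (AsigmaC σ c) := Ideal.instAlgebraQuotient _ _

attribute [local instance] instAlgebraAsigmaC

abbrev instSemiringAsigmaC : Semiring (AsigmaC σ c) := CommRing.toCommSemiring.toSemiring

attribute [local instance] instSemiringAsigmaC

abbrev instAddCommMonoidAsigmaC : AddCommMonoid (AsigmaC σ c) :=
  NonUnitalNonAssocSemiring.toAddCommMonoid

attribute [local instance] instAddCommMonoidAsigmaC

abbrev instModuleAsigmaC : Module ℂ (AsigmaC σ c) := Algebra.toModule

attribute [local instance] instModuleAsigmaC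

end Instances

attribute [local instance] instCommRingAsigma instAlgebraAsigma instCommRingAsigmaC
  instAlgebraAsigmaC instSemiringAsigmaC instAddCommMonoidAsigmaC instModuleAsigmaC

variable {X : Type} [AddCommGroup X] (σ : X →+ ℤ) {A : Type} [CommRing A] [Algebra ℂ A]
  [ModObj (Torus X) (specOver A)] (c : A →ₐ[ℂ] ℂ) {C C' : Type} [CommRing C] [Algebra ℂ C]
  [CommRing C'] [Algebra ℂ C']

/-- The homomorphisms `Φ : A → C[t]` which send `A_l` to polynomials of degree at most `σ(l)` and
whose constant term is given by the point `c`. -/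
structure IsBased (Φ : A →ₐ[ℂ] Polynomial C) : Prop where
  degree : ∀ (l : X) (a : A), a ∈ weightSpace A l → ∀ i : ℕ, σ l < i → (Φ a).coeff i = 0
  base : ∀ a, (Φ a).coeff 0 = algebraMap ℂ C (c a)

variable {σ c}

lemma IsBased.degree_of_mem {Φ : A →ₐ[ℂ] Polynomial C} (h : IsBased σ c Φ) {n : ℤ} {a : A}
    (ha : a ∈ degreePart σ A n) {i : ℕ} (hi : n < i) : (Φ a).coeff i = 0 := by
  have : degreePart σ A n ≤ LinearMap.ker (((Polynomial.lcoeff C i).restrictScalars ℂ) ∘ₗ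
      Φ.toLinearMap) := by
    refine iSup₂_le fun l hl a ha => ?_
    exact h.degree l a ha i (by omega)
  exact this ha

/-- The linear map on the generators given by a based homomorphism. -/
def genLift (Φ : A →ₐ[ℂ] Polynomial C) : GenSpace σ A →ₗ[ℂ] C :=
  DirectSum.toModule ℂ ℤ C fun n => TensorProduct.lift
    (LinearMap.mk₂ ℂ (fun (a : degreePart σ A n) (β : homogDual n) => pair β (Φ a))
      (fun a b β => by simp) (fun r a β => by simp)
      (fun a β β' => by simp [pair_eq_sum, add_smul, Finset.sum_add_distrib])
      (fun r a β => by simp [pair_eq_sum, Finset.smul_sum, smul_smul]))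

lemma lift_genLift_symGen (Φ : A →ₐ[ℂ] Polynomial C) (n : ℤ) (a : degreePart σ A n)
    (β : homogDual n) :
    SymmetricAlgebra.lift (genLift (σ := σ) Φ) (symGen σ n a β) = pair β (Φ a) := by
  simp [symGen, genLift]

/-- The relations of `J` translate into multiplicativity of `Φ` by `pair_mul`, whose degree bounds
are those of a based homomorphism. -/
lemma lift_genLift_idealJ {Φ : A →ₐ[ℂ] Polynomial C} (h : IsBased σ c Φ) :
    ∀ z ∈ idealJ σ A, SymmetricAlgebra.lift (genLift (σ := σ) Φ) z = 0 := by
  have : idealJ σ A ≤ RingHom.ker (SymmetricAlgebra.lift (genLift (σ := σ) Φ)) := by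
    refine Ideal.span_le.2 ?_
    rintro z ⟨n₁, n₂, a₁, a₂, β, k, β₁, β₂, hβ, rfl⟩
    change SymmetricAlgebra.lift (genLift (σ := σ) Φ) _ = 0
    rw [map_sub, map_sum, lift_genLift_symGen, sub_eq_zero]
    simp only [map_mul, lift_genLift_symGen]
    change pair β (Φ (a₁.1 * a₂.1)) = _
    rw [map_mul]
    exact pair_mul β β₁ β₂ hβ (fun i hi => h.degree_of_mem a₁.2 hi)
      (fun i hi => h.degree_of_mem a₂.2 hi)
  exact this

/-- The homomorphism on `A^σ` given by a based homomorphism. -/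
def asigmaLift {Φ : A →ₐ[ℂ] Polynomial C} (h : IsBased σ c Φ) : Asigma σ A →ₐ[ℂ] C :=
  Ideal.Quotient.liftₐ (idealJ σ A) (SymmetricAlgebra.lift (genLift (σ := σ) Φ))
    (lift_genLift_idealJ h)

lemma pair_betaInfty (n : ℤ) {f : Polynomial C} (hf : ∀ i : ℕ, n < i → f.coeff i = 0) :
    pair (betaInfty n) f = f.coeff 0 := by
  have h : ∀ i, i ≠ 0 → betaInfty n (mono n i) = 0 := by
    intro i hi
    by_cases hin : (i : ℤ) ≤ n
    · rw [betaInfty_eq, coeffDual_apply, mono_coe hin]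
      simp [dehom, MvPolynomial.aeval_monomial, Finsupp.prod_add_index', pow_add, hi.symm]
    · rw [mono_of_lt (by omega), map_zero]
  rw [pair_eq_sum, Finset.sum_eq_single 0]
  · by_cases hn : 0 ≤ n
    · have : betaInfty n (mono n 0) = 1 := by
        rw [betaInfty_eq, coeffDual_apply, mono_coe (by simpa using hn)]
        simp [dehom, MvPolynomial.aeval_monomial]
      rw [this, one_smul]
    -- For negative `n` the pairing only sees default values, but the bound also kills the constant
    -- term of `f`.
    · rw [hf 0 (by simpa using hn), smul_zero]
  · intro i _ hi
    rw [h i hi, zero_smul]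
  · intro h0
    rw [Polynomial.notMem_support_iff.1 h0, smul_zero]

/-- The homomorphism on `A^σ_c` given by a based homomorphism. -/
def asigmaCLift {Φ : A →ₐ[ℂ] Polynomial C} (h : IsBased σ c Φ) : AsigmaC σ c →ₐ[ℂ] C :=
  Ideal.Quotient.liftₐ (idealC σ c) (asigmaLift h) (by
    have : idealC σ c ≤ RingHom.ker (asigmaLift h) := by
      refine Ideal.span_le.2 ?_
      rintro z ⟨l, a, ha, rfl⟩
      change asigmaLift h _ = 0
      rw [map_sub, AlgHom.commutes, sub_eq_zero]
      refine (lift_genLift_symGen Φ _ _ _).trans ?_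
      rw [pair_betaInfty _ (h.degree l a ha), h.base]
    exact this)

lemma asigmaCLift_gen {Φ : A →ₐ[ℂ] Polynomial C} (h : IsBased σ c Φ) (n : ℤ)
    (a : degreePart σ A n) (β : homogDual n) : asigmaCLift h (gen σ c n a β) = pair β (Φ a) :=
  lift_genLift_symGen Φ n a β

/-! ### The generators of `A^σ_c` -/

variable (σ c) in
/-- The element `a ⊗ β` as a bilinear map. -/
def genBilin (n : ℤ) : degreePart σ A n →ₗ[ℂ] homogDual n →ₗ[ℂ] AsigmaC σ c :=
  (TensorProduct.mk ℂ (degreePart σ A n) (homogDual n)).compr₂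
    ((Ideal.Quotient.mkₐ ℂ (idealC σ c)).toLinearMap ∘ₗ
      (Ideal.Quotient.mkₐ ℂ (idealJ σ A)).toLinearMap ∘ₗ SymmetricAlgebra.ι ℂ _ ∘ₗ
      DirectSum.lof ℂ ℤ (fun n => degreePart σ A n ⊗[ℂ] homogDual n) n)

lemma genBilin_apply (n : ℤ) (a : degreePart σ A n) (β : homogDual n) :
    genBilin σ c n a β = gen σ c n a β := rfl

lemma gen_eq_sum (n : ℤ) (a : degreePart σ A n) (β : homogDual n) :
    gen σ c n a β = ∑ i ∈ Finset.range (n.toNat + 1), β (mono n i) • gen σ c n a (coeffDual n i) := by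
  rw [← genBilin_apply]
  conv_lhs => rw [eq_sum_coeffDual β, map_sum]
  simp [genBilin_apply]

/-- The elements `a ⊗ β` generate, weight vectors span each `A_n`, and the functionals `coeffDual`
span the dual spaces. -/
lemma algHom_ext_gen {f g : AsigmaC σ c →ₐ[ℂ] C}
    (h : ∀ (l : X) (a : A) (ha : a ∈ weightSpace A l) (i : ℕ),
      f (gen σ c (σ l) ⟨a, weightSpace_le_degreePart σ ha⟩ (coeffDual (σ l) i)) =
      g (gen σ c (σ l) ⟨a, weightSpace_le_degreePart σ ha⟩ (coeffDual (σ l) i))) : f = g := by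
  refine Ideal.Quotient.algHom_ext _ (Ideal.Quotient.algHom_ext _ (SymmetricAlgebra.algHom_ext ?_))
  refine DirectSum.linearMap_ext ℂ fun n => TensorProduct.ext' fun a β => ?_
  change f (gen σ c n a β) = g (gen σ c n a β)
  obtain ⟨a, ha⟩ := a
  -- The locus where the two maps agree is a subspace of `A_n`, so it suffices that it contains the
  -- weight spaces that span `A_n`.
  have key : degreePart σ A n ≤ (LinearMap.eqLocus (f.toLinearMap ∘ₗ (genBilin σ c n).flip β)
      (g.toLinearMap ∘ₗ (genBilin σ c n).flip β)).map (degreePart σ A n).subtype := by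
    refine iSup₂_le fun l hl a ha => ?_
    clear * - h hl ha
    subst hl
    refine ⟨⟨a, weightSpace_le_degreePart σ ha⟩, ?_, rfl⟩
    change f (gen σ c _ _ _) = g (gen σ c _ _ _)
    rw [gen_eq_sum, map_sum, map_sum]
    refine Finset.sum_congr rfl fun i _ => ?_
    rw [map_smul, map_smul, h l a ha]
  obtain ⟨⟨a', ha'⟩, h1, rfl⟩ := key ha
  exact h1

lemma gen_mul {m n : ℤ} (a : degreePart σ A m) (b : degreePart σ A n) (i : ℕ) :
    gen σ c (m + n) (degreePartMul σ A a b) (coeffDual (m + n) i) =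
      ∑ k ∈ Finset.HasAntidiagonal.antidiagonal i,
        gen σ c m a (coeffDual m k.1) * gen σ c n b (coeffDual n k.2) := by
  let s := Finset.HasAntidiagonal.antidiagonal i
  -- The relations of `J` use sums indexed by `Fin k`, so the antidiagonal has to be enumerated.
  let e := s.equivFin
  have hs : ∀ {M : Type} [AddCommMonoid M] (f : ℕ × ℕ → M),
      ∑ k ∈ s, f k = ∑ j, f (e.symm j).1 := by
    intro M _ f
    rw [← Finset.sum_coe_sort s f]
    exact (Equiv.sum_comp e.symm (fun k : s => f k.1)).symm
  have hJ : symGen σ (m + n) (degreePartMul σ A a b) (coeffDual (m + n) i) -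
      ∑ j, symGen σ m a (coeffDual m (e.symm j).1.1) * symGen σ n b (coeffDual n (e.symm j).1.2) ∈
      idealJ σ A := by
    refine Ideal.subset_span ⟨m, n, a, b, _, _, fun j => coeffDual m (e.symm j).1.1,
      fun j => coeffDual n (e.symm j).1.2, fun p q => ?_, rfl⟩
    rw [coeffDual_mul]
    exact hs (fun k => coeffDual m k.1 p * coeffDual n k.2 q)
  let q : SymmetricAlgebra ℂ (GenSpace σ A) →+* AsigmaC σ c :=
    (Ideal.Quotient.mk (idealC σ c)).comp (Ideal.Quotient.mk (idealJ σ A))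
  have h2 := congrArg (Ideal.Quotient.mk (idealC σ c)) ((Ideal.Quotient.eq).2 hJ)
  change q _ = q _ at h2
  rw [map_sum] at h2
  simp only [map_mul] at h2
  exact h2.trans (hs (fun k => gen σ c m a (coeffDual m k.1) * gen σ c n b (coeffDual n k.2))).symm

lemma gen_coeffDual_zero {l : X} {a : A} (ha : a ∈ weightSpace A l) :
    gen σ c (σ l) ⟨a, weightSpace_le_degreePart σ ha⟩ (coeffDual (σ l) 0) =
      algebraMap ℂ (AsigmaC σ c) (c a) := by
  rw [← betaInfty_eq]
  exact (Ideal.Quotient.eq).2 (Ideal.subset_span ⟨l, a, ha, rfl⟩)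

/-- Change of coefficients. -/
abbrev polyMap (h : C →ₐ[ℂ] C') : Polynomial C →ₐ[ℂ] Polynomial C' := Polynomial.mapAlgHom h

lemma polyMap_coeff (h : C →ₐ[ℂ] C') (f : Polynomial C) (i : ℕ) :
    (polyMap h f).coeff i = h (f.coeff i) := by
  simp [polyMap]

lemma IsBased.map {Φ : A →ₐ[ℂ] Polynomial C} (h : IsBased σ c Φ) (f : C →ₐ[ℂ] C') :
    IsBased σ c ((polyMap f).comp Φ) where
  degree l a ha i hi := by
    rw [AlgHom.comp_apply, polyMap_coeff, h.degree l a ha i hi, map_zero]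
  base a := by rw [AlgHom.comp_apply, polyMap_coeff, h.base, AlgHom.commutes]

lemma algHom_ext_weight {f g : A →ₐ[ℂ] C} (h : ∀ (l : X) a, a ∈ weightSpace A l → f a = g a) :
    f = g :=
  AlgHom.ext fun a => weight_induction (X := X) (by simp) (fun a b ha hb => by simp [ha, hb]) h a

variable {U : Type} [CommRing U] [Algebra ℂ U]

section Weight

variable (b : ∀ n, degreePart σ A n →ₗ[ℂ] homogDual n →ₗ[ℂ] U)

/-- The universal based homomorphism on a weight space. -/
def univWeight (l : X) : weightSpace A l →ₗ[ℂ] Polynomial U :=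
  ∑ i ∈ Finset.range ((σ l).toNat + 1),
    ((Polynomial.monomial (R := U) i).restrictScalars ℂ) ∘ₗ (b (σ l)).flip (coeffDual (σ l) i) ∘ₗ
      (Submodule.inclusion fun _ h => weightSpace_le_degreePart σ h)

lemma univWeight_coeff (l : X) (a : weightSpace A l) (i : ℕ) :
    (univWeight b l a).coeff i =
      b (σ l) ⟨a, weightSpace_le_degreePart σ a.2⟩ (coeffDual (σ l) i) := by
  rw [univWeight, LinearMap.sum_apply, Polynomial.finsetSum_coeff]
  simp only [LinearMap.comp_apply, LinearMap.restrictScalars_apply, Polynomial.coeff_monomial,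
    Finset.sum_ite_eq', Finset.mem_range]
  split_ifs with h
  · rfl
  · rw [coeffDual_of_lt (by omega), map_zero]

/-- The prescribed coefficients define `Φ` on each weight space, and `hmul` is multiplicativity
there. The unit has weight `0`: its higher coefficients vanish by degree and its constant term is `c
1 = 1`. -/
lemma exists_univBased
    (hmul : ∀ {m n : ℤ} (a : degreePart σ A m) (a' : degreePart σ A n) (i : ℕ),
      b (m + n) (degreePartMul σ A a a') (coeffDual (m + n) i) =
        ∑ k ∈ Finset.HasAntidiagonal.antidiagonal i,
          b m a (coeffDual m k.1) * b n a' (coeffDual n k.2))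
    (hzero : ∀ {l : X} {a : A} (ha : a ∈ weightSpace A l),
      b (σ l) ⟨a, weightSpace_le_degreePart σ ha⟩ (coeffDual (σ l) 0) = algebraMap ℂ U (c a)) :
    ∃ Φ : A →ₐ[ℂ] Polynomial U, IsBased σ c Φ ∧ ∀ (l : X) (a : A) (ha : a ∈ weightSpace A l) i,
      (Φ a).coeff i = b (σ l) ⟨a, weightSpace_le_degreePart σ ha⟩ (coeffDual (σ l) i) := by
  -- Products live in degree `σ l + σ m` instead of `σ (l + m)`, and the generators have to be moved
  -- between the two indices.
  have hcongr : ∀ {m n : ℤ} (h : m = n) {a : degreePart σ A m} {a' : degreePart σ A n}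
      (_ : a.1 = a'.1) (i : ℕ), b m a (coeffDual m i) = b n a' (coeffDual n i) := by
    intro m n h a a' haa' i
    subst h
    rw [Subtype.ext haa']
  obtain ⟨Φ, hΦ⟩ := exists_algHom_of_weights (univWeight b) (by
      ext i
      rw [univWeight_coeff, Polynomial.coeff_one]
      split_ifs with h
      · subst h
        exact (hzero one_mem_weightSpace).trans (by simp)
      · rw [coeffDual_of_lt (by rw [map_zero]; omega), map_zero]) (by
      intro l m a a'
      ext i
      rw [univWeight_coeff, Polynomial.coeff_mul]
      simp only [univWeight_coeff]
      rw [← hmul]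
      exact hcongr (map_add σ l m) rfl i)
  have hc : ∀ (l : X) (a : A) (ha : a ∈ weightSpace A l) i,
      (Φ a).coeff i = b (σ l) ⟨a, weightSpace_le_degreePart σ ha⟩ (coeffDual (σ l) i) := by
    intro l a ha i
    rw [hΦ l ⟨a, ha⟩, univWeight_coeff]
  refine ⟨Φ, ⟨fun l a ha i hi => ?_, fun a => ?_⟩, hc⟩
  · rw [hc l a ha, coeffDual_of_lt hi, map_zero]
  · refine weight_induction (X := X) (p := fun a => (Φ a).coeff 0 = algebraMap ℂ U (c a)) (by simp)
      (fun a b ha hb => ?_) (fun l a ha => ?_) a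
    · rw [map_add, Polynomial.coeff_add, ha, hb, map_add, map_add]
    · rw [hc l a ha, hzero ha]

end Weight

variable (σ c) in
/-- `Φ : A → U[t]` is a universal based homomorphism with coefficients `b n a β`. -/
structure IsUniversal (b : ∀ n, degreePart σ A n → homogDual n → U) (Φ : A →ₐ[ℂ] Polynomial U) :
    Prop where
  based : IsBased σ c Φ
  coeff : ∀ (l : X) (a : A) (ha : a ∈ weightSpace A l) (i : ℕ),
    (Φ a).coeff i = b (σ l) ⟨a, weightSpace_le_degreePart σ ha⟩ (coeffDual (σ l) i)
  exists_lift : ∀ {C : Type} [CommRing C] [Algebra ℂ C] (Ψ : A →ₐ[ℂ] Polynomial C),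
    IsBased σ c Ψ → ∃ h : U →ₐ[ℂ] C, (polyMap h).comp Φ = Ψ ∧
      ∀ n a β, h (b n a β) = pair β (Ψ a)
  hom_ext : ∀ {C : Type} [CommRing C] [Algebra ℂ C] {f g : U →ₐ[ℂ] C},
    (polyMap f).comp Φ = (polyMap g).comp Φ → f = g

lemma pair_coeffDual {n : ℤ} (i : ℕ) {f : Polynomial C} (hf : ∀ i : ℕ, n < i → f.coeff i = 0) :
    pair (coeffDual n i) f = f.coeff i := by
  rw [pair_eq_sum]
  have h : ∀ j ∈ f.support, coeffDual n i (mono n j) • f.coeff j =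
      if j = i then f.coeff j else 0 := by
    intro j hj
    have hjn : (j : ℤ) ≤ n := by
      by_contra hlt
      exact (Polynomial.mem_support_iff.1 hj) (hf j (by omega))
    rw [coeffDual_apply, mono_coe hjn]
    simp [dehom, MvPolynomial.aeval_monomial, Finsupp.prod_add_index', pow_add,
      Polynomial.coeff_X_pow, eq_comm]
  rw [Finset.sum_congr rfl h, Finset.sum_ite_eq']
  split_ifs with hi
  · rfl
  · exact (Polynomial.notMem_support_iff.1 hi).symm

variable (σ c) in
-- Existence of lifts is the presentation of `A^σ_c` by generators and relations; their uniqueness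
-- holds because the coefficients of `Φ` on weight vectors generate the algebra.
theorem exists_isUniversal : ∃ Φ : A →ₐ[ℂ] Polynomial (AsigmaC σ c),
    IsUniversal σ c (gen σ c) Φ := by
  obtain ⟨Φ, hΦ, hc⟩ := exists_univBased (c := c) (U := AsigmaC σ c) (genBilin σ c)
    (fun a a' i => gen_mul a a' i) (fun ha => gen_coeffDual_zero ha)
  refine ⟨Φ, hΦ, hc, fun {C} _ _ Ψ hΨ => ⟨asigmaCLift hΨ, ?_, asigmaCLift_gen hΨ⟩,
    fun {C} _ _ f g hfg => algHom_ext_gen fun l a ha i => ?_⟩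
  · refine algHom_ext_weight (X := X) fun l a ha => Polynomial.ext fun i => ?_
    rw [AlgHom.comp_apply, polyMap_coeff, hc l a ha]
    exact (asigmaCLift_gen hΨ _ _ _).trans (pair_coeffDual i (hΨ.degree l a ha))
  · have := congrArg (fun k => (k a).coeff i) hfg
    simp only [AlgHom.comp_apply, polyMap_coeff, hc l a ha] at this
    exact this

end Representability

section

open scoped MonObj

/-! ### The scaling action and its limit -/

section Contraction

attribute [local instance] instCommRingAsigma instAlgebraAsigma instCommRingAsigmaC
  instAlgebraAsigmaC instSemiringAsigmaC instAddCommMonoidAsigmaC instModuleAsigmaC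

variable {X : Type} [AddCommGroup X] {σ : X →+ ℤ} {A : Type} [CommRing A] [Algebra ℂ A]
  [ModObj (Torus X) (specOver A)] {c : A →ₐ[ℂ] ℂ} {C : Type} [CommRing C] [Algebra ℂ C]
  {U : Type} [CommRing U] [Algebra ℂ U]
  {b : ∀ n, degreePart σ A n →ₗ[ℂ] homogDual n →ₗ[ℂ] U} {Φ : A →ₐ[ℂ] Polynomial U}

lemma IsUniversal.hom_ext_coeff (hU : IsUniversal σ c (fun n a β => b n a β) Φ)
    {f g : U →ₐ[ℂ] C} (h : ∀ a i, f ((Φ a).coeff i) = g ((Φ a).coeff i)) : f = g :=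
  hU.hom_ext <| AlgHom.ext fun a => Polynomial.ext fun i => by
    rw [AlgHom.comp_apply, AlgHom.comp_apply, polyMap_coeff, polyMap_coeff, h]

/-- The substitution `t ↦ u t`. -/
def scale (u : C) : Polynomial C →ₐ[ℂ] Polynomial C :=
  (Polynomial.aeval (R := C) (Polynomial.C u * Polynomial.X)).restrictScalars ℂ

lemma scale_coeff (u : C) (f : Polynomial C) (i : ℕ) :
    (scale u f).coeff i = f.coeff i * u ^ i := by
  change (Polynomial.aeval (Polynomial.C u * Polynomial.X) f).coeff i = _
  rw [← Polynomial.comp_C_mul_X_coeff, Polynomial.comp_eq_aeval]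

/-- The coefficient of `t^i` is multiplied by `u^i`, so vanishing is kept and the constant term is
unchanged. As `u` need not be invertible, the action will extend to the affine line. -/
lemma IsBased.scale {Ψ : A →ₐ[ℂ] Polynomial C} (h : IsBased σ c Ψ) (u : C) :
    IsBased σ c ((BasedQuasimap.scale u).comp Ψ) where
  degree l a ha i hi := by
    rw [AlgHom.comp_apply, scale_coeff, h.degree l a ha i hi, zero_mul]
  base a := by rw [AlgHom.comp_apply, scale_coeff, h.base, pow_zero, mul_one]

lemma IsUniversal.exists_scale (hU : IsUniversal σ c (fun n a β => b n a β) Φ) (u : C)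
    (f : U →ₐ[ℂ] C) :
    ∃ g : U →ₐ[ℂ] C, ∀ a i, g ((Φ a).coeff i) = f ((Φ a).coeff i) * u ^ i := by
  obtain ⟨g, hg, -⟩ := hU.exists_lift _ ((hU.based.map f).scale u)
  refine ⟨g, fun a i => ?_⟩
  have := congrArg (fun k => (k a).coeff i) hg
  simpa only [AlgHom.comp_apply, polyMap_coeff, scale_coeff] using this

/-- The point `y` scaled by `u`. -/
def IsUniversal.act (hU : IsUniversal σ c (fun n a β => b n a β) Φ) {Z : Over SpecC} (u : Fn Z)
    (y : Z ⟶ specOver U) : Z ⟶ specOver U :=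
  toSpecOver (hU.exists_scale u (pullAlg y)).choose

lemma IsUniversal.pullAlg_act (hU : IsUniversal σ c (fun n a β => b n a β) Φ) {Z : Over SpecC}
    (u : Fn Z) (y : Z ⟶ specOver U) (a : A) (i : ℕ) :
    pullAlg (hU.act u y) ((Φ a).coeff i) = pullAlg y ((Φ a).coeff i) * u ^ i := by
  rw [IsUniversal.act, pullAlg_toSpecOver]
  exact (hU.exists_scale u (pullAlg y)).choose_spec a i

lemma IsUniversal.comp_act (hU : IsUniversal σ c (fun n a β => b n a β) Φ) {Z Z' : Over SpecC}
    (g : Z' ⟶ Z) (u : Fn Z) (y : Z ⟶ specOver U) :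
    g ≫ hU.act u y = hU.act (Fn.map g u) (g ≫ y) := by
  refine pullAlg_injective (hU.hom_ext_coeff fun a i => ?_)
  rw [pullAlg_comp, AlgHom.comp_apply, hU.pullAlg_act, hU.pullAlg_act, pullAlg_comp, map_mul,
    map_pow, AlgHom.comp_apply]

/-- The action of `ℂ^×` on the spectrum of the universal algebra. -/
@[reducible] def IsUniversal.modObj (hU : IsUniversal σ c (fun n a β => b n a β) Φ) :
    ModObj (Torus ℤ) (specOver U) :=
  modObjOfPoints (fun t y => hU.act (chi t 1) y)
    (fun g t y => by rw [hU.comp_act, chi_comp])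
    (fun y => pullAlg_injective (hU.hom_ext_coeff fun a i => by
      rw [hU.pullAlg_act, chi_one, one_pow, mul_one]))
    (fun t t' y => pullAlg_injective (hU.hom_ext_coeff fun a i => by
      rw [hU.pullAlg_act, hU.pullAlg_act, hU.pullAlg_act, chi_mul, mul_pow, mul_assoc,
        mul_comm (chi t 1 ^ i)]))

lemma IsUniversal.modObj_smul (hU : IsUniversal σ c (fun n a β => b n a β) Φ) {Z : Over SpecC}
    (t : Z ⟶ Torus ℤ) (y : Z ⟶ specOver U) :
    (let := hU.modObj; t • y) = hU.act (chi t 1) y := by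
  change lift t y ≫ hU.act (chi (fst _ _) 1) (snd _ _) = _
  rw [hU.comp_act, ← chi_comp, lift_fst, lift_snd]

lemma chi_natCast {Z : Over SpecC} (t : Z ⟶ Torus ℤ) (i : ℕ) : chi t (i : ℤ) = chi t 1 ^ i := by
  induction i with
  | zero => simpa using chi_zero t
  | succ i ih => rw [Nat.cast_succ, chi_add, ih, pow_succ]

/-- The limit point is the one classified by the constant homomorphism `c`, the scaling of any based
homomorphism by `u = 0`. -/
theorem IsUniversal.exists_contraction (hU : IsUniversal σ c (fun n a β => b n a β) Φ)
    (hneg : ∀ (l : X) (a : A), a ∈ weightSpace A l → σ l < 0 → c a = 0) :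
    ∃ z : U →ₐ[ℂ] ℂ,
      (∀ (n : ℕ) (a : degreePart σ A n) (β : homogDual n), z (b n a β) = c a * β (yPow n)) ∧
      ∃ _ : ModObj (Torus ℤ) (specOver U),
        (∀ (n : ℤ) (a : degreePart σ A n) (i j : ℕ),
          b n a (monomialDual n i j) ∈ weightSpace U (i : ℤ)) ∧
        ContractsTo U z := by
  -- A nonzero constant has degree `0`, which exceeds `σ l` exactly when `σ l` is negative; there
  -- `hneg` applies.
  have hconst : IsBased σ c (Polynomial.CAlgHom.comp c : A →ₐ[ℂ] Polynomial ℂ) := by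
    refine ⟨fun l a ha i hi => ?_, fun a => ?_⟩
    · rw [AlgHom.comp_apply, Polynomial.CAlgHom_apply, Polynomial.coeff_C]
      split_ifs with h0
      · exact hneg l a ha (by subst h0; simpa using hi)
      · rfl
    · simp
  obtain ⟨z, hz, hz2⟩ := hU.exists_lift _ hconst
  refine ⟨z, fun n a β => ?_, hU.modObj, ?_, ?_⟩
  · rw [hz2, AlgHom.comp_apply, Polynomial.CAlgHom_apply, ← Polynomial.monomial_zero_left,
      pair_monomial]
    have : mono n 0 = yPow n := by
      apply Subtype.ext
      rw [mono_coe (by simp)]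
      simp [yPow, MvPolynomial.X_pow_eq_monomial]
    rw [this, smul_eq_mul, mul_comm]
  · intro n a i j
    let := hU.modObj
    by_cases hij : (i : ℤ) + j = n
    · rw [← coeffDual_eq_monomialDual hij]
      have key : degreePart σ A n ≤ ((weightSpace U (i : ℤ)).comap
          ((b n).flip (coeffDual n i))).map (degreePart σ A n).subtype := by
        refine iSup₂_le fun l hl a ha => ?_
        clear * - hl ha hU
        subst hl
        refine ⟨⟨a, weightSpace_le_degreePart σ ha⟩, ?_, rfl⟩
        change b _ _ _ ∈ weightSpace U (i : ℤ)
        rw [← hU.coeff l a ha i, mem_weightSpace_iff]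
        intro Z t y
        rw [hU.modObj_smul, hU.pullAlg_act, chi_natCast, mul_comm]
      obtain ⟨a', h1, h2⟩ := key a.2
      rw [← Subtype.ext (a1 := a') h2]
      exact h1
    · rw [monomialDual_of_ne hij, map_zero]
      exact zero_mem _
  · let := hU.modObj
    -- The extension is scaling by the coordinate function of the affine line.
    refine ⟨hU.act (pullAlg (fst _ _) Polynomial.X) (snd _ _), fun Z t y => ?_, ?_⟩
    · rw [hU.comp_act, lift_snd, ← AlgHom.comp_apply, ← pullAlg_comp, lift_fst,
        pullAlg_comp_specMap]
      refine Eq.trans ?_ (hU.modObj_smul t y).symm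
      simp [chi]
    · rw [hU.comp_act, lift_snd, ← AlgHom.comp_apply, ← pullAlg_comp, lift_fst]
      refine pullAlg_injective (hU.hom_ext_coeff fun a i => ?_)
      have hza := congrArg (fun k => (k a).coeff i) hz
      simp only [AlgHom.comp_apply, polyMap_coeff, Polynomial.CAlgHom_apply,
        Polynomial.coeff_C] at hza
      rw [hU.pullAlg_act, constMap, pullAlg_specMap_apply, pullAlg_specMap_apply,
        AlgHom.comp_apply, hza, Polynomial.aeval_X, map_zero]
      split_ifs with h0
      · subst h0
        rw [hU.based.base, pow_zero, mul_one, AlgHom.commutes]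
        exact ((fnSpec U).commutes _).symm
      · rw [zero_pow h0, mul_zero, map_zero, map_zero]

theorem asigmaC_contraction {X : Type} [AddCommGroup X] (σ : X →+ ℤ) (A : Type) [CommRing A]
    [Algebra ℂ A] [ModObj (Torus X) (specOver A)] (c : A →ₐ[ℂ] ℂ)
    (hneg : ∀ (l : X) (a : A), a ∈ weightSpace A l → σ l < 0 → c a = 0) :
    ∃ z : AsigmaC σ c →ₐ[ℂ] ℂ,
        (∀ (n : ℕ) (a : degreePart σ A n) (β : homogDual n),
          z (gen σ c n a β) = c a * β (yPow n)) ∧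
        ∃ _ : ModObj (Torus ℤ) (specOver (AsigmaC σ c)),
          (∀ (n : ℤ) (a : degreePart σ A n) (i j : ℕ),
            gen σ c n a (monomialDual n i j) ∈ weightSpace (AsigmaC σ c) (i : ℤ)) ∧
          ContractsTo (AsigmaC σ c) z := by
  obtain ⟨Φ, hΦ⟩ := exists_isUniversal σ c
  exact IsUniversal.exists_contraction (b := genBilin σ c) hΦ hneg

end Contraction

end

section

open Limits

/-! ### Gluing morphisms along open covers -/

section Gluing

/-- A family of open immersions which covers `Z`. -/
structure IsOpenCover {ι : Type} {Z : Over SpecC} {U : ι → Over SpecC} (a : ∀ i, U i ⟶ Z) :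
    Prop where
  isOpen : ∀ i, IsOpenImmersion (a i).left
  exists_mem : ∀ z : Z.left, ∃ i, z ∈ Set.range (a i).left

variable {ι : Type} {Z W B : Over SpecC} {U : ι → Over SpecC}

/-- The underlying open cover. -/
def IsOpenCover.openCover {a : ∀ i, U i ⟶ Z} (h : IsOpenCover a) : Z.left.OpenCover where
  I₀ := ι
  X i := (U i).left
  f i := (a i).left
  mem₀ := by
    rw [Scheme.presieve₀_mem_precoverage_iff]
    exact ⟨h.exists_mem, h.isOpen⟩

lemma IsOpenCover.hom_ext {a : ∀ i, U i ⟶ Z} (h : IsOpenCover a) {f g : Z ⟶ W}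
    (hfg : ∀ i, a i ≫ f = a i ≫ g) : f = g :=
  Over.OverMorphism.ext <| h.openCover.hom_ext _ _ fun i =>
    congrArg (fun k => Over.Hom.left k) (hfg i)

lemma isPullback_left {P Q R S : Over SpecC} {f : P ⟶ Q} {g : P ⟶ R} {h : Q ⟶ S} {k : R ⟶ S}
    (H : IsPullback f g h k) : IsPullback f.left g.left h.left k.left :=
  H.map (Over.forget SpecC)

lemma IsOpenCover.of_isPullback {j : ∀ i, U i ⟶ B} (h : IsOpenCover j) {b : Z ⟶ B}
    {V : ι → Over SpecC} {a : ∀ i, V i ⟶ Z} {u : ∀ i, V i ⟶ U i}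
    (H : ∀ i, IsPullback (a i) (u i) b (j i)) : IsOpenCover a where
  isOpen i := by
    have := h.isOpen i
    exact MorphismProperty.of_isPullback (P := @IsOpenImmersion) (isPullback_left (H i)).flip this
  exists_mem z := by
    obtain ⟨i, x, hx⟩ := h.exists_mem (b.left z)
    obtain ⟨y, hy, -⟩ := Scheme.Pullback.exists_preimage_pullback z x hx.symm
    refine ⟨i, (isPullback_left (H i)).isoPullback.inv y, ?_⟩
    rw [← Scheme.Hom.comp_apply, IsPullback.isoPullback_inv_fst, hy]

lemma IsOpenCover.pullback {j : ∀ i, U i ⟶ B} (h : IsOpenCover j) (b : Z ⟶ B) :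
    IsOpenCover (fun i => pullback.fst b (j i)) :=
  h.of_isPullback fun i => IsPullback.of_hasPullback b (j i)

lemma IsOpenCover.local_ext {j : ∀ i, U i ⟶ B} (h : IsOpenCover j) (b : Z ⟶ B) {f g : Z ⟶ W}
    (hfg : ∀ (V : Over SpecC) (v : V ⟶ Z) (i : ι) (u : V ⟶ U i), v ≫ b = u ≫ j i →
      v ≫ f = v ≫ g) : f = g :=
  (h.pullback b).hom_ext fun i => hfg _ _ i (pullback.snd b (j i)) pullback.condition

lemma IsOpenCover.glue {a : ∀ i, U i ⟶ Z} (h : IsOpenCover a) (w : ∀ i, U i ⟶ W)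
    (hw : ∀ (V : Over SpecC) i k (p : V ⟶ U i) (q : V ⟶ U k), p ≫ a i = q ≫ a k →
      p ≫ w i = q ≫ w k) : ∃ f : Z ⟶ W, ∀ i, a i ≫ f = w i := by
  let f : Z.left ⟶ W.left := h.openCover.glueMorphisms (fun i => (w i).left) (by
    intro i k
    let V : Over SpecC := Over.mk (pullback.fst (a i).left (a k).left ≫ (U i).hom)
    let p : V ⟶ U i := Over.homMk (pullback.fst (a i).left (a k).left) rfl
    let q : V ⟶ U k := Over.homMk (pullback.snd (a i).left (a k).left) (by
      change pullback.snd (a i).left (a k).left ≫ (U k).hom =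
        pullback.fst (a i).left (a k).left ≫ (U i).hom
      rw [← Over.w (a i), ← Over.w (a k), ← Category.assoc, ← Category.assoc,
        pullback.condition])
    exact congrArg (fun k => Over.Hom.left k)
      (hw V i k p q (Over.OverMorphism.ext pullback.condition)))
  have hf : ∀ i, (a i).left ≫ f = (w i).left := fun i =>
    h.openCover.ι_glueMorphisms (fun i => (w i).left) _ i
  refine ⟨Over.homMk f (h.openCover.hom_ext _ _ fun i => ?_), fun i => Over.OverMorphism.ext (hf i)⟩
  change (a i).left ≫ f ≫ W.hom = (a i).left ≫ Z.hom
  rw [reassoc_of% hf i, Over.w, Over.w]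

/-- Solutions of a condition that is stable under restriction and has at most one solution agree on
overlaps, so local existence gives a global morphism. All later descent arguments take this form. -/
lemma IsOpenCover.glue_of_unique {j : ∀ i, U i ⟶ B} (h : IsOpenCover j) (b : Z ⟶ B)
    (P : ∀ {V : Over SpecC}, (V ⟶ Z) → (V ⟶ W) → Prop)
    (stable : ∀ {V V' : Over SpecC} (g : V' ⟶ V) (v : V ⟶ Z) (w : V ⟶ W), P v w →
      P (g ≫ v) (g ≫ w))
    (uniq : ∀ {V : Over SpecC} (v : V ⟶ Z) (w w' : V ⟶ W), P v w → P v w' → w = w')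
    (exist : ∀ {V : Over SpecC} (v : V ⟶ Z) (i : ι) (u : V ⟶ U i), v ≫ b = u ≫ j i →
      ∃ w, P v w) :
    ∃ f : Z ⟶ W, ∀ {V : Over SpecC} (v : V ⟶ Z) (i : ι) (u : V ⟶ U i), v ≫ b = u ≫ j i →
      P v (v ≫ f) := by
  choose w hw using fun i => exist (pullback.fst b (j i)) i _ pullback.condition
  obtain ⟨f, hf⟩ := (h.pullback b).glue w fun V i k p q hpq =>
    uniq (p ≫ pullback.fst b (j i)) _ _ (stable _ _ _ (hw i)) (hpq ▸ stable _ _ _ (hw k))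
  refine ⟨f, fun {V} v i u hv => ?_⟩
  have := stable (pullback.lift v u hv) _ _ (hw i)
  rw [← hf i, ← Category.assoc, pullback.lift_fst] at this
  exact this

end Gluing

end

section

open Limits

/-! ### Gluing two schemes along an open subscheme -/

section Pushout

variable {U V W : Scheme.{0}} (f : U ⟶ V) (g : U ⟶ W) [IsOpenImmersion f] [IsOpenImmersion g]

instance isOpenImmersion_pushout_inl : IsOpenImmersion (pushout.inl f g) :=
  inferInstanceAs (IsOpenImmersion (colimit.ι (span f g) .left))

instance isOpenImmersion_pushout_inr : IsOpenImmersion (pushout.inr f g) :=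
  inferInstanceAs (IsOpenImmersion (colimit.ι (span f g) .right))

lemma mem_range_pushout (z : (pushout f g : Scheme)) :
    z ∈ Set.range (pushout.inl f g) ∨ z ∈ Set.range (pushout.inr f g) := by
  obtain ⟨i, x, hx⟩ := Scheme.IsLocallyDirected.ι_jointly_surjective (span f g) z
  obtain _ | (_ | _) := i
  · refine Or.inl ⟨f x, ?_⟩
    rw [← hx]
    exact congrArg (fun k : U ⟶ pushout f g => k x) (colimit.w (span f g) WalkingSpan.Hom.fst)
  · exact Or.inl ⟨x, hx⟩
  · exact Or.inr ⟨x, hx⟩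

lemma exists_of_pushout_eq {x : V} {y : W} (h : pushout.inl f g x = pushout.inr f g y) :
    ∃ z : U, f z = x ∧ g z = y := by
  obtain ⟨k, fi, fj, z, hz, hz'⟩ :=
    (Scheme.IsLocallyDirected.ι_eq_ι_iff (span f g) (i := .left) (j := .right)).1 h
  have key : ∀ (k : WalkingSpan) (fi : WidePushoutShape.Hom k (some .left))
      (fj : WidePushoutShape.Hom k (some .right)) (z : (span f g).obj k),
      (span f g).map fi z = x → (span f g).map fj z = y → ∃ z : U, f z = x ∧ g z = y := by
    rintro _ (_ | _) ⟨⟩ z hz hz'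
    exact ⟨z, hz, hz'⟩
  exact key k fi fj z hz hz'

/-- A point in the image of both pieces comes from `U`, so gluing makes no further identifications.
-/
lemma isPullback_pushout : IsPullback f g (pushout.inl f g) (pushout.inr f g) := by
  refine IsOpenImmersion.isPullback _ _ _ _ pushout.condition.symm (TopologicalSpace.Opens.ext (Set.ext fun y => ?_))
  constructor
  · rintro ⟨x, hx⟩
    obtain ⟨z, -, hz⟩ := exists_of_pushout_eq f g hx
    exact ⟨z, hz⟩
  · rintro ⟨z, rfl⟩
    exact ⟨f z, congrArg (fun k : U ⟶ pushout f g => k z) pushout.condition⟩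

end Pushout

/-! ### Schemes covered by two open subschemes -/

section TwoCover

variable {S V₀ V₁ O : Over SpecC}

/-- `S` is the union of two open subschemes `V₀` and `V₁` with intersection `O`. -/
structure IsTwoCover (o₀ : O ⟶ V₀) (o₁ : O ⟶ V₁) (j₀ : V₀ ⟶ S) (j₁ : V₁ ⟶ S) : Prop where
  isOpen₀ : IsOpenImmersion j₀.left
  isOpen₁ : IsOpenImmersion j₁.left
  exists_mem : ∀ z : S.left, z ∈ Set.range j₀.left ∨ z ∈ Set.range j₁.left
  isPullback : IsPullback o₀ o₁ j₀ j₁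

/-- Gluing two schemes along an open subscheme. -/
lemma exists_glue (o₀ : O ⟶ V₀) (o₁ : O ⟶ V₁) [IsOpenImmersion o₀.left] [IsOpenImmersion o₁.left] :
    ∃ (S : Over SpecC) (j₀ : V₀ ⟶ S) (j₁ : V₁ ⟶ S), IsTwoCover o₀ o₁ j₀ j₁ :=
  ⟨Over.mk (pushout.desc V₀.hom V₁.hom (f := o₀.left) (g := o₁.left)
      ((Over.w o₀).trans (Over.w o₁).symm)),
    Over.homMk (pushout.inl o₀.left o₁.left) (pushout.inl_desc _ _ _),
    Over.homMk (pushout.inr o₀.left o₁.left) (pushout.inr_desc _ _ _),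
    inferInstanceAs (IsOpenImmersion (pushout.inl _ _)),
    inferInstanceAs (IsOpenImmersion (pushout.inr _ _)),
    mem_range_pushout _ _,
    IsPullback.of_map (Over.forget SpecC) (Over.OverMorphism.ext pushout.condition)
      (isPullback_pushout o₀.left o₁.left)⟩

/-- The two-element family of two morphisms to the same scheme. -/
def pairMap (j₀ : V₀ ⟶ S) (j₁ : V₁ ⟶ S) : ∀ b : Bool, (bif b then V₁ else V₀) ⟶ S
  | false => j₀
  | true => j₁

namespace IsTwoCover

variable {o₀ : O ⟶ V₀} {o₁ : O ⟶ V₁} {j₀ : V₀ ⟶ S} {j₁ : V₁ ⟶ S} {Z W : Over SpecC}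

lemma isOpenCover (h : IsTwoCover o₀ o₁ j₀ j₁) : IsOpenCover (pairMap j₀ j₁) where
  isOpen := by
    rintro (_ | _)
    exacts [h.isOpen₀, h.isOpen₁]
  exists_mem z := (h.exists_mem z).elim (fun h => ⟨false, h⟩) fun h => ⟨true, h⟩

lemma symm (h : IsTwoCover o₀ o₁ j₀ j₁) : IsTwoCover o₁ o₀ j₁ j₀ :=
  ⟨h.isOpen₁, h.isOpen₀, fun z => (h.exists_mem z).symm, h.isPullback.flip⟩

lemma ext_left (h : IsTwoCover o₀ o₁ j₀ j₁) {u u' : Z ⟶ V₀} (hu : u ≫ j₀ = u' ≫ j₀) : u = u' := by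
  have := h.isOpen₀
  exact Over.OverMorphism.ext ((cancel_mono j₀.left).1 (congrArg (fun k => Over.Hom.left k) hu))

lemma ext_right (h : IsTwoCover o₀ o₁ j₀ j₁) {u u' : Z ⟶ V₁} (hu : u ≫ j₁ = u' ≫ j₁) : u = u' :=
  h.symm.ext_left hu

lemma exists_overlap (h : IsTwoCover o₀ o₁ j₀ j₁) {u : Z ⟶ V₀} {u' : Z ⟶ V₁}
    (hu : u ≫ j₀ = u' ≫ j₁) : ∃ o : Z ⟶ O, o ≫ o₀ = u ∧ o ≫ o₁ = u' :=
  ⟨h.isPullback.lift u u' hu, h.isPullback.lift_fst _ _ _, h.isPullback.lift_snd _ _ _⟩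

lemma local_ext (h : IsTwoCover o₀ o₁ j₀ j₁) (b : Z ⟶ S) {f g : Z ⟶ W}
    (h₀ : ∀ (V : Over SpecC) (v : V ⟶ Z) (u : V ⟶ V₀), v ≫ b = u ≫ j₀ → v ≫ f = v ≫ g)
    (h₁ : ∀ (V : Over SpecC) (v : V ⟶ Z) (u : V ⟶ V₁), v ≫ b = u ≫ j₁ → v ≫ f = v ≫ g) :
    f = g :=
  h.isOpenCover.local_ext b fun V v i => match i with
    | false => h₀ V v
    | true => h₁ V v

lemma glue_of_unique (h : IsTwoCover o₀ o₁ j₀ j₁) (b : Z ⟶ S)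
    (P : ∀ {V : Over SpecC}, (V ⟶ Z) → (V ⟶ W) → Prop)
    (stable : ∀ {V V' : Over SpecC} (g : V' ⟶ V) (v : V ⟶ Z) (w : V ⟶ W), P v w →
      P (g ≫ v) (g ≫ w))
    (uniq : ∀ {V : Over SpecC} (v : V ⟶ Z) (w w' : V ⟶ W), P v w → P v w' → w = w')
    (exist₀ : ∀ {V : Over SpecC} (v : V ⟶ Z) (u : V ⟶ V₀), v ≫ b = u ≫ j₀ → ∃ w, P v w)
    (exist₁ : ∀ {V : Over SpecC} (v : V ⟶ Z) (u : V ⟶ V₁), v ≫ b = u ≫ j₁ → ∃ w, P v w) :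
    ∃ f : Z ⟶ W,
      (∀ {V : Over SpecC} (v : V ⟶ Z) (u : V ⟶ V₀), v ≫ b = u ≫ j₀ → P v (v ≫ f)) ∧
      ∀ {V : Over SpecC} (v : V ⟶ Z) (u : V ⟶ V₁), v ≫ b = u ≫ j₁ → P v (v ≫ f) := by
  obtain ⟨f, hf⟩ := h.isOpenCover.glue_of_unique b P stable uniq fun {V} v i => match i with
    | false => exist₀ v
    | true => exist₁ v
  exact ⟨f, fun v => hf v false, fun v => hf v true⟩

lemma exists_hom (h : IsTwoCover o₀ o₁ j₀ j₁) (w₀ : V₀ ⟶ W) (w₁ : V₁ ⟶ W)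
    (hw : o₀ ≫ w₀ = o₁ ≫ w₁) : ∃ f : S ⟶ W, j₀ ≫ f = w₀ ∧ j₁ ≫ f = w₁ := by
  obtain ⟨f, hf⟩ := h.isOpenCover.glue (pairMap w₀ w₁) fun V i k => match i, k with
    | false, false => fun p q hpq => by rw [h.ext_left hpq]
    | true, true => fun p q hpq => by rw [h.ext_right hpq]
    | false, true => fun p q hpq => by
      obtain ⟨o, rfl, rfl⟩ := h.exists_overlap hpq
      change (o ≫ o₀) ≫ w₀ = (o ≫ o₁) ≫ w₁
      rw [Category.assoc, hw, Category.assoc]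
    | true, false => fun p q hpq => by
      obtain ⟨o, rfl, rfl⟩ := h.exists_overlap hpq.symm
      change (o ≫ o₁) ≫ w₁ = (o ≫ o₀) ≫ w₀
      rw [Category.assoc, ← hw, Category.assoc]
  exact ⟨f, hf false, hf true⟩

end IsTwoCover

end TwoCover

end

section

open Limits
open scoped MonObj

/-! ### Equivariant morphisms out of a framed principal bundle -/

section Torsor

variable {X : Type} [AddCommGroup X] {S V₀ V₁ O : Over SpecC}

lemma torus_exists_inv {Z : Over SpecC} (t : Z ⟶ Torus X) : ∃ t' : Z ⟶ Torus X, t' * t = 1 := by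
  let u : Multiplicative X →* Fn Z :=
    { toFun := fun l => chi t (-l.toAdd)
      map_one' := by simp [chi_zero]
      map_mul' := fun a b => by rw [toAdd_mul, neg_add, chi_add] }
  refine ⟨torusPoint u, torus_ext fun l => ?_⟩
  rw [chi_mul, chi_torusPoint, chi_one]
  change chi t (-l) * chi t l = 1
  rw [← chi_add, neg_add_cancel, chi_zero]

lemma smul_smul_point {Z P : Over SpecC} [ModObj (Torus X) P] (t t' : Z ⟶ Torus X) (p : Z ⟶ P) :
    t • (t' • p) = (t * t') • p := (mul_smul t t' p).symm

lemma one_smul_point {Z P : Over SpecC} [ModObj (Torus X) P] (p : Z ⟶ P) :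
    (1 : Z ⟶ Torus X) • p = p := one_smul _ p

namespace IsPrincipalBundle

variable {P : Over SpecC} [ModObj (Torus X) P] {π : P ⟶ S}

lemma smul_left_cancel (hπ : IsPrincipalBundle X π) {Z : Over SpecC} {t t' : Z ⟶ Torus X}
    {p : Z ⟶ P} (h : t • p = t' • p) : t = t' :=
  (hπ.simply_transitive Z p (t' • p) (hπ.smul_comp Z t' p).symm).unique h rfl

lemma exists_smul_eq (hπ : IsPrincipalBundle X π) {Z : Over SpecC} {p q : Z ⟶ P}
    (h : p ≫ π = q ≫ π) : ∃ t : Z ⟶ Torus X, t • p = q :=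
  (hπ.simply_transitive Z p q h).exists

end IsPrincipalBundle

/-- A framing of a principal bundle over a union of two open subschemes: sections over these open
subschemes, which differ by `τ` on the intersection. -/
structure IsFraming {P : Over SpecC} [ModObj (Torus X) P] (π : P ⟶ S) (o₀ : O ⟶ V₀) (o₁ : O ⟶ V₁)
    (j₀ : V₀ ⟶ S) (j₁ : V₁ ⟶ S) (τ : O ⟶ Torus X) (e₀ : V₀ ⟶ P) (e₁ : V₁ ⟶ P) : Prop where
  proj₀ : e₀ ≫ π = j₀
  proj₁ : e₁ ≫ π = j₁
  glue : o₀ ≫ e₀ = τ • (o₁ ≫ e₁)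

variable {o₀ : O ⟶ V₀} {o₁ : O ⟶ V₁} {j₀ : V₀ ⟶ S} {j₁ : V₁ ⟶ S} {τ : O ⟶ Torus X}

section Universal

variable {P W : Over SpecC} [ModObj (Torus X) P] {π : P ⟶ S} {e₀ : V₀ ⟶ P} {e₁ : V₁ ⟶ P}

/-- Locally on the base, every point of `P` is a translate of one of the two sections. -/
lemma IsFraming.hom_ext (h : IsTwoCover o₀ o₁ j₀ j₁) (hπ : IsPrincipalBundle X π)
    (he : IsFraming π o₀ o₁ j₀ j₁ τ e₀ e₁) {f g : P ⟶ W}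
    (h₀ : ∀ (V : Over SpecC) (t : V ⟶ Torus X) (u : V ⟶ V₀),
      (t • (u ≫ e₀)) ≫ f = (t • (u ≫ e₀)) ≫ g)
    (h₁ : ∀ (V : Over SpecC) (t : V ⟶ Torus X) (u : V ⟶ V₁),
      (t • (u ≫ e₁)) ≫ f = (t • (u ≫ e₁)) ≫ g) : f = g := by
  refine h.local_ext π (fun V v u hv => ?_) fun V v u hv => ?_
  · obtain ⟨t, rfl⟩ := hπ.exists_smul_eq (p := u ≫ e₀) (q := v) (by rw [hv, Category.assoc, he.proj₀])
    exact h₀ V t u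
  · obtain ⟨t, rfl⟩ := hπ.exists_smul_eq (p := u ≫ e₁) (q := v) (by rw [hv, Category.assoc, he.proj₁])
    exact h₁ V t u

variable [ModObj (Torus X) W]

lemma IsFraming.equivariant_ext (h : IsTwoCover o₀ o₁ j₀ j₁) (hπ : IsPrincipalBundle X π)
    (he : IsFraming π o₀ o₁ j₀ j₁ τ e₀ e₁) {f g : P ⟶ W} (hf : IsModHom (Torus X) f)
    (hg : IsModHom (Torus X) g) (h₀ : e₀ ≫ f = e₀ ≫ g) (h₁ : e₁ ≫ f = e₁ ≫ g) : f = g := by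
  rw [isModHom_iff] at hf hg
  refine he.hom_ext h hπ (fun V t u => ?_) fun V t u => ?_
  · rw [hf, hg, Category.assoc, h₀, Category.assoc]
  · rw [hf, hg, Category.assoc, h₁, Category.assoc]

/-- The morphism has to send `t e₀(u)` to `t w₀(u)` and `t e₁(u)` to `t w₁(u)`. Over the overlap
these prescriptions agree, as `w₀` and `w₁` differ by the same `τ` as the sections. -/
lemma IsFraming.exists_equivariant (h : IsTwoCover o₀ o₁ j₀ j₁) (hπ : IsPrincipalBundle X π)
    (he : IsFraming π o₀ o₁ j₀ j₁ τ e₀ e₁) (w₀ : V₀ ⟶ W) (w₁ : V₁ ⟶ W)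
    (hw : o₀ ≫ w₀ = τ • (o₁ ≫ w₁)) :
    ∃ f : P ⟶ W, IsModHom (Torus X) f ∧ e₀ ≫ f = w₀ ∧ e₁ ≫ f = w₁ := by
  obtain ⟨f, hf₀, hf₁⟩ := h.glue_of_unique (W := W) π
    -- The graph of the wanted morphism, tested in both frames after any further base change. The
    -- base change makes the condition stable under restriction.
    (fun {V} v w =>
      (∀ (V' : Over SpecC) (g : V' ⟶ V) (t : V' ⟶ Torus X) (u : V' ⟶ V₀), g ≫ v = t • (u ≫ e₀) →
        g ≫ w = t • (u ≫ w₀)) ∧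
      ∀ (V' : Over SpecC) (g : V' ⟶ V) (t : V' ⟶ Torus X) (u : V' ⟶ V₁), g ≫ v = t • (u ≫ e₁) →
        g ≫ w = t • (u ≫ w₁))
    (fun g v w hvw => ⟨fun V' g' t u hu => by
        rw [← Category.assoc]; exact hvw.1 V' _ t u (by rwa [Category.assoc]),
      fun V' g' t u hu => by
        rw [← Category.assoc]; exact hvw.2 V' _ t u (by rwa [Category.assoc])⟩)
    (fun {V} v w w' hw hw' => by
      refine h.local_ext (v ≫ π) (fun V' g u hu => ?_) fun V' g u hu => ?_
      · obtain ⟨t, ht⟩ := hπ.exists_smul_eq (p := u ≫ e₀) (q := g ≫ v)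
          (by rw [Category.assoc, Category.assoc, hu, he.proj₀])
        rw [hw.1 V' g t u ht.symm, hw'.1 V' g t u ht.symm]
      · obtain ⟨t, ht⟩ := hπ.exists_smul_eq (p := u ≫ e₁) (q := g ≫ v)
          (by rw [Category.assoc, Category.assoc, hu, he.proj₁])
        rw [hw.2 V' g t u ht.symm, hw'.2 V' g t u ht.symm])
    (fun {V} v u hu => by
      obtain ⟨t, rfl⟩ := hπ.exists_smul_eq (p := u ≫ e₀) (q := v)
        (by rw [Category.assoc, hu, he.proj₀])
      refine ⟨t • (u ≫ w₀), fun V' g t' u' hg => ?_, fun V' g t' u' hg => ?_⟩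
      · have hp := congrArg (· ≫ π) hg
        simp only [Category.assoc, hπ.smul_comp, he.proj₀] at hp
        obtain rfl : g ≫ u = u' := h.ext_left (by rw [Category.assoc, hp])
        rw [comp_smul, ← Category.assoc] at hg
        rw [hπ.smul_left_cancel hg.symm, comp_smul, Category.assoc]
      · have hp := congrArg (· ≫ π) hg
        simp only [Category.assoc, hπ.smul_comp, he.proj₀, he.proj₁] at hp
        -- A point expressed in both frames lies over the overlap; there `e₀` is rewritten as `τ e₁`
        -- and `w₀` as `τ w₁`.
        obtain ⟨o, ho, rfl⟩ := h.exists_overlap (u := g ≫ u) (u' := u')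
          (by rw [Category.assoc, hp])
        rw [comp_smul, ← Category.assoc, ← ho, Category.assoc, he.glue, comp_smul, smul_smul_point,
          ← Category.assoc] at hg
        rw [hπ.smul_left_cancel hg.symm, comp_smul, ← Category.assoc, ← ho, Category.assoc, hw,
          comp_smul, smul_smul_point, Category.assoc])
    (fun {V} v u hu => by
      obtain ⟨t, rfl⟩ := hπ.exists_smul_eq (p := u ≫ e₁) (q := v)
        (by rw [Category.assoc, hu, he.proj₁])
      refine ⟨t • (u ≫ w₁), fun V' g t' u' hg => ?_, fun V' g t' u' hg => ?_⟩
      · have hp := congrArg (· ≫ π) hg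
        simp only [Category.assoc, hπ.smul_comp, he.proj₀, he.proj₁] at hp
        obtain ⟨o, rfl, ho⟩ := h.exists_overlap (u := u') (u' := g ≫ u)
          (by rw [Category.assoc, hp])
        rw [comp_smul, ← Category.assoc, ← ho, Category.assoc, Category.assoc o o₀, he.glue,
          comp_smul, smul_smul_point] at hg
        rw [comp_smul, ← Category.assoc, ← ho, hπ.smul_left_cancel hg, Category.assoc,
          Category.assoc, hw, comp_smul, smul_smul_point]
      · have hp := congrArg (· ≫ π) hg
        simp only [Category.assoc, hπ.smul_comp, he.proj₁] at hp
        obtain rfl : g ≫ u = u' := h.ext_right (by rw [Category.assoc, hp])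
        rw [comp_smul, ← Category.assoc] at hg
        rw [hπ.smul_left_cancel hg.symm, comp_smul, Category.assoc])
  have key₀ : ∀ (V : Over SpecC) (t : V ⟶ Torus X) (u : V ⟶ V₀),
      (t • (u ≫ e₀)) ≫ f = t • (u ≫ w₀) := fun V t u => by
    simpa using (hf₀ (t • (u ≫ e₀)) u (by rw [hπ.smul_comp, Category.assoc, he.proj₀])).1 V (𝟙 V) t u
      (Category.id_comp _)
  have key₁ : ∀ (V : Over SpecC) (t : V ⟶ Torus X) (u : V ⟶ V₁),
      (t • (u ≫ e₁)) ≫ f = t • (u ≫ w₁) := fun V t u => by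
    simpa using (hf₁ (t • (u ≫ e₁)) u (by rw [hπ.smul_comp, Category.assoc, he.proj₁])).2 V (𝟙 V) t u
      (Category.id_comp _)
  refine ⟨f, (isModHom_iff f).2 fun Z t p => ?_, ?_, ?_⟩
  · refine h.local_ext (p ≫ π) (fun V v u hu => ?_) fun V v u hu => ?_
    · obtain ⟨t', ht'⟩ := hπ.exists_smul_eq (p := u ≫ e₀) (q := v ≫ p)
        (by rw [Category.assoc, Category.assoc, hu, he.proj₀])
      rw [← Category.assoc, comp_smul, comp_smul, ← Category.assoc, ← ht', smul_smul_point, key₀, key₀,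
        smul_smul_point]
    · obtain ⟨t', ht'⟩ := hπ.exists_smul_eq (p := u ≫ e₁) (q := v ≫ p)
        (by rw [Category.assoc, Category.assoc, hu, he.proj₁])
      rw [← Category.assoc, comp_smul, comp_smul, ← Category.assoc, ← ht', smul_smul_point, key₁, key₁,
        smul_smul_point]
  · simpa using key₀ V₀ 1 (𝟙 _)
  · simpa using key₁ V₁ 1 (𝟙 _)

end Universal

end Torsor

end

section

open Limits
open scoped MonObj

lemma isPullback_of_points {P Q R S : Over SpecC} {f : P ⟶ Q} {g : P ⟶ R} {h : Q ⟶ S} {k : R ⟶ S}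
    (w : f ≫ h = g ≫ k)
    (exist : ∀ (Z : Over SpecC) (x : Z ⟶ Q) (y : Z ⟶ R), x ≫ h = y ≫ k →
      ∃ z : Z ⟶ P, z ≫ f = x ∧ z ≫ g = y)
    (uniq : ∀ (Z : Over SpecC) (z z' : Z ⟶ P), z ≫ f = z' ≫ f → z ≫ g = z' ≫ g → z = z') :
    IsPullback f g h k := by
  choose l hl using exist
  exact ⟨⟨w⟩, ⟨PullbackCone.IsLimit.mk w (fun s => l _ s.fst s.snd s.condition)
    (fun s => (hl _ s.fst s.snd s.condition).1) (fun s => (hl _ s.fst s.snd s.condition).2)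
    fun s m h₁ h₂ => uniq _ _ _ (h₁.trans (hl _ s.fst s.snd s.condition).1.symm)
      (h₂.trans (hl _ s.fst s.snd s.condition).2.symm)⟩⟩

/-! ### Gluing two trivial bundles by a transition function -/

section Construction

variable {X : Type} [AddCommGroup X] {S V₀ V₁ O : Over SpecC} {o₀ : O ⟶ V₀} {o₁ : O ⟶ V₁}
  {j₀ : V₀ ⟶ S} {j₁ : V₁ ⟶ S} (τ : O ⟶ Torus X)

/-- The morphism `T × O ⟶ T × V` given by `(t, x) ↦ (t τ(x), x)`. -/
def twist {V : Over SpecC} (o : O ⟶ V) : Torus X ⊗ O ⟶ Torus X ⊗ V :=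
  lift (fst _ _ * (snd _ _ ≫ τ)) (snd _ _ ≫ o)

lemma comp_twist {V Z : Over SpecC} (o : O ⟶ V) (y : Z ⟶ Torus X ⊗ O) :
    y ≫ twist τ o = lift ((y ≫ fst _ _) * (y ≫ snd _ _ ≫ τ)) (y ≫ snd _ _ ≫ o) := by
  rw [twist, comp_lift, MonObj.comp_mul]

/-- Translation by `τ` is invertible, so `twist` is a base change of `o`, and therefore an open
immersion if `o` is one. -/
lemma isPullback_twist {V : Over SpecC} (o : O ⟶ V) :
    IsPullback (twist τ o) (snd _ _) (snd _ _) o := by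
  refine isPullback_of_points (lift_snd _ _) (fun Z x y hxy => ?_) fun Z z z' h₁ h₂ => ?_
  · obtain ⟨t, ht⟩ := torus_exists_inv (y ≫ τ)
    refine ⟨lift ((x ≫ fst _ _) * t) y, ?_, lift_snd _ _⟩
    rw [comp_twist, lift_fst, lift_snd_assoc, mul_assoc, ht, mul_one, lift_snd_assoc]
    ext1
    · rw [lift_fst]
    · rw [lift_snd, hxy]
  · rw [comp_twist, comp_twist] at h₁
    have h := congrArg (· ≫ fst _ _) h₁
    simp only [lift_fst] at h
    rw [reassoc_of% h₂] at h
    obtain ⟨t, ht⟩ := torus_exists_inv (z' ≫ snd _ _ ≫ τ)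
    ext1
    · rw [torus_mul_comm] at ht
      rw [← mul_one (z ≫ _), ← ht, ← mul_assoc, h, mul_assoc, ht, mul_one]
    · exact h₂

lemma isPullback_whisker {V : Over SpecC} (o : O ⟶ V) :
    IsPullback (Torus X ◁ o) (snd _ _) (snd _ _) o := by
  refine isPullback_of_points (whiskerLeft_snd _ _) (fun Z x y hxy => ?_) fun Z z z' h₁ h₂ => ?_
  · refine ⟨lift (x ≫ fst _ _) y, ?_, lift_snd _ _⟩
    ext1
    · simp
    · simp [hxy]
  · ext1
    · simpa using congrArg (· ≫ fst _ _) h₁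
    · exact h₂

variable {P : Over SpecC} {a₀ : Torus X ⊗ V₀ ⟶ P} {a₁ : Torus X ⊗ V₁ ⟶ P} {π : P ⟶ S}

/-- The gluing of two trivial principal bundles. -/
structure IsGluing (o₀ : O ⟶ V₀) (o₁ : O ⟶ V₁) (j₀ : V₀ ⟶ S) (j₁ : V₁ ⟶ S) (τ : O ⟶ Torus X)
    (a₀ : Torus X ⊗ V₀ ⟶ P) (a₁ : Torus X ⊗ V₁ ⟶ P) (π : P ⟶ S) : Prop where
  base : IsTwoCover o₀ o₁ j₀ j₁
  total : IsTwoCover (Torus X ◁ o₀) (twist τ o₁) a₀ a₁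
  proj₀ : a₀ ≫ π = snd _ _ ≫ j₀
  proj₁ : a₁ ≫ π = snd _ _ ≫ j₁

namespace IsGluing

variable {τ}

lemma glue (h : IsGluing o₀ o₁ j₀ j₁ τ a₀ a₁ π) {Z : Over SpecC} (t : Z ⟶ Torus X) (o : Z ⟶ O) :
    lift t (o ≫ o₀) ≫ a₀ = lift (t * (o ≫ τ)) (o ≫ o₁) ≫ a₁ := by
  have := congrArg (lift t o ≫ ·) h.total.isPullback.w
  simp only [← Category.assoc, comp_twist] at this
  simpa using this

/-- Over `V₀` the glued scheme is still `T × V₀`: a point of the second piece lying over `V₀` lies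
over `O`, and the inverse of `τ` moves it into the first piece. -/
lemma exists_left (h : IsGluing o₀ o₁ j₀ j₁ τ a₀ a₁ π) {Z : Over SpecC} (p : Z ⟶ P) (u : Z ⟶ V₀)
    (hu : p ≫ π = u ≫ j₀) : ∃ t, lift t u ≫ a₀ = p := by
  obtain ⟨y, hy₀, hy₁⟩ := h.total.glue_of_unique (W := Torus X ⊗ V₀) p
    (fun {V} v w => w ≫ a₀ = v ≫ p) (fun g v w hw => by rw [Category.assoc, hw, Category.assoc])
    (fun v w w' hw hw' => h.total.ext_left (hw.trans hw'.symm))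
    (fun v y hy => ⟨y, hy.symm⟩)
    (fun {V} v y hy => by
      have := congrArg (· ≫ π) hy
      simp only [Category.assoc, hu, h.proj₁] at this
      obtain ⟨o, ho₀, ho₁⟩ := h.base.exists_overlap (u := v ≫ u) (u' := y ≫ snd _ _)
        (by simpa using this)
      obtain ⟨t', ht'⟩ := torus_exists_inv (o ≫ τ)
      refine ⟨lift ((y ≫ fst _ _) * t') (o ≫ o₀), ?_⟩
      rw [h.glue, mul_assoc, ht', mul_one, ho₁, hy]
      congr 1
      ext1 <;> simp)
  have hy : y ≫ a₀ = p := h.total.local_ext p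
    (fun V v u hv => by rw [← Category.assoc]; exact hy₀ v u hv)
    (fun V v u hv => by rw [← Category.assoc]; exact hy₁ v u hv)
  have hu' : y ≫ snd _ _ = u := h.base.ext_left (by
    rw [← hu, ← hy, Category.assoc, Category.assoc, h.proj₀])
  refine ⟨y ≫ fst _ _, ?_⟩
  rw [← hy, ← hu']
  congr 1
  ext1 <;> simp

lemma exists_right (h : IsGluing o₀ o₁ j₀ j₁ τ a₀ a₁ π) {Z : Over SpecC} (p : Z ⟶ P) (u : Z ⟶ V₁)
    (hu : p ≫ π = u ≫ j₁) : ∃ t, lift t u ≫ a₁ = p := by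
  obtain ⟨y, hy₀, hy₁⟩ := h.total.glue_of_unique (W := Torus X ⊗ V₁) p
    (fun {V} v w => w ≫ a₁ = v ≫ p) (fun g v w hw => by rw [Category.assoc, hw, Category.assoc])
    (fun v w w' hw hw' => h.total.ext_right (hw.trans hw'.symm))
    (fun {V} v y hy => by
      have := congrArg (· ≫ π) hy
      simp only [Category.assoc, hu, h.proj₀] at this
      obtain ⟨o, ho₀, ho₁⟩ := h.base.exists_overlap (u := y ≫ snd _ _) (u' := v ≫ u)
        (by simpa using this.symm)
      refine ⟨lift ((y ≫ fst _ _) * (o ≫ τ)) (o ≫ o₁), ?_⟩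
      rw [← h.glue, ho₀, hy]
      congr 1
      ext1 <;> simp)
    (fun v y hy => ⟨y, hy.symm⟩)
  have hy : y ≫ a₁ = p := h.total.local_ext p
    (fun V v u hv => by rw [← Category.assoc]; exact hy₀ v u hv)
    (fun V v u hv => by rw [← Category.assoc]; exact hy₁ v u hv)
  have hu' : y ≫ snd _ _ = u := h.base.ext_right (by
    rw [← hu, ← hy, Category.assoc, Category.assoc, h.proj₁])
  refine ⟨y ≫ fst _ _, ?_⟩
  rw [← hy, ← hu']
  congr 1
  ext1 <;> simp

lemma local_ext (h : IsGluing o₀ o₁ j₀ j₁ τ a₀ a₁ π) {Z W : Over SpecC} (p : Z ⟶ P) {f g : Z ⟶ W}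
    (h₀ : ∀ (V : Over SpecC) (v : V ⟶ Z) (t : V ⟶ Torus X) (u : V ⟶ V₀), v ≫ p = lift t u ≫ a₀ →
      v ≫ f = v ≫ g)
    (h₁ : ∀ (V : Over SpecC) (v : V ⟶ Z) (t : V ⟶ Torus X) (u : V ⟶ V₁), v ≫ p = lift t u ≫ a₁ →
      v ≫ f = v ≫ g) : f = g :=
  h.total.local_ext p
    (fun V v y hy => h₀ V v (y ≫ fst _ _) (y ≫ snd _ _)
      (hy.trans (congrArg (· ≫ a₀) (by ext1 <;> simp))))
    (fun V v y hy => h₁ V v (y ≫ fst _ _) (y ≫ snd _ _)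
      (hy.trans (congrArg (· ≫ a₁) (by ext1 <;> simp))))

lemma left_inj (h : IsGluing o₀ o₁ j₀ j₁ τ a₀ a₁ π) {Z : Over SpecC} {t t' : Z ⟶ Torus X}
    {u u' : Z ⟶ V₀} (e : lift t u ≫ a₀ = lift t' u' ≫ a₀) : t = t' ∧ u = u' := by
  have := h.total.ext_left e
  exact ⟨by simpa using congrArg (· ≫ fst _ _) this, by simpa using congrArg (· ≫ snd _ _) this⟩

lemma right_inj (h : IsGluing o₀ o₁ j₀ j₁ τ a₀ a₁ π) {Z : Over SpecC} {t t' : Z ⟶ Torus X}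
    {u u' : Z ⟶ V₁} (e : lift t u ≫ a₁ = lift t' u' ≫ a₁) : t = t' ∧ u = u' := by
  have := h.total.ext_right e
  exact ⟨by simpa using congrArg (· ≫ fst _ _) this, by simpa using congrArg (· ≫ snd _ _) this⟩

lemma exists_of_eq (h : IsGluing o₀ o₁ j₀ j₁ τ a₀ a₁ π) {Z : Over SpecC} {t t' : Z ⟶ Torus X}
    {u : Z ⟶ V₀} {u' : Z ⟶ V₁} (e : lift t u ≫ a₀ = lift t' u' ≫ a₁) :
    ∃ o : Z ⟶ O, o ≫ o₀ = u ∧ o ≫ o₁ = u' ∧ t' = t * (o ≫ τ) := by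
  obtain ⟨o, h₀, h₁⟩ := h.base.exists_overlap (u := u) (u' := u') (by
    simpa [h.proj₀, h.proj₁] using congrArg (· ≫ π) e)
  refine ⟨o, h₀, h₁, ?_⟩
  rw [← h₀, h.glue] at e
  exact (h.right_inj e).1.symm

/-- The torus acts on each piece by left translation, while the gluing is right translation by `τ`;
the two commute by associativity. -/
lemma exists_action (h : IsGluing o₀ o₁ j₀ j₁ τ a₀ a₁ π) : ∃ m : Torus X ⊗ P ⟶ P,
    (∀ (Z : Over SpecC) (t t' : Z ⟶ Torus X) (u : Z ⟶ V₀),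
      lift t (lift t' u ≫ a₀) ≫ m = lift (t * t') u ≫ a₀) ∧
    ∀ (Z : Over SpecC) (t t' : Z ⟶ Torus X) (u : Z ⟶ V₁),
      lift t (lift t' u ≫ a₁) ≫ m = lift (t * t') u ≫ a₁ := by
  obtain ⟨m, hm₀, hm₁⟩ := h.total.glue_of_unique (W := P) (snd (Torus X) P)
    (fun {V} v w =>
      (∀ (V' : Over SpecC) (g : V' ⟶ V) (t : V' ⟶ Torus X) (u : V' ⟶ V₀),
        g ≫ v ≫ snd _ _ = lift t u ≫ a₀ → g ≫ w = lift ((g ≫ v ≫ fst _ _) * t) u ≫ a₀) ∧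
      ∀ (V' : Over SpecC) (g : V' ⟶ V) (t : V' ⟶ Torus X) (u : V' ⟶ V₁),
        g ≫ v ≫ snd _ _ = lift t u ≫ a₁ → g ≫ w = lift ((g ≫ v ≫ fst _ _) * t) u ≫ a₁)
    (fun g v w hvw => ⟨fun V' g' t u hu => by
        simpa using hvw.1 V' (g' ≫ g) t u (by simpa using hu),
      fun V' g' t u hu => by
        simpa using hvw.2 V' (g' ≫ g) t u (by simpa using hu)⟩)
    (fun {V} v w w' hw hw' => h.local_ext (v ≫ snd _ _)
      (fun V' g t u hu => (hw.1 V' g t u hu).trans (hw'.1 V' g t u hu).symm)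
      (fun V' g t u hu => (hw.2 V' g t u hu).trans (hw'.2 V' g t u hu).symm))
    (fun {V} v y hy => by
      refine ⟨lift ((v ≫ fst _ _) * (y ≫ fst _ _)) (y ≫ snd _ _) ≫ a₀, fun V' g t u hu => ?_,
        fun V' g t u hu => ?_⟩
      · obtain ⟨rfl, rfl⟩ := h.left_inj (t := g ≫ y ≫ fst _ _) (u := g ≫ y ≫ snd _ _) (t' := t)
          (u' := u) (by
            rw [← hu, hy, ← comp_lift, ← comp_lift, lift_fst_snd, Category.comp_id, Category.assoc])
        rw [← Category.assoc, comp_lift, MonObj.comp_mul]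
      · obtain ⟨o, ho₀, rfl, rfl⟩ := h.exists_of_eq (t := g ≫ y ≫ fst _ _) (u := g ≫ y ≫ snd _ _)
          (t' := t) (u' := u) (by
            rw [← hu, hy, ← comp_lift, ← comp_lift, lift_fst_snd, Category.comp_id, Category.assoc])
        rw [← Category.assoc, comp_lift, MonObj.comp_mul, ← ho₀, h.glue, mul_assoc])
    (fun {V} v y hy => by
      refine ⟨lift ((v ≫ fst _ _) * (y ≫ fst _ _)) (y ≫ snd _ _) ≫ a₁, fun V' g t u hu => ?_,
        fun V' g t u hu => ?_⟩
      · obtain ⟨o, rfl, ho, ht⟩ := h.exists_of_eq (t' := g ≫ y ≫ fst _ _) (u' := g ≫ y ≫ snd _ _)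
          (t := t) (u := u) (by
            rw [← hu, hy, ← comp_lift, ← comp_lift, lift_fst_snd, Category.comp_id, Category.assoc])
        rw [← Category.assoc, comp_lift, MonObj.comp_mul, ht, h.glue, ho, mul_assoc]
      · obtain ⟨rfl, rfl⟩ := h.right_inj (t := g ≫ y ≫ fst _ _) (u := g ≫ y ≫ snd _ _) (t' := t)
          (u' := u) (by
            rw [← hu, hy, ← comp_lift, ← comp_lift, lift_fst_snd, Category.comp_id, Category.assoc])
        rw [← Category.assoc, comp_lift, MonObj.comp_mul])
  refine ⟨m, fun Z t t' u => ?_, fun Z t t' u => ?_⟩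
  · simpa using (hm₀ (lift t (lift t' u ≫ a₀)) (lift t' u) (lift_snd _ _)).1 Z (𝟙 Z) t' u (by simp)
  · simpa using (hm₁ (lift t (lift t' u ≫ a₁)) (lift t' u) (lift_snd _ _)).2 Z (𝟙 Z) t' u (by simp)

lemma exists_modObj (h : IsGluing o₀ o₁ j₀ j₁ τ a₀ a₁ π) : ∃ _ : ModObj (Torus X) P,
    (∀ (Z : Over SpecC) (t t' : Z ⟶ Torus X) (u : Z ⟶ V₀),
      t • (lift t' u ≫ a₀) = lift (t * t') u ≫ a₀) ∧
    ∀ (Z : Over SpecC) (t t' : Z ⟶ Torus X) (u : Z ⟶ V₁),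
      t • (lift t' u ≫ a₁) = lift (t * t') u ≫ a₁ := by
  obtain ⟨m, hm₀, hm₁⟩ := h.exists_action
  have one : ∀ {Z : Over SpecC} (p : Z ⟶ P), lift 1 p ≫ m = p := fun p => by
    refine h.local_ext p (fun V v t u hv => ?_) fun V v t u hv => ?_
    · rw [← Category.assoc, comp_lift, MonObj.comp_one, hv, hm₀, one_mul]
    · rw [← Category.assoc, comp_lift, MonObj.comp_one, hv, hm₁, one_mul]
  have mul : ∀ {Z : Over SpecC} (t t' : Z ⟶ Torus X) (p : Z ⟶ P),
      lift (t * t') p ≫ m = lift t (lift t' p ≫ m) ≫ m := fun t t' p => by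
    refine h.local_ext p (fun V v t u hv => ?_) fun V v t u hv => ?_
    · rw [← Category.assoc, comp_lift, ← Category.assoc, comp_lift, ← Category.assoc v, comp_lift,
        MonObj.comp_mul, hv, hm₀, hm₀, hm₀, mul_assoc]
    · rw [← Category.assoc, comp_lift, ← Category.assoc, comp_lift, ← Category.assoc v, comp_lift,
        MonObj.comp_mul, hv, hm₁, hm₁, hm₁, mul_assoc]
  let a : ∀ {Z : Over SpecC}, (Z ⟶ Torus X) → (Z ⟶ P) → (Z ⟶ P) := fun t p => lift t p ≫ m
  have nat : ∀ {Z Z' : Over SpecC} (g : Z' ⟶ Z) (t : Z ⟶ Torus X) (p : Z ⟶ P),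
      g ≫ a t p = a (g ≫ t) (g ≫ p) := fun g t p => by
    change g ≫ lift t p ≫ m = _
    rw [← Category.assoc, comp_lift]
  refine ⟨modObjOfPoints a nat one mul, fun Z t t' u => ?_, fun Z t t' u => ?_⟩
  · exact (modObjOfPoints_smul a nat one mul _ _).trans (hm₀ Z t t' u)
  · exact (modObjOfPoints_smul a nat one mul _ _).trans (hm₁ Z t t' u)

end IsGluing

end Construction

end

section

open Limits
open scoped MonObj

/-! ### The principal bundle with prescribed transition function -/

section Framed

variable {X : Type} [AddCommGroup X] {S V₀ V₁ O : Over SpecC} {o₀ : O ⟶ V₀} {o₁ : O ⟶ V₁}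
  {j₀ : V₀ ⟶ S} {j₁ : V₁ ⟶ S}

lemma exists_section_of_isOpenImmersion {P V : Over SpecC} {π : P ⟶ S} {j : V ⟶ S} {e : V ⟶ P}
    (hj : IsOpenImmersion j.left) (he : e ≫ π = j) {b : S.left} (hb : b ∈ Set.range j.left) :
    ∃ U : S.left.Opens, b ∈ U ∧ ∃ τ : U.toScheme ⟶ P.left, τ ≫ π.left = U.ι := by
  refine ⟨j.left.opensRange, hb, j.left.isoOpensRange.inv ≫ e.left, ?_⟩
  rw [Category.assoc, ← Over.comp_left, he]
  exact j.left.isoOpensRange_inv_comp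

lemma IsGluing.isPrincipalBundle {P : Over SpecC} [ModObj (Torus X) P] {τ : O ⟶ Torus X}
    {a₀ : Torus X ⊗ V₀ ⟶ P} {a₁ : Torus X ⊗ V₁ ⟶ P} {π : P ⟶ S}
    (h : IsGluing o₀ o₁ j₀ j₁ τ a₀ a₁ π)
    (smul₀ : ∀ (Z : Over SpecC) (t t' : Z ⟶ Torus X) (u : Z ⟶ V₀),
      t • (lift t' u ≫ a₀) = lift (t * t') u ≫ a₀)
    (smul₁ : ∀ (Z : Over SpecC) (t t' : Z ⟶ Torus X) (u : Z ⟶ V₁),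
      t • (lift t' u ≫ a₁) = lift (t * t') u ≫ a₁) : IsPrincipalBundle X π where
  smul_comp Z t p := by
    refine h.local_ext p (fun V v t' u hv => ?_) fun V v t' u hv => ?_
    · rw [← Category.assoc, comp_smul, ← Category.assoc v, hv, smul₀, Category.assoc,
        Category.assoc, h.proj₀, lift_snd_assoc, lift_snd_assoc]
    · rw [← Category.assoc, comp_smul, ← Category.assoc v, hv, smul₁, Category.assoc,
        Category.assoc, h.proj₁, lift_snd_assoc, lift_snd_assoc]
  simply_transitive Z p q hpq := by
    have cancel₀ : ∀ {V : Over SpecC} {v : V ⟶ Z} {t t' : V ⟶ Torus X} (u : V ⟶ V₀),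
        (v ≫ p) ≫ π = u ≫ j₀ → t • (v ≫ p) = t' • (v ≫ p) → t = t' := by
      intro V v t t' u hu ht
      obtain ⟨s, hs⟩ := h.exists_left _ _ hu
      rw [← hs, smul₀, smul₀] at ht
      obtain ⟨s', hs'⟩ := torus_exists_inv s
      rw [torus_mul_comm] at hs'
      have := congrArg (· * s') (h.left_inj ht).1
      simpa [mul_assoc, hs'] using this
    have cancel₁ : ∀ {V : Over SpecC} {v : V ⟶ Z} {t t' : V ⟶ Torus X} (u : V ⟶ V₁),
        (v ≫ p) ≫ π = u ≫ j₁ → t • (v ≫ p) = t' • (v ≫ p) → t = t' := by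
      intro V v t t' u hu ht
      obtain ⟨s, hs⟩ := h.exists_right _ _ hu
      rw [← hs, smul₁, smul₁] at ht
      obtain ⟨s', hs'⟩ := torus_exists_inv s
      rw [torus_mul_comm] at hs'
      have := congrArg (· * s') (h.right_inj ht).1
      simpa [mul_assoc, hs'] using this
    have cancel : ∀ {V : Over SpecC} {v : V ⟶ Z} {t t' : V ⟶ Torus X},
        t • (v ≫ p) = t' • (v ≫ p) → t = t' := by
      intro V v t t' ht
      refine h.base.local_ext ((v ≫ p) ≫ π) (fun V' g u hu => ?_) fun V' g u hu => ?_
      · refine cancel₀ (v := g ≫ v) u (by simpa using hu) ?_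
        simpa [comp_smul] using congrArg (g ≫ ·) ht
      · refine cancel₁ (v := g ≫ v) u (by simpa using hu) ?_
        simpa [comp_smul] using congrArg (g ≫ ·) ht
    -- Over each chart the translating element is a quotient of two coordinates. It is unique by
    -- `cancel`, so the local solutions glue.
    obtain ⟨t, ht₀, ht₁⟩ := h.base.glue_of_unique (W := Torus X) (p ≫ π)
      (fun {V} v t => t • (v ≫ p) = v ≫ q)
      (fun g v w hw => by
        rw [Category.assoc, ← comp_smul, hw, Category.assoc])
      (fun v w w' hw hw' => cancel (hw.trans hw'.symm))
      (fun {V} v u hu => by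
        obtain ⟨s, hs⟩ := h.exists_left (v ≫ p) u (by simpa using hu)
        obtain ⟨r, hr⟩ := h.exists_left (v ≫ q) u (by
          rw [Category.assoc, ← hpq]; exact hu)
        obtain ⟨s', hs'⟩ := torus_exists_inv s
        exact ⟨r * s', by rw [← hs, ← hr, smul₀, mul_assoc, hs', mul_one]⟩)
      (fun {V} v u hu => by
        obtain ⟨s, hs⟩ := h.exists_right (v ≫ p) u (by simpa using hu)
        obtain ⟨r, hr⟩ := h.exists_right (v ≫ q) u (by
          rw [Category.assoc, ← hpq]; exact hu)
        obtain ⟨s', hs'⟩ := torus_exists_inv s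
        exact ⟨r * s', by rw [← hs, ← hr, smul₁, mul_assoc, hs', mul_one]⟩)
    refine ⟨t, h.base.local_ext (p ≫ π) (fun V v u hu => ?_) (fun V v u hu => ?_), fun t' ht' => ?_⟩
    · rw [comp_smul, ht₀ v u hu]
    · rw [comp_smul, ht₁ v u hu]
    · refine h.base.local_ext (p ≫ π) (fun V v u hu => ?_) fun V v u hu => ?_
      · refine cancel (v := v) ?_
        rw [ht₀ v u hu, ← ht', comp_smul]
      · refine cancel (v := v) ?_
        rw [ht₁ v u hu, ← ht', comp_smul]
  locally_trivial b := by
    rcases h.base.exists_mem b with hb | hb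
    · exact exists_section_of_isOpenImmersion (e := lift 1 (𝟙 _) ≫ a₀) h.base.isOpen₀
        (by rw [Category.assoc, h.proj₀, lift_snd_assoc, Category.id_comp]) hb
    · exact exists_section_of_isOpenImmersion (e := lift 1 (𝟙 _) ≫ a₁) h.base.isOpen₁
        (by rw [Category.assoc, h.proj₁, lift_snd_assoc, Category.id_comp]) hb

/-- The principal bundle with given transition function. -/
lemma IsTwoCover.exists_framed (h : IsTwoCover o₀ o₁ j₀ j₁) (τ : O ⟶ Torus X) :
    ∃ (P : Over SpecC) (_ : ModObj (Torus X) P) (π : P ⟶ S) (e₀ : V₀ ⟶ P) (e₁ : V₁ ⟶ P),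
      IsPrincipalBundle X π ∧ IsFraming π o₀ o₁ j₀ j₁ τ e₀ e₁ := by
  have i₀ : IsOpenImmersion o₀.left := MorphismProperty.of_isPullback (P := @IsOpenImmersion)
    (isPullback_left h.isPullback).flip h.isOpen₁
  have i₁ : IsOpenImmersion o₁.left := MorphismProperty.of_isPullback (P := @IsOpenImmersion)
    (isPullback_left h.isPullback) h.isOpen₀
  have k₀ : IsOpenImmersion (Torus X ◁ o₀).left :=
    MorphismProperty.of_isPullback (P := @IsOpenImmersion)
      (isPullback_left (isPullback_whisker (X := X) o₀)).flip i₀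
  have k₁ : IsOpenImmersion (twist τ o₁).left :=
    MorphismProperty.of_isPullback (P := @IsOpenImmersion)
      (isPullback_left (isPullback_twist τ o₁)).flip i₁
  obtain ⟨P, a₀, a₁, hP⟩ := exists_glue (Torus X ◁ o₀) (twist τ o₁)
  obtain ⟨π, hπ₀, hπ₁⟩ := hP.exists_hom (snd _ _ ≫ j₀) (snd _ _ ≫ j₁) (by
    rw [whiskerLeft_snd_assoc, h.isPullback.w, twist, lift_snd_assoc, Category.assoc])
  have hg : IsGluing o₀ o₁ j₀ j₁ τ a₀ a₁ π := ⟨h, hP, hπ₀, hπ₁⟩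
  obtain ⟨inst, smul₀, smul₁⟩ := hg.exists_modObj
  refine ⟨P, inst, π, lift 1 (𝟙 _) ≫ a₀, lift 1 (𝟙 _) ≫ a₁, hg.isPrincipalBundle smul₀ smul₁,
    by rw [Category.assoc, hπ₀, lift_snd_assoc, Category.id_comp],
    by rw [Category.assoc, hπ₁, lift_snd_assoc, Category.id_comp], ?_⟩
  rw [← Category.assoc, ← Category.assoc, comp_lift, comp_lift, smul₁, Category.comp_id,
    Category.comp_id, MonObj.comp_one, MonObj.comp_one, mul_one]
  have := hg.glue 1 (𝟙 _)
  simpa using this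

end Framed

end

section

open Limits
open scoped MonObj

/-! ### Morphisms to `Proj` which land in an affine chart -/

section ProjPoints

variable {R : Type} [CommRing R] {σ : Type} [SetLike σ R] [AddSubgroupClass σ R] (𝒜 : ℕ → σ)
  [GradedRing 𝒜] {Z : Scheme.{0}} (f : R →+* Γ(Z, ⊤))
  (hf : (HomogeneousIdeal.irrelevant 𝒜).toIdeal.map f = ⊤) {r : R} {n : ℕ}

/-- The homomorphism from the homogeneous localization given by a homomorphism which inverts `r`. -/
def awayEval {B : Type} [CommRing B] (f : R →+* B) (hr : IsUnit (f r)) :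
    HomogeneousLocalization.Away 𝒜 r →+* B :=
  (IsLocalization.Away.lift (S := Localization.Away r) r hr).comp
    (algebraMap (HomogeneousLocalization.Away 𝒜 r) (Localization.Away r))

/-- When `f r` is invertible the morphism lands in the chart `D₊(r)`, where it evaluates fractions
of degree `0`. -/
lemma fromOfGlobalSections_eq (hn : 0 < n) (hr : r ∈ 𝒜 n) (hu : IsUnit (f r)) :
    Proj.fromOfGlobalSections 𝒜 f hf =
      Z.toSpecΓ ≫ Spec.map (CommRingCat.ofHom (awayEval 𝒜 f hu)) ≫ Proj.awayι 𝒜 r hr hn := by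
  -- The basic open set of a unit is all of `Z`, so nothing is lost by comparing the morphisms on
  -- it.
  have hiso : IsIso (Z.basicOpen (f r)).ι := by
    rw [Z.basicOpen_of_isUnit hu]
    exact inferInstanceAs (IsIso (Z.topIso.hom))
  rw [← cancel_epi (Z.basicOpen (f r)).ι]
  have h := Proj.fromOfGlobalSections_resLE 𝒜 f hf hn hr
  have h2 := congrArg (· ≫ (Proj.basicOpen 𝒜 r).ι) h
  simp only [Scheme.Hom.resLE_comp_ι] at h2
  rw [h2]
  simp only [Proj.toBasicOpenOfGlobalSections, Category.assoc, Proj.basicOpenIsoSpec_inv_ι]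
  obtain ⟨φ, hφ⟩ : ∃ φ : Localization.Away (f r) →+* Γ(Z, ⊤), φ.comp (algebraMap _ _) =
      RingHom.id _ := ⟨IsLocalization.Away.lift (f r) (g := RingHom.id _) hu,
        IsLocalization.Away.lift_comp _ _⟩
  have e₁ : awayEval 𝒜 f hu = φ.comp ((IsLocalization.map (M := .powers r) (T := .powers (f r))
      (Localization.Away (f r)) f (by
        rw [← Submonoid.map_le_iff_le_comap, Submonoid.map_powers])).comp
      (algebraMap (HomogeneousLocalization.Away 𝒜 r) (Localization.Away r))) := by
    rw [awayEval, ← RingHom.comp_assoc]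
    congr 1
    refine IsLocalization.ringHom_ext (M := .powers r) ?_
    rw [RingHom.comp_assoc, IsLocalization.map_comp, ← RingHom.comp_assoc, hφ]
    exact IsLocalization.Away.lift_comp _ _
  have e₂ : (Scheme.isoOfEq Z (Z.toSpecΓ_preimage_basicOpen (f r))).inv ≫
      Z.toSpecΓ ∣_ (PrimeSpectrum.basicOpen (f r)) ≫ (basicOpenIsoSpecAway (R := Γ(Z, ⊤)) (f r)).hom =
      (Z.basicOpen (f r)).ι ≫ Z.toSpecΓ ≫ Spec.map (CommRingCat.ofHom φ) := by
    have : Mono (Spec.map (CommRingCat.ofHom (algebraMap Γ(Z, ⊤) (Localization.Away (f r))))) := by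
      infer_instance
    rw [← cancel_mono (Spec.map (CommRingCat.ofHom (algebraMap Γ(Z, ⊤)
      (Localization.Away (f r)))))]
    simp only [Category.assoc, ← Spec.map_comp, ← CommRingCat.ofHom_comp, hφ]
    have h3 : CommRingCat.ofHom (RingHom.id Γ(Z, ⊤)) = 𝟙 _ := rfl
    rw [basicOpenIsoSpecAway_hom_SpecMap, h3, Spec.map_id]
    refine (congrArg (_ ≫ ·) (morphismRestrict_ι Z.toSpecΓ
      (show (Spec Γ(Z, ⊤)).Opens from PrimeSpectrum.basicOpen (f r)))).trans ?_
    exact (Scheme.isoOfEq_inv_ι_assoc _ _ _).trans (congrArg (_ ≫ ·) (Category.comp_id _).symm)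
  rw [e₁]
  set ψ := (IsLocalization.map (M := .powers r) (T := .powers (f r))
      (Localization.Away (f r)) f (by
        rw [← Submonoid.map_le_iff_le_comap, Submonoid.map_powers])).comp
      (algebraMap (HomogeneousLocalization.Away 𝒜 r) (Localization.Away r))
  rw [CommRingCat.ofHom_comp ψ φ, Spec.map_comp]
  simpa only [Category.assoc] using
    congrArg (· ≫ Spec.map (CommRingCat.ofHom ψ) ≫ Proj.awayι 𝒜 r hr hn) e₂

end ProjPoints

end

section

open Limits
open scoped MonObj

/-! ### Evaluation of fractions of degree zero -/

section AwayEval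

variable {R : Type} [CommRing R] {σ : Type} [SetLike σ R] [AddSubgroupClass σ R] (𝒜 : ℕ → σ)
  [GradedRing 𝒜] {B C : Type} [CommRing B] [CommRing C] {r : R}

lemma awayEval_mk {f : R →+* B} (hu : IsUnit (f r)) {d : ℕ} (hr : r ∈ 𝒜 d) (n : ℕ) (x : R)
    (hx : x ∈ 𝒜 (n • d)) :
    awayEval 𝒜 f hu (HomogeneousLocalization.Away.mk 𝒜 hr n x hx) * f r ^ n = f x := by
  have h := congrArg (IsLocalization.Away.lift (S := Localization.Away r) r hu)
    (IsLocalization.mk'_spec (Localization.Away r) x (⟨r ^ n, n, rfl⟩ : Submonoid.powers r))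
  rw [map_mul, IsLocalization.Away.lift_eq, IsLocalization.Away.lift_eq, map_pow,
    ← Localization.mk_eq_mk'] at h
  exact h

lemma comp_awayEval {f : R →+* B} (hu : IsUnit (f r)) (g : B →+* C) :
    g.comp (awayEval 𝒜 f hu) = awayEval 𝒜 (g.comp f) (hu.map g) := by
  rw [awayEval, awayEval, ← RingHom.comp_assoc]
  congr 1
  refine IsLocalization.ringHom_ext (M := .powers r) ?_
  rw [RingHom.comp_assoc, IsLocalization.Away.lift_comp, IsLocalization.Away.lift_comp]

lemma awayEval_ext {d : ℕ} (hr : r ∈ 𝒜 d) {f : R →+* B} (hu : IsUnit (f r))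
    {g : HomogeneousLocalization.Away 𝒜 r →+* B}
    (h : ∀ n x hx, g (HomogeneousLocalization.Away.mk 𝒜 hr n x hx) * f r ^ n = f x) :
    g = awayEval 𝒜 f hu := by
  ext z
  obtain ⟨n, x, hx, rfl⟩ := HomogeneousLocalization.Away.mk_surjective 𝒜 hr z
  exact (hu.pow n).mul_right_cancel ((h n x hx).trans (awayEval_mk 𝒜 hu hr n x hx).symm)

end AwayEval

/-! ### Points of the projective line with an invertible coordinate -/

section Line

/-- The grading of `ℂ[x, y]`. -/
abbrev homog : ℕ → Submodule ℂ (MvPolynomial (Fin 2) ℂ) :=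
  MvPolynomial.homogeneousSubmodule (Fin 2) ℂ

/-- Evaluation of polynomials in two variables. -/
abbrev evalVec {B : Type} [CommRing B] [Algebra ℂ B] (v : Fin 2 → B) :
    MvPolynomial (Fin 2) ℂ →+* B := (MvPolynomial.aeval (R := ℂ) v).toRingHom

lemma X_mem_homog (i : Fin 2) : (MvPolynomial.X i : MvPolynomial (Fin 2) ℂ) ∈ homog 1 :=
  MvPolynomial.isHomogeneous_X ℂ i

variable {B C : Type} [CommRing B] [Algebra ℂ B] [CommRing C] [Algebra ℂ C]

lemma isUnit_evalVec {v : Fin 2 → B} {i : Fin 2} (hu : IsUnit (v i)) :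
    IsUnit (evalVec v (MvPolynomial.X i)) := by
  change IsUnit (MvPolynomial.aeval (R := ℂ) v (MvPolynomial.X i))
  rwa [MvPolynomial.aeval_X]

lemma point_left {f g : B} (h : IsCoprime f g) {i : Fin 2} (hu : IsUnit (![f, g] i)) :
    (P1.point f g h).left =
      Spec.map (CommRingCat.ofHom (awayEval homog (evalVec ![f, g]) (isUnit_evalVec hu))) ≫
        Proj.awayι homog (MvPolynomial.X i) (X_mem_homog i) zero_lt_one := by
  have hu' : IsUnit (evalAt f g (MvPolynomial.X i)) :=
    (isUnit_evalVec hu).map (Scheme.ΓSpecIso (.of B)).inv.hom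
  refine (fromOfGlobalSections_eq homog (evalAt f g) (map_irrelevant_evalAt f g h)
    zero_lt_one (X_mem_homog i) hu').trans ?_
  have e : awayEval homog (evalAt f g) hu' = (Scheme.ΓSpecIso (.of B)).inv.hom.comp
      (awayEval homog (evalVec ![f, g]) (isUnit_evalVec hu)) := (comp_awayEval _ _ _).symm
  rw [e, CommRingCat.ofHom_comp, Spec.map_comp, CommRingCat.ofHom_hom, Category.assoc]
  exact toSpecΓ_SpecMap_ΓSpecIso_inv_assoc (.of B) _

lemma specMap_comp_point {f g : B} (h : IsCoprime f g) {i : Fin 2} (hu : IsUnit (![f, g] i))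
    (φ : B →ₐ[ℂ] C) (h' : IsCoprime (φ f) (φ g)) :
    specMap φ ≫ P1.point f g h = P1.point (φ f) (φ g) h' := by
  have hv : ![φ f, φ g] = φ ∘ ![f, g] := by
    ext i; fin_cases i <;> rfl
  have hu' : IsUnit (![φ f, φ g] i) := by rw [hv]; exact hu.map φ
  have e : φ.toRingHom.comp (evalVec ![f, g]) = evalVec ![φ f, φ g] := by
    rw [hv]
    exact MvPolynomial.ringHom_ext (fun r => by simp) fun i => by simp
  have e' : CommRingCat.ofHom (awayEval homog (evalVec ![φ f, φ g]) (isUnit_evalVec hu')) =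
      CommRingCat.ofHom (awayEval homog (evalVec ![f, g]) (isUnit_evalVec hu)) ≫
        CommRingCat.ofHom φ.toRingHom := by
    rw [← CommRingCat.ofHom_comp, comp_awayEval]
    congr 2
    exact e.symm
  ext1
  rw [Over.comp_left, point_left h hu, point_left h' hu', e', Spec.map_comp]
  exact (Category.assoc (W := Spec (.of C)) (Z := Proj homog) _ _ _).symm

lemma evalVec_smul {n : ℕ} {p : MvPolynomial (Fin 2) ℂ} (hp : p ∈ homog n) (v : Fin 2 → B) (u : B) :
    evalVec (fun i => u * v i) p = u ^ n * evalVec v p := by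
  change MvPolynomial.aeval _ p = _ * MvPolynomial.aeval _ p
  rw [MvPolynomial.aeval_def, MvPolynomial.aeval_def, MvPolynomial.eval₂_eq', MvPolynomial.eval₂_eq',
    Finset.mul_sum]
  refine Finset.sum_congr rfl fun d hd => ?_
  have h := (MvPolynomial.mem_homogeneousSubmodule n p).1 hp (MvPolynomial.mem_support_iff.1 hd)
  have h' : d 0 + d 1 = n := by
    rw [← h, Finsupp.weight_apply, Finsupp.sum_fintype _ _ (by simp)]
    simp [Fin.sum_univ_two]
  rw [Fin.prod_univ_two, Fin.prod_univ_two, ← h']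
  ring

/-- In a fraction of degree `0` the powers of `u` in numerator and denominator cancel. -/
lemma point_smul {f g u : B} (hu : IsUnit u) (h : IsCoprime f g) (h' : IsCoprime (u * f) (u * g))
    {i : Fin 2} (hi : IsUnit (![f, g] i)) : P1.point (u * f) (u * g) h' = P1.point f g h := by
  have hv : ![u * f, u * g] = fun i => u * ![f, g] i := by
    ext i; fin_cases i <;> rfl
  have hi' : IsUnit (![u * f, u * g] i) := by rw [hv]; exact hu.mul hi
  ext1
  rw [point_left h hi, point_left h' hi']
  congr 3
  refine awayEval_ext homog (X_mem_homog i) _ fun n x hx => ?_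
  have hx' : x ∈ homog n := by simpa using hx
  have h1 := awayEval_mk homog (isUnit_evalVec hi') (X_mem_homog i) n x hx
  refine (hu.pow n).mul_left_cancel ?_
  have h2 := evalVec_smul hx' ![f, g] u
  rw [← hv, ← h1] at h2
  have h3 : evalVec ![u * f, u * g] (MvPolynomial.X i) =
      u * evalVec ![f, g] (MvPolynomial.X i) := by
    rw [hv]
    simp
  rw [← h2, h3]
  ring

end Line

end

section

open Limits
open scoped MonObj

/-! ### The two standard charts of `ℙ¹` -/

section Charts

/-- Distinct monomials of degree `n` have distinct exponents of `x`, so no terms cancel when `y` is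
set to `1`. -/
lemma eq_zero_of_dehom {n : ℕ} {p : MvPolynomial (Fin 2) ℂ} (hp : p ∈ homog n)
    (h : dehom p = 0) : p = 0 := by
  have hdeg : ∀ d ∈ p.support, d 0 + d 1 = n := fun d hd => by
    have h := (MvPolynomial.mem_homogeneousSubmodule n p).1 hp (MvPolynomial.mem_support_iff.1 hd)
    rw [← h, Finsupp.weight_apply, Finsupp.sum_fintype _ _ (by simp)]
    simp [Fin.sum_univ_two]
  by_contra hne
  obtain ⟨d, hd⟩ := MvPolynomial.support_nonempty.2 hne
  have h2 := dehom_coeff p (d 0)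
  rw [h, Polynomial.coeff_zero, Finset.sum_eq_single d] at h2
  · rw [if_pos rfl] at h2
    exact MvPolynomial.mem_support_iff.1 hd h2.symm
  · intro b hb hbd
    refine if_neg fun h0 => hbd ?_
    ext i
    fin_cases i
    · exact h0
    · have := hdeg d hd
      have := hdeg b hb
      change b 1 = d 1
      omega
  · exact fun h => absurd hd h

lemma eq_zero_of_dehom_swap {n : ℕ} {p : MvPolynomial (Fin 2) ℂ} (hp : p ∈ homog n)
    (h : evalVec ![1, (Polynomial.X : Polynomial ℂ)] p = 0) : p = 0 := by
  have h1 : dehom (MvPolynomial.rename (Equiv.swap (0 : Fin 2) 1) p) = 0 := by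
    rw [dehom, MvPolynomial.aeval_rename, ← h]
    change MvPolynomial.aeval _ p = MvPolynomial.aeval _ p
    congr 2
    ext i
    fin_cases i <;> rfl
  have h2 := eq_zero_of_dehom (n := n)
    (MvPolynomial.IsHomogeneous.rename_isHomogeneous (f := Equiv.swap (0 : Fin 2) 1) hp) h1
  exact MvPolynomial.rename_injective _ (Equiv.injective _) (h2.trans (map_zero _).symm)

/-- Setting the coordinate `i` to `1` turns a fraction into its numerator, so `hv` gives
injectivity. The image contains the constants and the ratio of the two coordinates, hence
everything. -/
lemma bijective_awayEval {v : Fin 2 → Polynomial ℂ} {i k : Fin 2} (hi : v i = 1)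
    (hk : v k = Polynomial.X)
    (hv : ∀ (n : ℕ) (p : MvPolynomial (Fin 2) ℂ), p ∈ homog n → evalVec v p = 0 → p = 0)
    (hu : IsUnit (evalVec v (MvPolynomial.X i))) :
    Function.Bijective (awayEval homog (evalVec v) hu) := by
  have h1 : evalVec v (MvPolynomial.X i) = 1 := by simpa using hi
  have key : ∀ n x hx, awayEval homog (evalVec v) hu
      (HomogeneousLocalization.Away.mk homog (X_mem_homog i) n x hx) = evalVec v x := by
    intro n x hx
    have := awayEval_mk homog hu (X_mem_homog i) n x hx
    rwa [h1, one_pow, mul_one] at this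
  constructor
  · rw [injective_iff_map_eq_zero]
    intro z hz
    obtain ⟨n, x, hx, rfl⟩ := HomogeneousLocalization.Away.mk_surjective homog (X_mem_homog i) z
    rw [key] at hz
    exact HomogeneousLocalization.mk_eq_zero_of_num _ (Subtype.ext (hv _ x hx hz))
  · have hC : ∀ c : ℂ, Polynomial.C c ∈ (awayEval homog (evalVec v) hu).range := fun c =>
      ⟨HomogeneousLocalization.Away.mk homog (X_mem_homog i) 0 (MvPolynomial.C c)
        (by simp), by
        rw [key]; simp [Polynomial.algebraMap_eq]⟩
    have hX : Polynomial.X ∈ (awayEval homog (evalVec v) hu).range :=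
      ⟨HomogeneousLocalization.Away.mk homog (X_mem_homog i) 1 (MvPolynomial.X k)
        (by simpa using MvPolynomial.isHomogeneous_X ℂ k), by rw [key]; simp [hk]⟩
    intro p
    change p ∈ (awayEval homog (evalVec v) hu).range
    induction p using Polynomial.induction_on with
    | C a => exact hC a
    | add p q hp hq => exact add_mem hp hq
    | monomial n a _ => exact mul_mem (hC a) (pow_mem hX _)

/-- The coordinate chart `[t : 1]` of the projective line. -/
def line₀ : specOver (Polynomial ℂ) ⟶ P1 := P1.point Polynomial.X 1 isCoprime_one_right

/-- The coordinate chart `[1 : t]` of the projective line. -/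
def line₁ : specOver (Polynomial ℂ) ⟶ P1 := P1.point 1 Polynomial.X isCoprime_one_left

lemma isUnit_vec₀ {B : Type} [CommRing B] (f : B) : IsUnit (![f, 1] 1) := isUnit_one

lemma isUnit_vec₁ {B : Type} [CommRing B] (f : B) : IsUnit (![1, f] 0) := isUnit_one

/-- The ring isomorphism defining a chart. -/
lemma isIso_awayEval₀ : IsIso (Spec.map (CommRingCat.ofHom (awayEval homog
    (evalVec ![(Polynomial.X : Polynomial ℂ), 1]) (isUnit_evalVec (isUnit_vec₀ _))))) := by
  have : IsIso (CommRingCat.ofHom (awayEval homog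
      (evalVec ![(Polynomial.X : Polynomial ℂ), 1]) (isUnit_evalVec (isUnit_vec₀ _)))) :=
    (ConcreteCategory.isIso_iff_bijective _).2 (bijective_awayEval (k := 0) rfl rfl
      (fun n p hp h => eq_zero_of_dehom hp h) _)
  infer_instance

lemma isIso_awayEval₁ : IsIso (Spec.map (CommRingCat.ofHom (awayEval homog
    (evalVec ![1, (Polynomial.X : Polynomial ℂ)]) (isUnit_evalVec (isUnit_vec₁ _))))) := by
  have : IsIso (CommRingCat.ofHom (awayEval homog
      (evalVec ![1, (Polynomial.X : Polynomial ℂ)]) (isUnit_evalVec (isUnit_vec₁ _)))) :=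
    (ConcreteCategory.isIso_iff_bijective _).2 (bijective_awayEval (k := 1) rfl rfl
      (fun n p hp h => eq_zero_of_dehom_swap hp h) _)
  infer_instance

lemma isOpenImmersion_of_eq_comp {U V W : Scheme.{0}} {f : U ⟶ W} {g : U ⟶ V} {h : V ⟶ W}
    (hg : IsIso g) (hh : IsOpenImmersion h) (e : f = g ≫ h) : IsOpenImmersion f := by
  subst e
  infer_instance

lemma range_of_eq_comp {U V W : Scheme.{0}} {f : U ⟶ W} {g : U ⟶ V} {h : V ⟶ W} (hg : IsIso g)
    (e : f = g ≫ h) : Set.range f = Set.range h := by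
  subst e
  rw [Scheme.Hom.comp_base, TopCat.coe_comp, Set.range_comp, Set.range_eq_univ.2 g.surjective,
    Set.image_univ]

lemma isOpenImmersion_line₀ : IsOpenImmersion line₀.left :=
  isOpenImmersion_of_eq_comp (W := Proj homog) isIso_awayEval₀ inferInstance
    (point_left _ (isUnit_vec₀ _))

lemma isOpenImmersion_line₁ : IsOpenImmersion line₁.left :=
  isOpenImmersion_of_eq_comp (W := Proj homog) isIso_awayEval₁ inferInstance
    (point_left _ (isUnit_vec₁ _))

lemma range_line₀ : Set.range line₀.left =
    (Proj.basicOpen homog (MvPolynomial.X 1) : Set (Proj homog)) := by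
  rw [← Proj.opensRange_awayι homog (MvPolynomial.X 1) (X_mem_homog 1) zero_lt_one]
  exact range_of_eq_comp (W := Proj homog) isIso_awayEval₀ (point_left _ (isUnit_vec₀ _))

lemma range_line₁ : Set.range line₁.left =
    (Proj.basicOpen homog (MvPolynomial.X 0) : Set (Proj homog)) := by
  rw [← Proj.opensRange_awayι homog (MvPolynomial.X 0) (X_mem_homog 0) zero_lt_one]
  exact range_of_eq_comp (W := Proj homog) isIso_awayEval₁ (point_left _ (isUnit_vec₁ _))

lemma exists_mem_line (z : P1.left) : z ∈ Set.range line₀.left ∨ z ∈ Set.range line₁.left := by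
  have h := Proj.iSup_basicOpen_eq_top' homog (MvPolynomial.X : Fin 2 → _)
    (fun i => ⟨1, X_mem_homog i⟩) (by
      rw [eq_top_iff]
      intro p _
      induction p using MvPolynomial.induction_on with
      | C a =>
        let c : homog 0 := ⟨MvPolynomial.C a, MvPolynomial.isHomogeneous_C (Fin 2) a⟩
        exact Subalgebra.algebraMap_mem _ c
      | add p q hp hq => exact add_mem (hp trivial) (hq trivial)
      | mul_X p i hp => exact mul_mem (hp trivial) (Algebra.subset_adjoin ⟨i, rfl⟩))
  have hz : z ∈ (⨆ i, Proj.basicOpen homog (MvPolynomial.X i) : (Proj homog).Opens) := by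
    rw [h]; trivial
  obtain ⟨i, hi⟩ := TopologicalSpace.Opens.mem_iSup.1 hz
  rw [range_line₀, range_line₁]
  fin_cases i
  · exact Or.inr hi
  · exact Or.inl hi

/-- The homomorphism to the functions given by a morphism to an affine scheme. -/
def pullHom {Z : Scheme.{0}} {B : Type} [CommRing B] (y : Z ⟶ Spec (.of B)) : B →+* Γ(Z, ⊤) :=
  ((Scheme.ΓSpecIso (.of B)).inv ≫ y.appTop).hom

lemma pullHom_comp {Z : Scheme.{0}} {B C : Type} [CommRing B] [CommRing C]
    (y : Z ⟶ Spec (.of B)) (φ : C →+* B) :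
    pullHom (y ≫ Spec.map (CommRingCat.ofHom φ)) = (pullHom y).comp φ := by
  rw [pullHom, pullHom, Scheme.Hom.comp_appTop]
  have h := Scheme.ΓSpecIso_inv_naturality (CommRingCat.ofHom φ)
  rw [← reassoc_of% h]
  rfl

/-- A common point of the two charts factors through `D₊(xy)`, on which the coordinates are `x / y`
and `y / x`. -/
lemma mul_eq_one_of_line_eq {Z : Over SpecC} {y y' : Z ⟶ specOver (Polynomial ℂ)}
    (h : y ≫ line₀ = y' ≫ line₁) : pullAlg y Polynomial.X * pullAlg y' Polynomial.X = 1 := by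
  let γ₀ := awayEval homog (evalVec ![(Polynomial.X : Polynomial ℂ), 1])
    (isUnit_evalVec (isUnit_vec₀ _))
  let γ₁ := awayEval homog (evalVec ![1, (Polynomial.X : Polynomial ℂ)])
    (isUnit_evalVec (isUnit_vec₁ _))
  have h1 : (y.left ≫ Spec.map (CommRingCat.ofHom γ₀)) ≫ Proj.awayι homog (MvPolynomial.X 1)
      (X_mem_homog 1) zero_lt_one = (y'.left ≫ Spec.map (CommRingCat.ofHom γ₁)) ≫
      Proj.awayι homog (MvPolynomial.X 0) (X_mem_homog 0) zero_lt_one := by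
    have h2 := congrArg (fun k => Over.Hom.left k) h
    simp only [Over.comp_left] at h2
    rw [line₀, line₁, point_left _ (isUnit_vec₀ _), point_left _ (isUnit_vec₁ _)] at h2
    exact (Category.assoc (Z := Proj homog) _ _ _).trans
      (h2.trans (Category.assoc (Z := Proj homog) _ _ _).symm)
  let w := pullback.lift _ _ h1 ≫ (Proj.pullbackAwayιIso homog (X_mem_homog 1) zero_lt_one
    (X_mem_homog 0) zero_lt_one (x := MvPolynomial.X 1 * MvPolynomial.X 0) rfl).hom
  have w₀ : y.left ≫ Spec.map (CommRingCat.ofHom γ₀) = w ≫ Spec.map (CommRingCat.ofHom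
      (HomogeneousLocalization.awayMap homog (X_mem_homog 0) rfl)) := by
    rw [Category.assoc, Proj.pullbackAwayιIso_hom_SpecMap_awayMap_left, pullback.lift_fst]
  have w₁ : y'.left ≫ Spec.map (CommRingCat.ofHom γ₁) = w ≫ Spec.map (CommRingCat.ofHom
      (HomogeneousLocalization.awayMap homog (X_mem_homog 1) (mul_comm _ _))) := by
    rw [Category.assoc, Proj.pullbackAwayιIso_hom_SpecMap_awayMap_right, pullback.lift_snd]
  let z₀ := HomogeneousLocalization.Away.mk homog (X_mem_homog 1) 1 (MvPolynomial.X 0)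
    (X_mem_homog 0)
  let z₁ := HomogeneousLocalization.Away.mk homog (X_mem_homog 0) 1 (MvPolynomial.X 1)
    (X_mem_homog 1)
  have e₀ : γ₀ z₀ = Polynomial.X := by
    have := awayEval_mk homog (isUnit_evalVec (isUnit_vec₀ (Polynomial.X : Polynomial ℂ)))
      (X_mem_homog 1) 1 (MvPolynomial.X 0) (X_mem_homog 0)
    simp at this
    exact this
  have e₁ : γ₁ z₁ = Polynomial.X := by
    have := awayEval_mk homog (isUnit_evalVec (isUnit_vec₁ (Polynomial.X : Polynomial ℂ)))
      (X_mem_homog 0) 1 (MvPolynomial.X 1) (X_mem_homog 1)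
    simp at this
    exact this
  have f₀ : pullAlg y Polynomial.X = pullHom w (HomogeneousLocalization.awayMap homog
      (X_mem_homog 0) rfl z₀) := by
    rw [← e₀]
    exact congrArg (fun k => k z₀)
      ((pullHom_comp _ _).symm.trans ((congrArg pullHom w₀).trans (pullHom_comp _ _)))
  have f₁ : pullAlg y' Polynomial.X = pullHom w (HomogeneousLocalization.awayMap homog
      (X_mem_homog 1) (mul_comm _ _) z₁) := by
    rw [← e₁]
    exact congrArg (fun k => k z₁)
      ((pullHom_comp _ _).symm.trans ((congrArg pullHom w₁).trans (pullHom_comp _ _)))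
  rw [f₀, f₁]
  refine (map_mul (pullHom w) _ _).symm.trans ((congrArg (pullHom w) ?_).trans (map_one _))
  rw [HomogeneousLocalization.awayMap_mk, HomogeneousLocalization.awayMap_mk]
  apply HomogeneousLocalization.val_injective
  rw [HomogeneousLocalization.val_mul, HomogeneousLocalization.Away.val_mk,
    HomogeneousLocalization.Away.val_mk, Localization.mk_mul, HomogeneousLocalization.val_one,
    ← Localization.mk_one, Localization.mk_eq_mk_iff, Localization.r_iff_exists]
  refine ⟨1, ?_⟩
  simp
  ring

end Charts

end

section

open Limits
open scoped MonObj LaurentPolynomial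

/-! ### The two charts of `ℙ¹ × Spec R` and their intersection -/

section RelativeLine

variable (R : Type) [CommRing R] [Algebra ℂ R]

/-- The inclusion of the constants. -/
abbrev constHom : R →ₐ[ℂ] Polynomial R := IsScalarTower.toAlgHom ℂ R (Polynomial R)

/-- The chart `[t : 1]` of `ℙ¹ × Spec R`. -/
def chart₀ : specOver (Polynomial R) ⟶ P1 ⊗ specOver R :=
  lift (P1.point Polynomial.X 1 isCoprime_one_right) (specMap (constHom R))

/-- The chart `[1 : t]` of `ℙ¹ × Spec R`. -/
def chart₁ : specOver (Polynomial R) ⟶ P1 ⊗ specOver R :=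
  lift (P1.point 1 Polynomial.X isCoprime_one_left) (specMap (constHom R))

/-- The homomorphism `R[t] → R[t, t⁻¹]`. -/
def laurent : Polynomial R →ₐ[ℂ] R[T;T⁻¹] :=
  (Polynomial.aeval (R := R) (LaurentPolynomial.T 1 : R[T;T⁻¹])).restrictScalars ℂ

/-- The homomorphism `R[t] → R[t, t⁻¹]` given by `t ↦ t⁻¹`. -/
def laurentInv : Polynomial R →ₐ[ℂ] R[T;T⁻¹] :=
  (Polynomial.aeval (R := R) (LaurentPolynomial.T (-1) : R[T;T⁻¹])).restrictScalars ℂ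

lemma laurent_X : laurent R Polynomial.X = LaurentPolynomial.T 1 := Polynomial.aeval_X _

lemma laurentInv_X : laurentInv R Polynomial.X = LaurentPolynomial.T (-1) := Polynomial.aeval_X _

lemma laurent_C (r : R) : laurent R (Polynomial.C r) = LaurentPolynomial.C r :=
  Polynomial.aeval_C _ r

lemma laurentInv_C (r : R) : laurentInv R (Polynomial.C r) = LaurentPolynomial.C r :=
  Polynomial.aeval_C _ r

variable {R} {B : Type} [CommRing B] [Algebra ℂ B]

lemma polynomial_algHom_ext {f g : Polynomial R →ₐ[ℂ] B}
    (hC : f.comp (constHom R) = g.comp (constHom R)) (hX : f Polynomial.X = g Polynomial.X) :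
    f = g := by
  refine AlgHom.ext fun p => ?_
  induction p using Polynomial.induction_on with
  | C a => exact congrArg (fun k => k a) hC
  | add p q hp hq => rw [map_add, map_add, hp, hq]
  | monomial n a _ =>
    rw [map_mul, map_mul, map_pow, map_pow, hX]
    congr 1
    exact congrArg (fun k => k a) hC

lemma laurent_algHom_ext {f g : R[T;T⁻¹] →ₐ[ℂ] B} (h : f.comp (laurent R) = g.comp (laurent R)) :
    f = g := by
  have hX : ∀ n : ℕ, f (LaurentPolynomial.T n) = g (LaurentPolynomial.T n) := fun n => by
    have := congrArg (fun k => k (Polynomial.X ^ n)) h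
    simpa [laurent_X, LaurentPolynomial.T_pow] using this
  refine AlgHom.ext fun p => ?_
  induction p using LaurentPolynomial.induction_on' with
  | add p q hp hq => rw [map_add, map_add, hp, hq]
  | C_mul_T n a =>
    rw [map_mul, map_mul, ← laurent_C]
    congr 1
    · exact congrArg (fun k => k (Polynomial.C a)) h
    · obtain ⟨m, rfl | rfl⟩ := n.eq_nat_or_neg
      · exact hX m
      · have h1 : LaurentPolynomial.T (-m : ℤ) * LaurentPolynomial.T (m : ℤ) = (1 : R[T;T⁻¹]) := by
          rw [← LaurentPolynomial.T_add, neg_add_cancel, LaurentPolynomial.T_zero]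
        have hf := congrArg f h1
        have hg := congrArg g h1
        rw [map_mul, map_one] at hf hg
        rw [hX] at hf
        calc f (LaurentPolynomial.T (-m : ℤ))
            = f (LaurentPolynomial.T (-m : ℤ)) * (g (LaurentPolynomial.T (-m : ℤ)) *
                g (LaurentPolynomial.T (m : ℤ))) := by rw [hg, mul_one]
          _ = g (LaurentPolynomial.T (-m : ℤ)) * (f (LaurentPolynomial.T (-m : ℤ)) *
                g (LaurentPolynomial.T (m : ℤ))) := by ring
          _ = _ := by rw [hf, mul_one]

lemma exists_polynomial_lift (f : R →ₐ[ℂ] B) (b : B) : ∃ g : Polynomial R →ₐ[ℂ] B,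
    g.comp (constHom R) = f ∧ g Polynomial.X = b :=
  ⟨Polynomial.eval₂AlgHom f b fun _ => Commute.all _ _, by ext a; simp, by simp⟩

lemma exists_laurent_lift (f : R →ₐ[ℂ] B) (b b' : B) (h : b * b' = 1) :
    ∃ g : R[T;T⁻¹] →ₐ[ℂ] B, (∀ r, g (LaurentPolynomial.C r) = f r) ∧
      g (LaurentPolynomial.T 1) = b ∧ g (LaurentPolynomial.T (-1)) = b' := by
  let u : Bˣ := ⟨b, b', h, by rw [mul_comm, h]⟩
  refine ⟨{ LaurentPolynomial.eval₂ f.toRingHom u with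
    commutes' := fun r => ?_ }, fun r => ?_, ?_, ?_⟩
  · change LaurentPolynomial.eval₂ f.toRingHom u (algebraMap ℂ R[T;T⁻¹] r) = _
    rw [IsScalarTower.algebraMap_apply ℂ R R[T;T⁻¹], ← LaurentPolynomial.C_eq_algebraMap,
      LaurentPolynomial.eval₂_C]
    exact f.commutes r
  · exact LaurentPolynomial.eval₂_C _ _ r
  · exact (LaurentPolynomial.eval₂_T _ _ 1).trans (by simp [u])
  · exact (LaurentPolynomial.eval₂_T _ _ (-1)).trans (by simp [u])

/-- The homomorphism `ℂ[t] → R[t]`. -/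
def baseHom (R : Type) [CommRing R] [Algebra ℂ R] : Polynomial ℂ →ₐ[ℂ] Polynomial R :=
  Polynomial.aeval Polynomial.X

lemma baseHom_X : baseHom R Polynomial.X = Polynomial.X := Polynomial.aeval_X _

lemma specMap_baseHom_line₀ : specMap (baseHom R) ≫ line₀ =
    P1.point (Polynomial.X : Polynomial R) 1 isCoprime_one_right := by
  have h := specMap_comp_point (f := Polynomial.X) (g := 1) isCoprime_one_right (isUnit_vec₀ _)
    (baseHom R) (by rw [map_one]; exact isCoprime_one_right)
  simp only [baseHom_X, map_one] at h
  exact h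

lemma specMap_baseHom_line₁ : specMap (baseHom R) ≫ line₁ =
    P1.point 1 (Polynomial.X : Polynomial R) isCoprime_one_left := by
  have h := specMap_comp_point (f := 1) (g := Polynomial.X) isCoprime_one_left (isUnit_vec₁ _)
    (baseHom R) (by rw [map_one]; exact isCoprime_one_left)
  simp only [baseHom_X, map_one] at h
  exact h

variable (R)

lemma chart₀_fst : chart₀ R ≫ fst _ _ = specMap (baseHom R) ≫ line₀ := by
  rw [chart₀, lift_fst, specMap_baseHom_line₀]

lemma chart₁_fst : chart₁ R ≫ fst _ _ = specMap (baseHom R) ≫ line₁ := by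
  rw [chart₁, lift_fst, specMap_baseHom_line₁]

lemma chart₀_snd : chart₀ R ≫ snd _ _ = specMap (constHom R) := lift_snd _ _

lemma chart₁_snd : chart₁ R ≫ snd _ _ = specMap (constHom R) := lift_snd _ _

variable {R}

lemma polynomial_point_ext {Z : Over SpecC} {y y' : Z ⟶ specOver (Polynomial R)}
    (hC : y ≫ specMap (constHom R) = y' ≫ specMap (constHom R))
    (hX : pullAlg y Polynomial.X = pullAlg y' Polynomial.X) : y = y' := by
  apply pullAlg_injective
  refine polynomial_algHom_ext ?_ hX
  rw [← pullAlg_comp_specMap, ← pullAlg_comp_specMap, hC]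

/-- `Spec R[t]` is the product of `Spec ℂ[t]` and `Spec R`, so the charts of `ℙ¹ × Spec R` are base
changes of those of `ℙ¹` and inherit being open and jointly surjective. -/
lemma isPullback_relative {p : specOver (Polynomial ℂ) ⟶ P1}
    {j : specOver (Polynomial R) ⟶ P1 ⊗ specOver R} (h₁ : j ≫ fst _ _ = specMap (baseHom R) ≫ p)
    (h₂ : j ≫ snd _ _ = specMap (constHom R)) :
    IsPullback j (specMap (baseHom R)) (fst _ _) p := by
  refine isPullback_of_points h₁ (fun Z x y hxy => ?_) fun Z z z' hz hz' => ?_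
  · obtain ⟨g, hg, hgX⟩ := exists_polynomial_lift (pullAlg (x ≫ snd _ _))
      (pullAlg y Polynomial.X)
    have hy : toSpecOver g ≫ specMap (baseHom R) = y := by
      apply pullAlg_injective
      rw [pullAlg_comp_specMap, pullAlg_toSpecOver]
      exact Polynomial.algHom_ext (by rw [AlgHom.comp_apply, baseHom_X, hgX])
    refine ⟨toSpecOver g, ?_, hy⟩
    ext1
    · rw [Category.assoc, h₁, ← Category.assoc, hy, hxy]
    · apply pullAlg_injective
      rw [Category.assoc, h₂, pullAlg_comp_specMap, pullAlg_toSpecOver, hg]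
  · refine polynomial_point_ext ?_ ?_
    · rw [← h₂, ← Category.assoc, hz, Category.assoc]
    · have := congrArg (fun k => pullAlg k Polynomial.X) hz'
      simpa only [pullAlg_comp_specMap, AlgHom.comp_apply, baseHom_X] using this

lemma point_overlap : P1.point (LaurentPolynomial.T 1 : R[T;T⁻¹]) 1 isCoprime_one_right =
    P1.point 1 (LaurentPolynomial.T (-1)) isCoprime_one_left := by
  have h1 : (LaurentPolynomial.T 1 * LaurentPolynomial.T (-1) : R[T;T⁻¹]) = 1 := by
    rw [← LaurentPolynomial.T_add, add_neg_cancel, LaurentPolynomial.T_zero]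
  have h := point_smul (f := (1 : R[T;T⁻¹])) (g := LaurentPolynomial.T (-1))
    (u := LaurentPolynomial.T 1) (LaurentPolynomial.isUnit_T 1) isCoprime_one_left
    (by rw [h1]; exact isCoprime_one_right) (isUnit_vec₁ _)
  simp only [h1, mul_one] at h
  exact h

lemma laurent_comp_chart : specMap (laurent R) ≫ chart₀ R = specMap (laurentInv R) ≫ chart₁ R := by
  ext1
  · have h₀ := specMap_comp_point (f := (Polynomial.X : Polynomial R)) (g := 1)
      isCoprime_one_right (isUnit_vec₀ _) (laurent R) (by rw [map_one]; exact isCoprime_one_right)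
    have h₁ := specMap_comp_point (f := 1) (g := (Polynomial.X : Polynomial R))
      isCoprime_one_left (isUnit_vec₁ _) (laurentInv R)
      (by rw [map_one]; exact isCoprime_one_left)
    simp only [laurent_X, laurentInv_X, map_one] at h₀ h₁
    rw [chart₀, chart₁, Category.assoc, Category.assoc, lift_fst, lift_fst]
    exact h₀.trans (point_overlap.trans h₁.symm)
  · rw [Category.assoc, chart₀_snd, Category.assoc, chart₁_snd, ← specMap_comp, ← specMap_comp]
    congr 1
    exact AlgHom.ext fun r => (laurent_C R r).trans (laurentInv_C R r).symm

/-- The two coordinates of a common point are inverse to each other and thus define a homomorphism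
on Laurent polynomials. -/
lemma isPullback_laurent :
    IsPullback (specMap (laurent R)) (specMap (laurentInv R)) (chart₀ R) (chart₁ R) := by
  refine isPullback_of_points laurent_comp_chart (fun Z x y hxy => ?_) fun Z z z' hz _ => ?_
  · have hC : x ≫ specMap (constHom R) = y ≫ specMap (constHom R) := by
      rw [← chart₀_snd, ← Category.assoc, hxy, Category.assoc, chart₁_snd, chart₀_snd]
    have hX : pullAlg x Polynomial.X * pullAlg y Polynomial.X = 1 := by
      have := mul_eq_one_of_line_eq (y := x ≫ specMap (baseHom R)) (y' := y ≫ specMap (baseHom R))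
        (by rw [Category.assoc, ← chart₀_fst, ← Category.assoc, hxy, Category.assoc, chart₁_fst,
          Category.assoc])
      simpa only [pullAlg_comp_specMap, AlgHom.comp_apply, baseHom_X] using this
    obtain ⟨g, hgC, hgT, hgT'⟩ := exists_laurent_lift ((pullAlg x).comp (constHom R)) _ _ hX
    refine ⟨toSpecOver g, ?_, ?_⟩
    · refine polynomial_point_ext ?_ ?_
      · apply pullAlg_injective
        rw [Category.assoc, ← specMap_comp, pullAlg_comp_specMap, pullAlg_comp_specMap,
          pullAlg_toSpecOver]
        ext r
        exact (congrArg g (laurent_C R r)).trans (hgC r)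
      · rw [pullAlg_comp_specMap, pullAlg_toSpecOver, AlgHom.comp_apply, laurent_X, hgT]
    · refine polynomial_point_ext ?_ ?_
      · apply pullAlg_injective
        rw [← hC, Category.assoc, ← specMap_comp, pullAlg_comp_specMap, pullAlg_comp_specMap,
          pullAlg_toSpecOver]
        ext r
        exact (congrArg g (laurentInv_C R r)).trans (hgC r)
      · rw [pullAlg_comp_specMap, pullAlg_toSpecOver, AlgHom.comp_apply, laurentInv_X, hgT']
  · apply pullAlg_injective
    apply laurent_algHom_ext
    rw [← pullAlg_comp_specMap, ← pullAlg_comp_specMap, hz]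

variable (R)

lemma isTwoCover_chart :
    IsTwoCover (specMap (laurent R)) (specMap (laurentInv R)) (chart₀ R) (chart₁ R) where
  isOpen₀ := MorphismProperty.of_isPullback (P := @IsOpenImmersion)
    (isPullback_left (isPullback_relative (chart₀_fst R) (chart₀_snd R))).flip isOpenImmersion_line₀
  isOpen₁ := MorphismProperty.of_isPullback (P := @IsOpenImmersion)
    (isPullback_left (isPullback_relative (chart₁_fst R) (chart₁_snd R))).flip isOpenImmersion_line₁
  exists_mem z := by
    have h : IsOpenCover (pairMap line₀ line₁) :=
      { isOpen := by
          rintro (_ | _)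
          exacts [isOpenImmersion_line₀, isOpenImmersion_line₁]
        exists_mem := fun z =>
          (exists_mem_line z).elim (fun h => ⟨false, h⟩) fun h => ⟨true, h⟩ }
    have h' := h.of_isPullback (V := fun _ => specOver (Polynomial R))
      (a := fun i => match i with
        | false => chart₀ R
        | true => chart₁ R)
      (u := fun i => match i with
        | false => specMap (baseHom R)
        | true => specMap (baseHom R))
      (b := fst P1 (specOver R)) (fun i => match i with
        | false => isPullback_relative (chart₀_fst R) (chart₀_snd R)
        | true => isPullback_relative (chart₁_fst R) (chart₁_snd R))
    obtain ⟨i, hi⟩ := h'.exists_mem z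
    cases i
    · exact Or.inl hi
    · exact Or.inr hi
  isPullback := isPullback_laurent

end RelativeLine

end

section

open Limits
open scoped MonObj LaurentPolynomial

/-! ### Comparing polynomials in `t` and in `t⁻¹` -/

section LaurentCoefficients

variable {R : Type} [CommRing R] [Algebra ℂ R]

lemma laurent_apply (f : Polynomial R) : laurent R f = Polynomial.toLaurent f := by
  have h : Polynomial.aeval (R := R) (LaurentPolynomial.T 1 : R[T;T⁻¹]) =
      Polynomial.toLaurentAlg := Polynomial.algHom_ext (by simp)
  exact congrArg (fun k => k f) h

lemma laurentInv_apply (f : Polynomial R) :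
    laurentInv R f = LaurentPolynomial.invert (laurent R f) := by
  have h : Polynomial.aeval (R := R) (LaurentPolynomial.T (-1) : R[T;T⁻¹]) =
      (LaurentPolynomial.invert (R := R)).toAlgHom.comp
        (Polynomial.aeval (R := R) (LaurentPolynomial.T 1 : R[T;T⁻¹])) :=
    Polynomial.algHom_ext (by simp)
  exact congrArg (fun k => k f) h

lemma laurent_coeff (f : Polynomial R) (n : ℕ) : (laurent R f).coeff n = f.coeff n := by
  rw [laurent_apply, LaurentPolynomial.coeff_toLaurent]
  exact Finsupp.mapDomain_apply Nat.castEmbedding.injective _ _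

lemma laurent_coeff_neg (f : Polynomial R) {n : ℤ} (hn : n < 0) : (laurent R f).coeff n = 0 := by
  rw [laurent_apply, LaurentPolynomial.coeff_toLaurent]
  refine Finsupp.mapDomain_of_notMem_range _ _ ?_
  rintro ⟨m, rfl⟩
  change ((m : ℕ) : ℤ) < 0 at hn
  omega

lemma laurentInv_coeff (f : Polynomial R) (n : ℤ) :
    (laurentInv R f).coeff n = (laurent R f).coeff (-n) := by
  rw [laurentInv_apply, LaurentPolynomial.invert_apply]

lemma laurent_injective : Function.Injective (laurent R) := fun f g h => by
  ext n
  rw [← laurent_coeff, h, laurent_coeff]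

lemma laurentInv_injective : Function.Injective (laurentInv R) := fun f g h => by
  rw [laurentInv_apply, laurentInv_apply] at h
  exact laurent_injective (LaurentPolynomial.invert.injective h)

omit [Algebra ℂ R] in
lemma T_mul_coeff (d : ℤ) (f : R[T;T⁻¹]) (n : ℤ) :
    (LaurentPolynomial.T d * f).coeff n = f.coeff (n - d) := by
  rw [LaurentPolynomial.T, AddMonoidAlgebra.coeff_single_mul_apply, one_mul, neg_add_eq_sub]

lemma coeff_eq_of_laurent_eq {f g : Polynomial R} {d : ℤ}
    (h : laurent R f = LaurentPolynomial.T d * laurentInv R g) (i : ℕ) :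
    f.coeff i = (laurent R g).coeff (d - i) := by
  rw [← laurent_coeff, h, T_mul_coeff, laurentInv_coeff, neg_sub]

lemma coeff_eq_zero_of_laurent_eq {f g : Polynomial R} {d : ℤ}
    (h : laurent R f = LaurentPolynomial.T d * laurentInv R g) {i : ℕ} (hi : d < i) :
    f.coeff i = 0 := by
  rw [coeff_eq_of_laurent_eq h, laurent_coeff_neg _ (by omega)]

/-- Functions regular on both charts are constant: one side has no negative powers of `t`, the other
no positive ones. -/
lemma eq_C_of_laurent_eq {f g : Polynomial R} (h : laurent R f = laurentInv R g) :
    f = Polynomial.C (f.coeff 0) ∧ g = Polynomial.C (f.coeff 0) := by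
  have hf : f = Polynomial.C (f.coeff 0) := by
    ext i
    cases i with
    | zero => simp
    | succ i =>
      rw [coeff_eq_zero_of_laurent_eq (d := 0) (g := g) (by
        rw [h, LaurentPolynomial.T_zero, one_mul]) (by omega), Polynomial.coeff_C_succ]
  refine ⟨hf, laurentInv_injective ?_⟩
  rw [← h, hf, laurent_C, laurentInv_C]
  simp

/-- A polynomial of degree at most `d` is reversed by a polynomial. -/
lemma exists_reverse (f : Polynomial R) (d : ℤ) (h : ∀ i : ℕ, d < i → f.coeff i = 0) :
    ∃ g, laurent R f = LaurentPolynomial.T d * laurentInv R g := by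
  refine ⟨∑ i ∈ f.support, Polynomial.monomial (d - i).toNat (f.coeff i), ?_⟩
  conv_lhs => rw [f.as_sum_support]
  rw [map_sum, map_sum, Finset.mul_sum]
  refine Finset.sum_congr rfl fun i hi => ?_
  have hid : (i : ℤ) ≤ d := by
    by_contra hlt
    exact Polynomial.mem_support_iff.1 hi (h i (by omega))
  rw [← Polynomial.C_mul_X_pow_eq_monomial, ← Polynomial.C_mul_X_pow_eq_monomial, map_mul, map_mul,
    map_pow, map_pow, laurent_X, laurentInv_X, laurent_C, laurentInv_C, LaurentPolynomial.T_pow,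
    LaurentPolynomial.T_pow, mul_left_comm, ← LaurentPolynomial.T_add]
  congr 2
  rw [Int.toNat_of_nonneg (by omega)]
  ring

end LaurentCoefficients

section CoordinateUnit

variable {R : Type} [CommRing R]

/-- The coordinate as a unit. -/
def tUnit (R : Type) [CommRing R] : (R[T;T⁻¹])ˣ where
  val := LaurentPolynomial.T 1
  inv := LaurentPolynomial.T (-1)
  val_inv := by rw [← LaurentPolynomial.T_add]; simp
  inv_val := by rw [← LaurentPolynomial.T_add]; simp

lemma tUnit_zpow (d : ℤ) : ((tUnit R ^ d : (R[T;T⁻¹])ˣ) : R[T;T⁻¹]) = LaurentPolynomial.T d := by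
  obtain ⟨n, rfl | rfl⟩ := d.eq_nat_or_neg
  · rw [zpow_natCast, Units.val_pow_eq_pow_val]
    change LaurentPolynomial.T 1 ^ n = _
    rw [LaurentPolynomial.T_pow, mul_one]
  · rw [zpow_neg, zpow_natCast, ← inv_pow, Units.val_pow_eq_pow_val]
    change LaurentPolynomial.T (-1) ^ n = _
    rw [LaurentPolynomial.T_pow, mul_neg, mul_one]

end CoordinateUnit

/-! ### Compatibility of the charts with base change and with `∞` -/

section ChartBaseChange

variable {R R' : Type} [CommRing R] [Algebra ℂ R] [CommRing R'] [Algebra ℂ R']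

/-- Evaluation at `t = 0`. -/
abbrev evalZero (R : Type) [CommRing R] [Algebra ℂ R] : Polynomial R →ₐ[ℂ] R :=
  (Polynomial.aeval (R := R) (0 : R)).restrictScalars ℂ

lemma evalZero_apply (f : Polynomial R) : evalZero R f = f.coeff 0 :=
  (Polynomial.coeff_zero_eq_aeval_zero f).symm

lemma polyMap_comp_constHom (φ : R →ₐ[ℂ] R') :
    (polyMap φ).comp (constHom R) = (constHom R').comp φ := by
  refine AlgHom.ext fun r => ?_
  simp

lemma polyMap_comp_baseHom (φ : R →ₐ[ℂ] R') : (polyMap φ).comp (baseHom R) = baseHom R' :=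
  Polynomial.algHom_ext (by simp [baseHom])

lemma specMap_polyMap_chart₀ (φ : R →ₐ[ℂ] R') :
    specMap (polyMap φ) ≫ chart₀ R = chart₀ R' ≫ (P1 ◁ specMap φ) := by
  ext1
  · rw [Category.assoc, Category.assoc, whiskerLeft_fst, chart₀_fst, chart₀_fst, ← Category.assoc,
      ← specMap_comp, polyMap_comp_baseHom]
  · rw [Category.assoc, Category.assoc, whiskerLeft_snd, chart₀_snd, ← Category.assoc, chart₀_snd,
      ← specMap_comp, ← specMap_comp, polyMap_comp_constHom]

lemma specMap_polyMap_chart₁ (φ : R →ₐ[ℂ] R') :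
    specMap (polyMap φ) ≫ chart₁ R = chart₁ R' ≫ (P1 ◁ specMap φ) := by
  ext1
  · rw [Category.assoc, Category.assoc, whiskerLeft_fst, chart₁_fst, chart₁_fst, ← Category.assoc,
      ← specMap_comp, polyMap_comp_baseHom]
  · rw [Category.assoc, Category.assoc, whiskerLeft_snd, chart₁_snd, ← Category.assoc, chart₁_snd,
      ← specMap_comp, ← specMap_comp, polyMap_comp_constHom]

lemma fibreChart_eq₀ {K : Type} [Field K] [Algebra ℂ K] (x : R →ₐ[ℂ] K) :
    fibreChart x (P1.point Polynomial.X 1 isCoprime_one_right) =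
      specMap (polyMap x) ≫ chart₀ R := by
  rw [specMap_polyMap_chart₀]
  ext1
  · rw [fibreChart, lift_fst, Category.assoc, whiskerLeft_fst, chart₀, lift_fst]
  · rw [fibreChart, lift_snd, Category.assoc, whiskerLeft_snd, chart₀, lift_snd_assoc, specMap_comp]

lemma fibreChart_eq₁ {K : Type} [Field K] [Algebra ℂ K] (x : R →ₐ[ℂ] K) :
    fibreChart x (P1.point 1 Polynomial.X isCoprime_one_left) =
      specMap (polyMap x) ≫ chart₁ R := by
  rw [specMap_polyMap_chart₁]
  ext1
  · rw [fibreChart, lift_fst, Category.assoc, whiskerLeft_fst, chart₁, lift_fst]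
  · rw [fibreChart, lift_snd, Category.assoc, whiskerLeft_snd, chart₁, lift_snd_assoc, specMap_comp]

lemma evalZero_chart₀ : specMap (evalZero R) ≫ chart₀ R = inftySection R := by
  ext1
  · rw [inftySection, lift_fst, chart₀, Category.assoc, lift_fst]
    have h := specMap_comp_point (f := (Polynomial.X : Polynomial R)) (g := 1)
      isCoprime_one_right (isUnit_vec₀ _) (evalZero R) (by rw [map_one]; exact isCoprime_one_right)
    have hX : evalZero R Polynomial.X = 0 := by simp
    simp only [hX, map_one] at h
    exact h
  · rw [inftySection, lift_snd, Category.assoc, chart₀_snd, ← specMap_comp, ← specMap_id]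
    congr 1
    exact AlgHom.ext fun r => by simp

lemma evalZero_comp_polyMap (φ : R →ₐ[ℂ] R') :
    (evalZero R').comp (polyMap φ) = φ.comp (evalZero R) :=
  AlgHom.ext fun f => by
    rw [AlgHom.comp_apply, AlgHom.comp_apply, evalZero_apply, evalZero_apply, polyMap_coeff]

end ChartBaseChange

end

section

open Limits
open scoped MonObj

/-! ### Base change of principal bundles and affineness -/

section BundlePullback

variable {X : Type} [AddCommGroup X] {P S Q S' : Over SpecC} [ModObj (Torus X) P] {π : P ⟶ S}

/-- An open subscheme as a scheme over `ℂ`. -/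
def openOver (U : S.left.Opens) : Over SpecC := Over.mk (U.ι ≫ S.hom)

/-- The inclusion of an open subscheme. -/
def openIncl (U : S.left.Opens) : openOver U ⟶ S := Over.homMk U.ι rfl

lemma IsPrincipalBundle.exists_section (hπ : IsPrincipalBundle X π) (b : S.left) :
    ∃ U : S.left.Opens, b ∈ U ∧ ∃ τ : openOver U ⟶ P, τ ≫ π = openIncl U := by
  obtain ⟨U, hb, τ, hτ⟩ := hπ.locally_trivial b
  refine ⟨U, hb, Over.homMk τ ?_, Over.OverMorphism.ext hτ⟩
  change τ ≫ P.hom = U.ι ≫ S.hom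
  rw [← hτ, Category.assoc, Over.w]

/-- The base change of a principal bundle. -/
lemma IsPrincipalBundle.exists_modObj_of_isPullback (hπ : IsPrincipalBundle X π) {k : Q ⟶ P}
    {h : Q ⟶ S'} {j : S' ⟶ S} (H : IsPullback k h π j) :
    ∃ _ : ModObj (Torus X) Q, IsModHom (Torus X) k ∧ IsPrincipalBundle X h := by
  let a : ∀ {Z : Over SpecC}, (Z ⟶ Torus X) → (Z ⟶ Q) → (Z ⟶ Q) := fun t q =>
    H.lift (t • (q ≫ k)) (q ≫ h) (by rw [hπ.smul_comp, Category.assoc, H.w, Category.assoc])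
  have ak : ∀ {Z : Over SpecC} (t : Z ⟶ Torus X) (q : Z ⟶ Q), a t q ≫ k = t • (q ≫ k) :=
    fun t q => H.lift_fst _ _ _
  have ah : ∀ {Z : Over SpecC} (t : Z ⟶ Torus X) (q : Z ⟶ Q), a t q ≫ h = q ≫ h :=
    fun t q => H.lift_snd _ _ _
  have nat : ∀ {Z Z' : Over SpecC} (g : Z' ⟶ Z) (t : Z ⟶ Torus X) (q : Z ⟶ Q),
      g ≫ a t q = a (g ≫ t) (g ≫ q) := fun g t q => H.hom_ext
    (by rw [Category.assoc, ak, ak, comp_smul, Category.assoc])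
    (by rw [Category.assoc, ah, ah, Category.assoc])
  have one : ∀ {Z : Over SpecC} (q : Z ⟶ Q), a 1 q = q := fun q => H.hom_ext
    (by rw [ak, one_smul_point]) (ah _ _)
  have mul : ∀ {Z : Over SpecC} (t t' : Z ⟶ Torus X) (q : Z ⟶ Q), a (t * t') q = a t (a t' q) :=
    fun t t' q => H.hom_ext (by rw [ak, ak, ak, smul_smul_point]) (by rw [ah, ah, ah])
  let inst : ModObj (Torus X) Q := modObjOfPoints a nat one mul
  have smul_def : ∀ {Z : Over SpecC} (t : Z ⟶ Torus X) (q : Z ⟶ Q), t • q = a t q :=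
    fun t q => modObjOfPoints_smul a nat one mul t q
  refine ⟨inst, (isModHom_iff k).2 fun Z t q => by rw [smul_def, ak], ?_, ?_, ?_⟩
  · intro Z t q
    rw [smul_def, ah]
  · intro Z p q hpq
    obtain ⟨t, ht, huniq⟩ := hπ.simply_transitive Z (p ≫ k) (q ≫ k)
      (by rw [Category.assoc, Category.assoc, H.w, reassoc_of% hpq])
    refine ⟨t, H.hom_ext (by rw [smul_def, ak, ht]) (by rw [smul_def, ah, hpq]), fun t' ht' => ?_⟩
    refine huniq t' ?_
    change t' • (p ≫ k) = q ≫ k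
    rw [← ak, ← smul_def, ht']
  · intro b
    obtain ⟨U, hb, τ, hτ⟩ := hπ.exists_section (j.left b)
    let g : openOver (j.left ⁻¹ᵁ U) ⟶ openOver U := Over.homMk (j.left ∣_ U) (by
      change (j.left ∣_ U) ≫ U.ι ≫ S.hom = (j.left ⁻¹ᵁ U).ι ≫ S'.hom
      rw [morphismRestrict_ι_assoc, Over.w])
    have hg : g ≫ openIncl U = openIncl (j.left ⁻¹ᵁ U) ≫ j :=
      Over.OverMorphism.ext (morphismRestrict_ι _ _)
    refine ⟨j.left ⁻¹ᵁ U, hb, (H.lift (g ≫ τ) (openIncl _)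
      (by rw [Category.assoc, hτ, hg])).left, ?_⟩
    exact congrArg (fun k => Over.Hom.left k) (H.lift_snd (g ≫ τ) (openIncl (j.left ⁻¹ᵁ U))
      (by rw [Category.assoc, hτ, hg]))

/-- A section over `V` trivializes the bundle there, by simple transitivity. -/
lemma IsPrincipalBundle.isPullback_of_section (hπ : IsPrincipalBundle X π) {V : Over SpecC}
    {u : V ⟶ S} {τ : V ⟶ P} (hτ : τ ≫ π = u) :
    IsPullback (fst (Torus X) V • (snd (Torus X) V ≫ τ)) (snd _ _) π u := by
  refine isPullback_of_points ?_ (fun Z x y hxy => ?_) fun Z z z' hz hz' => ?_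
  · rw [hπ.smul_comp, Category.assoc, hτ]
  · obtain ⟨t, ht⟩ := hπ.exists_smul_eq (p := y ≫ τ) (q := x) (by rw [Category.assoc, hτ, hxy])
    refine ⟨lift t y, ?_, lift_snd _ _⟩
    rw [comp_smul, lift_fst, lift_snd_assoc, ht]
  · ext1
    · rw [comp_smul, comp_smul, reassoc_of% hz'] at hz
      exact hπ.smul_left_cancel hz
    · exact hz'

lemma isAffineHom_snd (V : Over SpecC) : IsAffineHom (snd (Torus X) V).left := by
  have : IsAffineHom (Torus X).hom :=
    inferInstanceAs (IsAffineHom (Spec.map (CommRingCat.ofHom (algebraMap ℂ (AddMonoidAlgebra ℂ X)))))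
  rw [Over.snd_left]
  exact MorphismProperty.of_isPullback (P := @IsAffineHom)
    (IsPullback.of_hasPullback (Torus X).hom V.hom) this

/-- Affineness is local on the target, and locally `π` is the projection of a product with the
affine scheme `T`. -/
lemma IsPrincipalBundle.isAffineHom (hπ : IsPrincipalBundle X π) : IsAffineHom π.left := by
  choose U hU τ hτ using hπ.exists_section
  have hc : IsOpenCover (fun b => openIncl (U b)) :=
    { isOpen := fun b => inferInstanceAs (IsOpenImmersion (U b).ι)
      exists_mem := fun z => ⟨z, by
        change z ∈ Set.range (U z).ι
        rw [Scheme.Opens.range_ι]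
        exact hU z⟩ }
  have := @HasAffineProperty.instIsZariskiLocalAtTarget _ _
    instHasAffinePropertyIsAffineHomIsAffine.{0}
  refine IsZariskiLocalAtTarget.of_openCover (P := @IsAffineHom) hc.openCover fun b => ?_
  have h := isAffineHom_snd (X := X) (openOver (U b))
  have H := isPullback_left (hπ.isPullback_of_section (hτ b))
  change IsAffineHom (pullback.snd π.left (openIncl (U b)).left)
  rw [← H.isoPullback_inv_snd]
  infer_instance

/-- The base change of a principal bundle to an affine scheme is affine. -/
lemma IsPrincipalBundle.exists_algebra (hπ : IsPrincipalBundle X π) {D : Type} [CommRing D]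
    [Algebra ℂ D] (j : specOver D ⟶ S) :
    ∃ (B : Type) (_ : CommRing B) (_ : Algebra ℂ B) (_ : ModObj (Torus X) (specOver B))
      (i : D →ₐ[ℂ] B) (k : specOver B ⟶ P), IsPullback k (specMap i) π j ∧
      IsModHom (Torus X) k ∧ IsPrincipalBundle X (specMap i) := by
  let Q := pullback π j
  have h1 : IsAffineHom (pullback.snd π j).left :=
    MorphismProperty.of_isPullback (P := @IsAffineHom)
      (isPullback_left (IsPullback.of_hasPullback π j)) hπ.isAffineHom
  have h2 : IsAffine Q.left := by
    have : IsAffine (specOver D).left := inferInstanceAs (IsAffine (Spec (.of D)))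
    exact isAffine_of_isAffineHom (pullback.snd π j).left
  have h3 : IsIso (canon Q) := by
    have : IsIso (canon Q).left := by
      change IsIso (Q.left.toSpecΓ ≫ Spec.map (𝟙 _))
      rw [Spec.map_id]
      infer_instance
    have : IsIso ((Over.forget SpecC).map (canon Q)) := this
    exact isIso_of_reflects_iso (canon Q) (Over.forget SpecC)
  obtain ⟨i, hi⟩ := exists_specMap_eq (inv (canon Q) ≫ pullback.snd π j)
  have H : IsPullback (inv (canon Q) ≫ pullback.fst π j) (specMap i) π j := by
    rw [hi]
    exact (IsPullback.of_hasPullback π j).of_iso (asIso (canon Q)) (Iso.refl _) (Iso.refl _)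
      (Iso.refl _) (by simp) (by simp) (by simp) (by simp)
  obtain ⟨inst, hk, hp⟩ := hπ.exists_modObj_of_isPullback H
  exact ⟨Fn Q, inferInstance, inferInstance, inst, i, _, H, hk, hp⟩

end BundlePullback

end

section

open Limits
open scoped MonObj

/-! ### Weight spaces of an affine principal bundle as invertible modules -/

section AffineBundle

variable {X : Type} [AddCommGroup X] {B B' C C' D D' : Type} [CommRing B] [Algebra ℂ B]
  [CommRing B'] [Algebra ℂ B'] [CommRing C] [Algebra ℂ C] [CommRing C'] [Algebra ℂ C'] [CommRing D]
  [Algebra ℂ D] [CommRing D'] [Algebra ℂ D']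

/-- The value of a character at a point of the torus with values in an algebra. -/
def chr (t : specOver C ⟶ Torus X) (l : X) : C := algOf t (AddMonoidAlgebra.single l 1)

lemma fnSpec_chr (t : specOver C ⟶ Torus X) (l : X) : fnSpec C (chr t l) = chi t l :=
  (pullAlg_eq_algOf t _).symm

lemma chr_comp (f : C →ₐ[ℂ] C') (t : specOver C ⟶ Torus X) (l : X) :
    chr (specMap f ≫ t) l = f (chr t l) := by
  rw [chr, algOf_comp, algOf_specMap]
  rfl

lemma chr_ext {t t' : specOver C ⟶ Torus X} (h : ∀ l, chr t l = chr t' l) : t = t' :=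
  torus_ext fun l => by rw [← fnSpec_chr, ← fnSpec_chr, h]

lemma chr_zero (t : specOver C ⟶ Torus X) : chr t 0 = 1 := map_one (algOf t)

lemma chr_univTorus (l : X) : chr (univTorus X C) l = AddMonoidAlgebra.single l 1 :=
  (fnSpec _).injective (by rw [fnSpec_chr, chi_univTorus])

lemma chr_one (l : X) : chr (1 : specOver C ⟶ Torus X) l = 1 :=
  (fnSpec _).injective (by rw [fnSpec_chr, chi_one, map_one])

variable [ModObj (Torus X) (specOver B)] [ModObj (Torus X) (specOver B')]

lemma eq_chr_mul {f g : B →ₐ[ℂ] C} {t : specOver C ⟶ Torus X} (h : t • specMap f = specMap g)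
    {l : X} {b : B} (hb : b ∈ weightSpace B l) : g b = chr t l * f b := by
  have := mem_weightSpace_iff.1 hb _ t (specMap f)
  rw [h, pullAlg_specMap_apply, pullAlg_specMap_apply, ← fnSpec_chr, ← map_mul] at this
  exact (fnSpec C).injective this

lemma map_mem_weightSpace {f : B →ₐ[ℂ] B'} (hf : IsModHom (Torus X) (specMap f)) {l : X} {b : B}
    (hb : b ∈ weightSpace B l) : f b ∈ weightSpace B' l := by
  rw [mem_weightSpace_iff]
  intro Z t y
  have := mem_weightSpace_iff.1 hb _ t (y ≫ specMap f)
  rwa [← (isModHom_iff _).1 hf, pullAlg_comp_specMap, pullAlg_comp_specMap] at this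

namespace IsPrincipalBundle

variable {i : D →ₐ[ℂ] B} (hi : IsPrincipalBundle X (specMap i))

include hi

lemma exists_chr {f g : B →ₐ[ℂ] C} (h : f.comp i = g.comp i) :
    ∃ t : specOver C ⟶ Torus X, t • specMap f = specMap g :=
  hi.exists_smul_eq (by rw [← specMap_comp, h, specMap_comp])

lemma map_mem_weightSpace_zero (d : D) : i d ∈ weightSpace B (0 : X) := by
  rw [mem_weightSpace_iff]
  intro Z t y
  have := congrArg (fun k => pullAlg k d) (hi.smul_comp Z t y)
  simp only [pullAlg_comp_specMap] at this
  rw [chi_zero, one_mul]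
  exact this

lemma smul_mem_weightSpace (d : D) {l : X} {b : B} (hb : b ∈ weightSpace B l) :
    i d * b ∈ weightSpace B l := by
  have := weightSpace_mul_mem B (hi.map_mem_weightSpace_zero d) hb
  rwa [zero_add] at this

lemma exists_local_section (m : Ideal D) [hm : m.IsPrime] :
    ∃ f ∉ m, ∃ ε : B →ₐ[ℂ] Localization.Away f,
      ε.comp i = IsScalarTower.toAlgHom ℂ D (Localization.Away f) := by
  let z : PrimeSpectrum D := ⟨m, hm⟩
  obtain ⟨U, hzU, τ, hτ⟩ := hi.exists_section z
  let V : TopologicalSpace.Opens (PrimeSpectrum D) := U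
  obtain ⟨_, ⟨f, rfl⟩, hzf, hfU⟩ :=
    PrimeSpectrum.isTopologicalBasis_basic_opens.exists_subset_of_mem_open
      (show z ∈ (V : Set (PrimeSpectrum D)) from hzU) V.2
  let j : specOver (Localization.Away f) ⟶ specOver D :=
    specMap (IsScalarTower.toAlgHom ℂ D (Localization.Away f))
  have hj : Set.range j.left ⊆ Set.range U.ι := by
    rw [Scheme.Opens.range_ι]
    refine subset_trans (le_of_eq ?_) hfU
    exact PrimeSpectrum.localization_away_comap_range (Localization.Away f) f
  let g : (specOver (Localization.Away f)).left ⟶ U.toScheme := IsOpenImmersion.lift U.ι j.left hj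
  have hg : g ≫ U.ι = j.left := IsOpenImmersion.lift_fac _ _ _
  let g' : specOver (Localization.Away f) ⟶ openOver U := Over.homMk g (by
    change g ≫ U.ι ≫ (specOver D).hom = _
    rw [← Category.assoc, hg, Over.w])
  have hg' : g' ≫ openIncl U = j := Over.OverMorphism.ext hg
  obtain ⟨ε, hε⟩ := exists_specMap_eq (g' ≫ τ)
  refine ⟨f, hzf, ε, specMap_injective ?_⟩
  rw [specMap_comp, hε, Category.assoc, hτ, hg']

/-- A local section is a left inverse of `i` after localization. Hence the annihilator of an element
of the kernel lies in no maximal ideal. -/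
lemma injective : Function.Injective i := by
  rw [injective_iff_map_eq_zero]
  intro d hd
  let I : Ideal D := LinearMap.ker (LinearMap.toSpanSingleton D D d)
  have hI : I = ⊤ := by
    by_contra hne
    obtain ⟨m, hm, hIm⟩ := Ideal.exists_le_maximal I hne
    obtain ⟨f, hf, ε, hε⟩ := hi.exists_local_section m
    have h0 : algebraMap D (Localization.Away f) d = 0 := by
      have := congrArg (fun k => k d) hε
      simp only [AlgHom.comp_apply, hd, map_zero] at this
      exact this.symm
    obtain ⟨⟨_, n, rfl⟩, hn⟩ := (IsLocalization.map_eq_zero_iff (Submonoid.powers f) _ d).1 h0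
    exact hf (hm.isPrime.mem_of_pow_mem n (hIm hn))
  have : (1 : D) ∈ I := hI ▸ Submodule.mem_top
  simpa [I] using this

/-- Invariant functions descend. Near any point of the base, an invariant `b` is the pullback of its
restriction along a local section; `I` collects the `f` for which `f b` descends. -/
lemma mem_range_of_mem {b : B} (hb : b ∈ weightSpace B (0 : X)) : ∃ d, i d = b := by
  let I : Ideal D :=
    { carrier := {f | ∃ d, i d = i f * b}
      add_mem' := by
        rintro f g ⟨d, hd⟩ ⟨e, he⟩
        exact ⟨d + e, by rw [map_add, map_add, hd, he, add_mul]⟩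
      zero_mem' := ⟨0, by simp⟩
      smul_mem' := by
        rintro f g ⟨d, hd⟩
        exact ⟨f * d, by rw [smul_eq_mul, map_mul, map_mul, hd, mul_assoc]⟩ }
  have hI : I = ⊤ := by
    by_contra hne
    obtain ⟨m, hm, hIm⟩ := Ideal.exists_le_maximal I hne
    obtain ⟨f, hf, ε, hε⟩ := hi.exists_local_section m
    let can : B →ₐ[ℂ] Localization.Away (i f) := IsScalarTower.toAlgHom ℂ B _
    obtain ⟨w, hmap⟩ : ∃ w : Localization.Away f →ₐ[ℂ] Localization.Away (i f),
        ∀ d, w (algebraMap D _ d) = can (i d) := by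
      have hu : ∀ y : Submonoid.powers f, IsUnit ((can.comp i) y) := by
        rintro ⟨_, n, rfl⟩
        rw [map_pow]
        exact (IsLocalization.Away.algebraMap_isUnit (i f)).pow n
      exact ⟨IsLocalization.liftAlgHom hu, fun d => IsLocalization.lift_eq _ _⟩
    have hcan : can.comp i = (w.comp ε).comp i := by
      rw [AlgHom.comp_assoc, hε]
      ext d
      exact (hmap d).symm
    -- The tautological point and the local section lie over the same base point, so they differ by
    -- a torus point, on which weight `0` does not depend.
    obtain ⟨t, ht⟩ := hi.exists_chr hcan
    have h1 := eq_chr_mul ht hb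
    rw [chr_zero, one_mul] at h1
    obtain ⟨⟨d, _, n, rfl⟩, hd⟩ := IsLocalization.surj (Submonoid.powers f) (ε b)
    have h2 := congrArg w hd
    rw [map_mul, hmap, hmap, ← AlgHom.comp_apply, h1, ← map_mul] at h2
    obtain ⟨⟨_, k, rfl⟩, hk⟩ := (IsLocalization.eq_iff_exists (Submonoid.powers (i f)) _).1 h2
    -- The power `n` clears the denominator of `ε b`, and `k` makes the resulting equation hold in
    -- `B` itself.
    refine hf (hm.isPrime.mem_of_pow_mem (k + n) (hIm ⟨f ^ k * d, ?_⟩))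
    simp only at hk
    rw [map_mul, map_pow, ← hk, map_pow, map_pow, pow_add]
    ring
  obtain ⟨d, hd⟩ : (1 : D) ∈ I := hI ▸ Submodule.mem_top
  exact ⟨d, by rw [hd, map_one, one_mul]⟩

/-- Sections over closed subschemes can be normalized by weight vectors. -/
lemma exists_mem_eq_one {g : D →ₐ[ℂ] D'} (hg : Function.Surjective g) {ε : B →ₐ[ℂ] D'}
    (hε : ε.comp i = g) (l : X) : ∃ b ∈ weightSpace B l, ε b = 1 := by
  let J : Ideal B := (RingHom.ker g).map i
  let q : B →ₐ[ℂ] B ⧸ J := Ideal.Quotient.mkₐ ℂ J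
  obtain ⟨θ, hθ⟩ : ∃ θ : D' →ₐ[ℂ] B ⧸ J, θ.comp g = q.comp i := by
    let θ' := Ideal.Quotient.liftₐ (RingHom.ker g) (q.comp i) fun d hd =>
      Ideal.Quotient.eq_zero_iff_mem.2 (Ideal.mem_map_of_mem i hd)
    refine ⟨θ'.comp
      (Ideal.quotientKerAlgEquivOfSurjective hg).symm.toAlgHom, ?_⟩
    ext d
    have : (Ideal.quotientKerAlgEquivOfSurjective hg).symm (g d) =
        Ideal.Quotient.mk (RingHom.ker g) d := by
      rw [AlgEquiv.symm_apply_eq]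
      rfl
    exact congrArg θ' this
  -- On the restriction of the bundle to `Spec D'`, the tautological point is a translate of the
  -- section by `t`. The function `χ^l(t)` has weight `l` and equals `1` along the section; `b` is a
  -- lift of it to `B`.
  obtain ⟨t, ht⟩ := hi.exists_chr (f := θ.comp ε) (g := q) (by rw [AlgHom.comp_assoc, hε, hθ])
  obtain ⟨b, hb⟩ := Ideal.Quotient.mkₐ_surjective ℂ J (chr t l)
  -- The orbit map of the section; along it `t` becomes the universal torus point, so `b` pulls back
  -- to `χ^l`.
  obtain ⟨w, hw⟩ := exists_specMap_eq (univTorus X D' • (univPoint X D' ≫ specMap ε))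
  have hwi : w.comp i = AddMonoidAlgebra.singleZeroAlgHom.comp g := by
    apply specMap_injective
    rw [specMap_comp, hw, hi.smul_comp, Category.assoc, ← specMap_comp, hε, specMap_comp, univPoint]
  obtain ⟨p, hp⟩ : ∃ p : B ⧸ J →ₐ[ℂ] AddMonoidAlgebra D' X, p.comp q = w := by
    have hJ : J ≤ RingHom.ker w := by
      refine Ideal.map_le_iff_le_comap.2 fun d hd => ?_
      have := congrArg (fun k => k d) hwi
      simp only [AlgHom.comp_apply] at this
      change w (i d) = 0
      rw [this, (RingHom.mem_ker).1 hd, map_zero]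
    exact ⟨Ideal.Quotient.liftₐ J w hJ, AlgHom.ext fun _ => rfl⟩
  have hpθ : p.comp θ = AddMonoidAlgebra.singleZeroAlgHom := by
    refine AlgHom.ext fun d' => ?_
    · obtain ⟨d, rfl⟩ := hg d'
      have h1 := congrArg (fun k => p (k d)) hθ
      have h2 := congrArg (fun k => k (i d)) hp
      have h3 := congrArg (fun k => k d) hwi
      exact h1.trans (h2.trans h3)
  have key : specMap p ≫ t = univTorus X D' := by
    refine hi.smul_left_cancel (p := univPoint X D' ≫ specMap ε) ?_
    rw [← hw, ← hp, specMap_comp, ← ht, comp_smul, univPoint, ← hpθ, specMap_comp, specMap_comp,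
      Category.assoc]
  have h1 : w b = AddMonoidAlgebra.single l 1 := by
    rw [← hp, AlgHom.comp_apply, hb, ← chr_comp, key, chr_univTorus]
  have h2 := pullAlg_smul (univTorus X D') (univPoint X D' ≫ specMap ε) b
  have h3 : ∀ b, pullAlg (univPoint X D' ≫ specMap ε) b =
      fnSpec _ (AddMonoidAlgebra.single (0 : X) (ε b)) := by
    intro b
    rw [univPoint, ← specMap_comp, pullAlg_specMap_apply]
    rfl
  simp only [← hw, pullAlg_specMap_apply, h3, chi_univTorus, ← map_mul, ← map_sum, h1,
    AddMonoidAlgebra.single_mul_single, zero_add, mul_one] at h2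
  have h4 := congrArg (fun z : AddMonoidAlgebra D' X => z.coeff l) ((fnSpec _).injective h2)
  classical
  simp only [AddMonoidAlgebra.coeff_sum, AddMonoidAlgebra.coeff_single, Finsupp.coe_finsetSum,
    Finset.sum_apply, Finsupp.single_apply, Finset.sum_ite_eq', if_pos] at h4
  -- The lift `b` need not be a weight vector, but its component of weight `l` has the same value
  -- along the section.
  refine ⟨comp l b, comp_mem l b, ?_⟩
  split_ifs at h4 with hl
  · exact h4.symm
  · have : comp l b = 0 := Finsupp.notMem_support_iff.1 hl
    rw [this, map_zero]
    exact h4.symm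

/-- The weight spaces of `l` and `-l` are inverse invertible modules. Their products generate an
ideal of `D` contained in no maximal ideal, because over each closed point both contain a vector
with value `1` along a section. -/
lemma exists_sum_eq_one (l : X) : ∃ (n : ℕ) (a b : Fin n → B), (∀ k, a k ∈ weightSpace B l) ∧
    (∀ k, b k ∈ weightSpace B (-l)) ∧ ∑ k, a k * b k = 1 := by
  let I : Ideal D := Ideal.span {d | ∃ a ∈ weightSpace B l, ∃ b ∈ weightSpace B (-l), i d = a * b}
  have hI : I = ⊤ := by
    by_contra hne
    obtain ⟨m, hm, hIm⟩ := Ideal.exists_le_maximal I hne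
    obtain ⟨f, hf, ε, hε⟩ := hi.exists_local_section m
    -- As `f` is a unit in the residue field, the local section restricts to a section over the
    -- closed point.
    obtain ⟨g, hg⟩ : ∃ g : Localization.Away f →ₐ[ℂ] D ⧸ m,
        g.comp (IsScalarTower.toAlgHom ℂ D (Localization.Away f)) = Ideal.Quotient.mkₐ ℂ m := by
      let := Ideal.Quotient.field m
      have hu : ∀ y : Submonoid.powers f, IsUnit (Ideal.Quotient.mkₐ ℂ m y) := by
        rintro ⟨_, n, rfl⟩
        rw [map_pow]
        exact (IsUnit.mk0 _ fun h => hf (Ideal.Quotient.eq_zero_iff_mem.1 h)).pow n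
      exact ⟨IsLocalization.liftAlgHom hu, AlgHom.ext fun d => IsLocalization.lift_eq _ _⟩
    have hε' : (g.comp ε).comp i = Ideal.Quotient.mkₐ ℂ m := by rw [AlgHom.comp_assoc, hε, hg]
    obtain ⟨a, ha, ha1⟩ := hi.exists_mem_eq_one (Ideal.Quotient.mkₐ_surjective ℂ m) hε' l
    obtain ⟨b, hb, hb1⟩ := hi.exists_mem_eq_one (Ideal.Quotient.mkₐ_surjective ℂ m) hε' (-l)
    have hab := weightSpace_mul_mem B ha hb
    rw [add_neg_cancel] at hab
    obtain ⟨d, hd⟩ := hi.mem_range_of_mem hab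
    have hdm : d ∈ m := hIm (Ideal.subset_span ⟨a, ha, b, hb, hd⟩)
    have h1 : Ideal.Quotient.mkₐ ℂ m d = 1 := by
      rw [← hε', AlgHom.comp_apply, hd, map_mul, ha1, hb1, one_mul]
    have := Ideal.Quotient.nontrivial_iff.2 hm.ne_top
    exact zero_ne_one ((Ideal.Quotient.eq_zero_iff_mem.2 hdm).symm.trans h1)
  have h1 : (1 : D) ∈ I := hI ▸ Submodule.mem_top
  obtain ⟨n, f, s, hs⟩ := Submodule.mem_span_set'.1 h1
  choose a ha b hb hab using fun k => (s k).2
  refine ⟨n, fun k => i (f k) * a k, b, fun k => hi.smul_mem_weightSpace _ (ha k), hb, ?_⟩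
  have := congrArg i hs
  rw [map_sum, map_one] at this
  rw [← this]
  refine Finset.sum_congr rfl fun k _ => ?_
  rw [smul_eq_mul, map_mul, hab, mul_assoc]

/-- Weight vectors which vanish along a section over a closed subscheme. -/
lemma exists_eq_sum_of_eq_zero {l : X} {n : ℕ} {a a' : Fin n → B}
    (ha' : ∀ k, a' k ∈ weightSpace B (-l)) (h1 : ∑ k, a k * a' k = 1)
    {b : B} (hb : b ∈ weightSpace B l) :
    ∃ d : Fin n → D, b = ∑ k, i (d k) * a k ∧ ∀ k, i (d k) = a' k * b := by
  have h : ∀ k, ∃ d, i d = a' k * b := fun k => hi.mem_range_of_mem (by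
    have := weightSpace_mul_mem B (ha' k) hb
    rwa [neg_add_cancel] at this)
  choose d hd using h
  refine ⟨d, ?_, hd⟩
  calc b = (∑ k, a k * a' k) * b := by rw [h1, one_mul]
    _ = _ := by
      rw [Finset.sum_mul]
      exact Finset.sum_congr rfl fun k _ => by rw [hd]; ring

end IsPrincipalBundle

end AffineBundle

end

section

open scoped LaurentPolynomial

/-! ### Vanishing of the first cohomology on `ℙ¹` by Nakayama's lemma -/

section LaurentModules

variable {R : Type} [CommRing R]

/-- For each maximal `m`, Nakayama's lemma gives an element congruent to `1` modulo `m` that kills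
`Q`. So the annihilator lies in no maximal ideal. -/
lemma fg_eq_bot_of_le_smul {M : Type*} [AddCommGroup M] [Module R M] {Q : Submodule R M}
    (hQ : Q.FG) (h : ∀ m : Ideal R, m.IsMaximal → Q ≤ m • Q) : Q = ⊥ := by
  have hI : Q.annihilator = ⊤ := by
    by_contra hne
    obtain ⟨m, hm, hle⟩ := Ideal.exists_le_maximal _ hne
    obtain ⟨r, hr, hr0⟩ :=
      Submodule.exists_sub_one_mem_and_smul_eq_zero_of_fg_of_le_smul m Q hQ (h m hm)
    have h1 : r ∈ m := hle (Submodule.mem_annihilator.2 hr0)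
    refine hm.ne_top ((Ideal.eq_top_iff_one _).2 ?_)
    have := m.sub_mem h1 hr
    rwa [sub_sub_cancel] at this
  exact Submodule.annihilator_eq_top_iff.1 hI

variable {M : Type*} [AddCommGroup M] [Module R M]

lemma aeval_smul_mem {S : Type*} [CommRing S] [Algebra R S] [Module S M] [IsScalarTower R S M]
    {N : Submodule R M} {s : S} (h : ∀ x ∈ N, s • x ∈ N) (p : Polynomial R) {x : M} (hx : x ∈ N) :
    Polynomial.aeval s p • x ∈ N := by
  have hpow : ∀ n : ℕ, s ^ n • x ∈ N := by
    intro n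
    induction n with
    | zero => simpa
    | succ n ih =>
      rw [pow_succ', mul_smul]
      exact h _ ih
  rw [Polynomial.aeval_eq_sum_range, Finset.sum_smul]
  exact N.sum_mem fun n _ => by
    rw [smul_assoc]
    exact N.smul_mem _ (hpow n)

lemma smul_mem_ideal_smul {S : Type*} [CommRing S] [Algebra R S] [Module S M] [IsScalarTower R S M]
    {m : Ideal R} (s : S) {x : M} (hx : x ∈ m • (⊤ : Submodule R M)) :
    s • x ∈ m • (⊤ : Submodule R M) := by
  refine Submodule.smul_induction_on hx (fun r hr y _ => ?_) fun y z hy hz => ?_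
  · rw [smul_algebra_smul_comm]
    exact Submodule.smul_mem_smul hr trivial
  · rw [smul_add]
    exact add_mem hy hz

variable [Algebra ℂ R]

/-- The vanishing of `H¹(ℙ¹, O(-1))`: every power of `t` is either positive or nonpositive. -/
lemma exists_laurent_split (p : R[T;T⁻¹]) : ∃ q q' : Polynomial R,
    p = LaurentPolynomial.T 1 * laurent R q + laurentInv R q' := by
  induction p using LaurentPolynomial.induction_on' with
  | add p p' hp hp' =>
    obtain ⟨q, q', rfl⟩ := hp
    obtain ⟨r, r', rfl⟩ := hp'
    exact ⟨q + r, q' + r', by rw [map_add, map_add]; ring⟩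
  | C_mul_T n r =>
    rcases lt_or_ge 0 n with hn | hn
    · refine ⟨Polynomial.C r * Polynomial.X ^ (n - 1).toNat, 0, ?_⟩
      rw [map_zero, add_zero, map_mul, map_pow, laurent_C, laurent_X, LaurentPolynomial.T_pow,
        mul_left_comm, ← LaurentPolynomial.T_add]
      congr 2
      omega
    · refine ⟨0, Polynomial.C r * Polynomial.X ^ (-n).toNat, ?_⟩
      rw [map_zero, mul_zero, zero_add, map_mul, map_pow, laurentInv_C, laurentInv_X,
        LaurentPolynomial.T_pow]
      congr 2
      omega

variable [Module R[T;T⁻¹] M] [IsScalarTower R R[T;T⁻¹] M]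

omit [Algebra ℂ R] in
lemma laurentC_smul (r : R) (x : M) : (LaurentPolynomial.C r : R[T;T⁻¹]) • x = r • x :=
  algebraMap_smul R[T;T⁻¹] r x

omit [Algebra ℂ R] in
lemma laurent_induction_mem {N : Submodule R M} {x : M}
    (h : ∀ k : ℤ, (LaurentPolynomial.T k : R[T;T⁻¹]) • x ∈ N) (p : R[T;T⁻¹]) : p • x ∈ N := by
  induction p using LaurentPolynomial.induction_on' with
  | add p p' hp hp' =>
    rw [add_smul]
    exact N.add_mem hp hp'
  | C_mul_T n r =>
    rw [mul_smul, laurentC_smul]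
    exact N.smul_mem _ (h n)

omit [Module R M] [Algebra ℂ R] [IsScalarTower R R[T;T⁻¹] M] in
lemma T_smul_T_smul (m n : ℤ) (x : M) : (LaurentPolynomial.T m : R[T;T⁻¹]) •
    (LaurentPolynomial.T n : R[T;T⁻¹]) • x = (LaurentPolynomial.T (m + n) : R[T;T⁻¹]) • x := by
  rw [smul_smul, LaurentPolynomial.T_add]

/-- The first cohomology of a sheaf on the projective line vanishes if the restriction to each
closed fibre is a line bundle of degree `-1`, given by gluing two trivial ones. -/
lemma exists_eq_add_of_local {M₀ M₁ : Submodule R M}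
    (h₀ : ∀ x ∈ M₀, (LaurentPolynomial.T 1 : R[T;T⁻¹]) • x ∈ M₀)
    (h₁ : ∀ x ∈ M₁, (LaurentPolynomial.T (-1) : R[T;T⁻¹]) • x ∈ M₁)
    {n : ℕ} {a : Fin n → M} (ha : ∀ k, a k ∈ M₀)
    (hs₀ : Submodule.span R[T;T⁻¹] (Set.range a) = ⊤)
    (hs₁ : Submodule.span R[T;T⁻¹] (M₁ : Set M) = ⊤)
    (hloc : ∀ m : Ideal R, m.IsMaximal → ∃ u ∈ M₀, ∃ v ∈ M₁, u - v ∈ m • (⊤ : Submodule R M) ∧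
      ∀ x, ∃ p : R[T;T⁻¹], x - p • u ∈ m • (⊤ : Submodule R M)) (x : M) :
    ∃ y ∈ M₀, ∃ z ∈ M₁, x = (LaurentPolynomial.T 1 : R[T;T⁻¹]) • y + z := by
  let τ : M →ₗ[R] M := (LinearMap.lsmul R[T;T⁻¹] M (LaurentPolynomial.T 1)).restrictScalars R
  -- `N` consists of the Čech coboundaries, and `M ⧸ N` is the `H¹` to be killed.
  let N : Submodule R M := M₀.map τ ⊔ M₁
  have hpow : ∀ x ∈ M₁, ∀ k : ℕ, (LaurentPolynomial.T (-k) : R[T;T⁻¹]) • x ∈ M₁ := by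
    intro x hx k
    induction k with
    | zero => simpa
    | succ k ih =>
      have := h₁ _ ih
      rw [T_smul_T_smul] at this
      convert this using 3
      push_cast
      ring
  have hbound : ∀ x : M, ∃ b : ℕ, ∀ k : ℤ, k ≤ -b →
      (LaurentPolynomial.T k : R[T;T⁻¹]) • x ∈ M₁ := by
    intro x
    have hx : x ∈ Submodule.span R[T;T⁻¹] (M₁ : Set M) := hs₁ ▸ Submodule.mem_top
    induction hx using Submodule.span_induction with
    | mem x hx =>
      refine ⟨0, fun k hk => ?_⟩
      obtain ⟨j, rfl⟩ : ∃ j : ℕ, k = -j := ⟨(-k).toNat, by omega⟩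
      exact hpow x hx j
    | zero => exact ⟨0, fun k _ => by rw [smul_zero]; exact M₁.zero_mem⟩
    | add x y _ _ hx hy =>
      obtain ⟨b, hb⟩ := hx
      obtain ⟨b', hb'⟩ := hy
      refine ⟨b + b', fun k hk => ?_⟩
      rw [smul_add]
      exact M₁.add_mem (hb k (by push_cast at hk; omega)) (hb' k (by push_cast at hk; omega))
    | smul p x _ hx =>
      obtain ⟨b, hb⟩ := hx
      induction p using LaurentPolynomial.induction_on' with
      | add p p' hp hp' =>
        obtain ⟨c, hc⟩ := hp
        obtain ⟨c', hc'⟩ := hp'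
        refine ⟨c + c', fun k hk => ?_⟩
        rw [add_smul, smul_add]
        exact M₁.add_mem (hc k (by push_cast at hk; omega)) (hc' k (by push_cast at hk; omega))
      | C_mul_T j r =>
        refine ⟨b + j.toNat, fun k hk => ?_⟩
        rw [mul_smul, laurentC_smul, smul_comm,
          T_smul_T_smul]
        exact M₁.smul_mem _ (hb _ (by push_cast at hk; omega))
  choose b hb using fun k => hbound (a k)
  -- Only finitely many multiples `t^j a_k` are left modulo `N`: positive powers come from the first
  -- chart and very negative ones from the second. This makes `M ⧸ N` finitely generated over `R`.
  have hN : ∀ k (j : ℤ), 0 < j ∨ j ≤ -b k → (LaurentPolynomial.T j : R[T;T⁻¹]) • a k ∈ N := by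
    rintro k j (hj | hj)
    · refine Submodule.mem_sup_left ⟨(LaurentPolynomial.T (j - 1) : R[T;T⁻¹]) • a k, ?_, ?_⟩
      · have := aeval_smul_mem h₀ (Polynomial.X ^ (j - 1).toNat) (ha k)
        rw [map_pow, Polynomial.aeval_X, LaurentPolynomial.T_pow] at this
        rwa [mul_one, Int.toNat_of_nonneg (by omega)] at this
      · change (LaurentPolynomial.T 1 : R[T;T⁻¹]) • ((LaurentPolynomial.T (j - 1) : R[T;T⁻¹]) • a k) =
          (LaurentPolynomial.T j : R[T;T⁻¹]) • a k
        rw [T_smul_T_smul, add_sub_cancel]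
    · exact Submodule.mem_sup_right (hb k j hj)
  let s : Set (M ⧸ N) := ⋃ k, (fun j : ℤ => N.mkQ ((LaurentPolynomial.T j : R[T;T⁻¹]) • a k)) ''
    Set.Icc (-b k : ℤ) 0
  have hs : s.Finite := Set.finite_iUnion fun k => (Set.finite_Icc _ _).image _
  have hfg : (⊤ : Submodule R (M ⧸ N)).FG := by
    have htop : (⊤ : Submodule R (M ⧸ N)) = Submodule.span R s := by
      refine (eq_top_iff.2 ?_).symm
      rintro y -
      obtain ⟨x, rfl⟩ := N.mkQ_surjective y
      change x ∈ (Submodule.span R s).comap N.mkQ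
      have hx : x ∈ Submodule.span R[T;T⁻¹] (Set.range a) := hs₀ ▸ Submodule.mem_top
      obtain ⟨p, rfl⟩ := (Submodule.mem_span_range_iff_exists_fun _).1 hx
      refine Submodule.sum_mem _ fun k _ => laurent_induction_mem (fun j => ?_) (p k)
      by_cases hj : 0 < j ∨ j ≤ -b k
      · rw [Submodule.mem_comap, N.mkQ_apply, (Submodule.Quotient.mk_eq_zero N).2 (hN k j hj)]
        exact zero_mem _
      · exact Submodule.subset_span (Set.mem_iUnion.2 ⟨k, j, ⟨by omega, by omega⟩, rfl⟩)
    rw [htop]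
    exact Submodule.fg_span hs
  have hsub : (⊤ : Submodule R (M ⧸ N)) = ⊥ := by
    refine fg_eq_bot_of_le_smul hfg fun m hm => ?_
    obtain ⟨u, hu, v, hv, huv, hx⟩ := hloc m hm
    rintro y -
    obtain ⟨x, rfl⟩ := N.mkQ_surjective y
    obtain ⟨p, hp⟩ := hx x
    obtain ⟨q, q', rfl⟩ := exists_laurent_split p
    -- Modulo `m`, `x` is `p u`. The positive part of `p` is applied to `u` and the rest to `v`,
    -- which is congruent to `u`; the result lies in `N`.
    have h1 : x - (τ (laurent R q • u) + laurentInv R q' • v) ∈ m • (⊤ : Submodule R M) := by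
      have := add_mem hp (smul_mem_ideal_smul (laurentInv R q') huv)
      convert this using 1
      change x - ((LaurentPolynomial.T 1 : R[T;T⁻¹]) • (laurent R q • u) + _) = _
      rw [add_smul, mul_smul, smul_sub]
      abel
    have h2 : τ (laurent R q • u) + laurentInv R q' • v ∈ N :=
      Submodule.add_mem_sup (Submodule.mem_map_of_mem (aeval_smul_mem h₀ q hu))
        (aeval_smul_mem h₁ q' hv)
    have h3 := Submodule.mem_map_of_mem (f := N.mkQ) h1
    rw [map_sub, (N.mkQ_apply _).trans ((Submodule.Quotient.mk_eq_zero N).2 h2), sub_zero,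
      Submodule.map_smul'', Submodule.map_top, Submodule.range_mkQ] at h3
    exact h3
  have hx : x ∈ N := by
    rw [← Submodule.Quotient.mk_eq_zero]
    exact (Submodule.mem_bot R).1 (hsub ▸ Submodule.mem_top)
  obtain ⟨_, ⟨y, hy, rfl⟩, z, hz, h⟩ := Submodule.mem_sup.1 hx
  exact ⟨y, hy, z, hz, h.symm⟩

end LaurentModules

end

section

open Limits
open scoped MonObj LaurentPolynomial

/-! ### Base change of Laurent polynomials -/

section LaurentMap

variable {R R' : Type} [CommRing R] [Algebra ℂ R] [CommRing R'] [Algebra ℂ R']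

/-- The homomorphism `R[t, t⁻¹] → R'[t, t⁻¹]` given by a homomorphism `R → R'`. -/
def laurentMap (φ : R →ₐ[ℂ] R') : R[T;T⁻¹] →ₐ[ℂ] R'[T;T⁻¹] := AddMonoidAlgebra.mapAlgHom ℤ φ

lemma laurentMap_coeff (φ : R →ₐ[ℂ] R') (p : R[T;T⁻¹]) (n : ℤ) :
    (laurentMap φ p).coeff n = φ (p.coeff n) := by
  simp [laurentMap]

lemma laurentMap_C (φ : R →ₐ[ℂ] R') (r : R) :
    laurentMap φ (LaurentPolynomial.C r) = LaurentPolynomial.C (φ r) := by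
  rw [← LaurentPolynomial.single_eq_C, ← LaurentPolynomial.single_eq_C]
  exact AddMonoidAlgebra.mapAlgHom_single _ _ _

lemma laurentMap_T (φ : R →ₐ[ℂ] R') (n : ℤ) :
    laurentMap φ (LaurentPolynomial.T n) = LaurentPolynomial.T n := by
  rw [LaurentPolynomial.T, LaurentPolynomial.T]
  exact (AddMonoidAlgebra.mapAlgHom_single _ _ _).trans (by rw [map_one])

lemma laurentMap_comp_laurent (φ : R →ₐ[ℂ] R') :
    (laurentMap φ).comp (laurent R) = (laurent R').comp (polyMap φ) :=
  polynomial_algHom_ext (AlgHom.ext fun r => by simp [laurent_C, laurentMap_C])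
    (by simp [laurent_X, laurentMap_T])

lemma laurentMap_comp_laurentInv (φ : R →ₐ[ℂ] R') :
    (laurentMap φ).comp (laurentInv R) = (laurentInv R').comp (polyMap φ) :=
  polynomial_algHom_ext (AlgHom.ext fun r => by simp [laurentInv_C, laurentMap_C])
    (by simp [laurentInv_X, laurentMap_T])

lemma polyMap_surjective {φ : R →ₐ[ℂ] R'} (h : Function.Surjective φ) :
    Function.Surjective (polyMap φ) := Polynomial.map_surjective φ.toRingHom h

lemma laurentMap_surjective {φ : R →ₐ[ℂ] R'} (h : Function.Surjective φ) :
    Function.Surjective (laurentMap φ) := by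
  intro p
  induction p using LaurentPolynomial.induction_on' with
  | add p q hp hq =>
    obtain ⟨p, rfl⟩ := hp
    obtain ⟨q, rfl⟩ := hq
    exact ⟨p + q, map_add _ _ _⟩
  | C_mul_T n a =>
    obtain ⟨a, rfl⟩ := h a
    exact ⟨LaurentPolynomial.C a * LaurentPolynomial.T n, by rw [map_mul, laurentMap_C, laurentMap_T]⟩

omit [Algebra ℂ R] in
lemma laurent_smul_mem {M : Type*} [AddCommGroup M] [Module R M] [Module R[T;T⁻¹] M]
    [IsScalarTower R R[T;T⁻¹] M] {m : Ideal R} {p : R[T;T⁻¹]} (hp : ∀ n, p.coeff n ∈ m) (x : M) :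
    p • x ∈ m • (⊤ : Submodule R M) := by
  rw [← p.sum_coeff_single, Finsupp.sum, Finset.sum_smul]
  refine Submodule.sum_mem _ fun n _ => ?_
  rw [LaurentPolynomial.single_eq_C_mul_T, mul_smul, laurentC_smul]
  exact Submodule.smul_mem_smul (hp n) trivial

lemma chr_coweightPoint {X : Type} [AddCommGroup X] (σ : X →+ ℤ) (l : X) :
    chr (coweightPoint σ (tUnit R)) l = LaurentPolynomial.T (σ l) := by
  rw [chr, coweightPoint, algOf_specMap, ← tUnit_zpow]
  simp

end LaurentMap

/-- The algebras which describe the restrictions of a principal bundle on `ℙ¹ × Spec R` to the two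
charts and to their intersection. -/
structure IsChartSystem (X : Type) [AddCommGroup X] {R B₀ B₁ B : Type} [CommRing R] [Algebra ℂ R]
    [CommRing B₀] [Algebra ℂ B₀] [CommRing B₁] [Algebra ℂ B₁] [CommRing B] [Algebra ℂ B]
    {P : Over SpecC} [ModObj (Torus X) P] [ModObj (Torus X) (specOver B₀)]
    [ModObj (Torus X) (specOver B₁)] [ModObj (Torus X) (specOver B)] (π : P ⟶ P1 ⊗ specOver R)
    (i₀ : Polynomial R →ₐ[ℂ] B₀) (i₁ : Polynomial R →ₐ[ℂ] B₁) (i : R[T;T⁻¹] →ₐ[ℂ] B)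
    (p₀ : specOver B₀ ⟶ P) (p₁ : specOver B₁ ⟶ P) (p : specOver B ⟶ P)
    (k₀ : B₀ →ₐ[ℂ] B) (k₁ : B₁ →ₐ[ℂ] B) : Prop where
  isPullback₀ : IsPullback p₀ (specMap i₀) π (chart₀ R)
  isPullback₁ : IsPullback p₁ (specMap i₁) π (chart₁ R)
  isPullback : IsPullback p (specMap i) π (specMap (laurent R) ≫ chart₀ R)
  isModHom₀ : IsModHom (Torus X) p₀
  isModHom₁ : IsModHom (Torus X) p₁
  isModHom : IsModHom (Torus X) p
  principal₀ : IsPrincipalBundle X (specMap i₀)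
  principal₁ : IsPrincipalBundle X (specMap i₁)
  principal : IsPrincipalBundle X (specMap i)
  comp₀ : specMap k₀ ≫ p₀ = p
  comp₁ : specMap k₁ ≫ p₁ = p
  comp_eq₀ : k₀.comp i₀ = i.comp (laurent R)
  comp_eq₁ : k₁.comp i₁ = i.comp (laurentInv R)

/-! ### Restricting a bundle to the charts and to fibres -/

section ChartSystem

variable {X : Type} [AddCommGroup X] {R : Type} [CommRing R] [Algebra ℂ R]

lemma IsPrincipalBundle.exists_chartSystem {P : Over SpecC} [ModObj (Torus X) P]
    {π : P ⟶ P1 ⊗ specOver R} (hπ : IsPrincipalBundle X π) :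
    ∃ (B₀ B₁ B : Type) (_ : CommRing B₀) (_ : Algebra ℂ B₀) (_ : CommRing B₁) (_ : Algebra ℂ B₁)
      (_ : CommRing B) (_ : Algebra ℂ B) (_ : ModObj (Torus X) (specOver B₀))
      (_ : ModObj (Torus X) (specOver B₁)) (_ : ModObj (Torus X) (specOver B))
      (i₀ : Polynomial R →ₐ[ℂ] B₀) (i₁ : Polynomial R →ₐ[ℂ] B₁) (i : R[T;T⁻¹] →ₐ[ℂ] B)
      (p₀ : specOver B₀ ⟶ P) (p₁ : specOver B₁ ⟶ P) (p : specOver B ⟶ P)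
      (k₀ : B₀ →ₐ[ℂ] B) (k₁ : B₁ →ₐ[ℂ] B), IsChartSystem X π i₀ i₁ i p₀ p₁ p k₀ k₁ := by
  obtain ⟨B₀, _, _, _, i₀, p₀, H₀, m₀, h₀⟩ := hπ.exists_algebra (chart₀ R)
  obtain ⟨B₁, _, _, _, i₁, p₁, H₁, m₁, h₁⟩ := hπ.exists_algebra (chart₁ R)
  obtain ⟨B, _, _, _, i, p, H, m, h⟩ := hπ.exists_algebra (specMap (laurent R) ≫ chart₀ R)
  obtain ⟨k₀, hk₀⟩ := exists_specMap_eq (H₀.lift p (specMap i ≫ specMap (laurent R))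
    (by rw [H.w, Category.assoc]))
  obtain ⟨k₁, hk₁⟩ := exists_specMap_eq (H₁.lift p (specMap i ≫ specMap (laurentInv R))
    (by rw [H.w, Category.assoc, laurent_comp_chart]))
  refine ⟨B₀, B₁, B, inferInstance, inferInstance, inferInstance, inferInstance, inferInstance,
    inferInstance, inferInstance, inferInstance, inferInstance, i₀, i₁, i, p₀, p₁, p, k₀, k₁,
    H₀, H₁, H, m₀, m₁, m, h₀, h₁, h, ?_, ?_, ?_, ?_⟩
  · rw [hk₀, H₀.lift_fst]
  · rw [hk₁, H₁.lift_fst]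
  · apply specMap_injective
    rw [specMap_comp, specMap_comp, hk₀, H₀.lift_snd]
  · apply specMap_injective
    rw [specMap_comp, specMap_comp, hk₁, H₁.lift_snd]

namespace IsChartSystem

variable {B₀ B₁ B : Type} [CommRing B₀] [Algebra ℂ B₀] [CommRing B₁] [Algebra ℂ B₁] [CommRing B]
  [Algebra ℂ B] {P : Over SpecC} [ModObj (Torus X) P] [ModObj (Torus X) (specOver B₀)]
  [ModObj (Torus X) (specOver B₁)] [ModObj (Torus X) (specOver B)] {π : P ⟶ P1 ⊗ specOver R}
  {i₀ : Polynomial R →ₐ[ℂ] B₀} {i₁ : Polynomial R →ₐ[ℂ] B₁} {i : R[T;T⁻¹] →ₐ[ℂ] B}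
  {p₀ : specOver B₀ ⟶ P} {p₁ : specOver B₁ ⟶ P} {p : specOver B ⟶ P}
  {k₀ : B₀ →ₐ[ℂ] B} {k₁ : B₁ →ₐ[ℂ] B} (h : IsChartSystem X π i₀ i₁ i p₀ p₁ p k₀ k₁)

include h

lemma map₀_mem {l : X} {b : B₀} (hb : b ∈ weightSpace B₀ l) :
    k₀ b ∈ weightSpace B l := by
  refine map_mem_weightSpace ((isModHom_iff _).2 fun Z t y => h.isPullback₀.hom_ext ?_ ?_) hb
  · rw [(isModHom_iff _).1 h.isModHom₀, Category.assoc, Category.assoc, h.comp₀,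
      (isModHom_iff _).1 h.isModHom]
  · rw [h.principal₀.smul_comp, Category.assoc, Category.assoc, ← specMap_comp, h.comp_eq₀,
      specMap_comp, ← Category.assoc, h.principal.smul_comp, Category.assoc]

lemma map₁_mem {l : X} {b : B₁} (hb : b ∈ weightSpace B₁ l) :
    k₁ b ∈ weightSpace B l := by
  refine map_mem_weightSpace ((isModHom_iff _).2 fun Z t y => h.isPullback₁.hom_ext ?_ ?_) hb
  · rw [(isModHom_iff _).1 h.isModHom₁, Category.assoc, Category.assoc, h.comp₁,
      (isModHom_iff _).1 h.isModHom]
  · rw [h.principal₁.smul_comp, Category.assoc, Category.assoc, ← specMap_comp, h.comp_eq₁,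
      specMap_comp, ← Category.assoc, h.principal.smul_comp, Category.assoc]

lemma map_chart₀ (f : Polynomial R) : k₀ (i₀ f) = i (laurent R f) :=
  congrArg (fun k => k f) h.comp_eq₀

lemma map_chart₁ (f : Polynomial R) : k₁ (i₁ f) = i (laurentInv R f) :=
  congrArg (fun k => k f) h.comp_eq₁

/-- The restrictions of a bundle of given degree to a fibre. -/
lemma exists_fibre {σ : X →+ ℤ} (hσ : HasDegree σ π) {K : Type} [Field K] [Algebra ℂ K]
    (x : R →ₐ[ℂ] K) : ∃ (f₀ : B₀ →ₐ[ℂ] Polynomial K) (f₁ : B₁ →ₐ[ℂ] Polynomial K)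
      (g₀ g₁ : B →ₐ[ℂ] K[T;T⁻¹]), f₀.comp i₀ = polyMap x ∧ f₁.comp i₁ = polyMap x ∧
      g₀.comp i = laurentMap x ∧ g₁.comp i = laurentMap x ∧ g₀.comp k₀ = (laurent K).comp f₀ ∧
      g₁.comp k₁ = (laurentInv K).comp f₁ ∧
      ∀ (l : X), ∀ b ∈ weightSpace B l, g₀ b = LaurentPolynomial.T (σ l) * g₁ b := by
  obtain ⟨e, e', he, he', hg⟩ := hσ K x
  rw [fibreChart_eq₀] at he
  rw [fibreChart_eq₁] at he'
  change specMap (laurent K) ≫ e = coweightPoint σ (tUnit K) • (specMap (laurentInv K) ≫ e') at hg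
  have hw₀ : (specMap (laurent K) ≫ e) ≫ π =
      specMap (laurentMap x) ≫ specMap (laurent R) ≫ chart₀ R := by
    rw [Category.assoc, he, ← Category.assoc, ← Category.assoc, ← specMap_comp, ← specMap_comp,
      laurentMap_comp_laurent]
  have hw₁ : (specMap (laurentInv K) ≫ e') ≫ π =
      specMap (laurentMap x) ≫ specMap (laurent R) ≫ chart₀ R := by
    rw [laurent_comp_chart, Category.assoc, he', ← Category.assoc, ← Category.assoc, ← specMap_comp,
      ← specMap_comp, laurentMap_comp_laurentInv]
  obtain ⟨f₀, hf₀⟩ := exists_specMap_eq (h.isPullback₀.lift e _ he)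
  obtain ⟨f₁, hf₁⟩ := exists_specMap_eq (h.isPullback₁.lift e' _ he')
  obtain ⟨g₀, hg₀⟩ := exists_specMap_eq (h.isPullback.lift _ _ hw₀)
  obtain ⟨g₁, hg₁⟩ := exists_specMap_eq (h.isPullback.lift _ _ hw₁)
  have e1 : f₀.comp i₀ = polyMap x := specMap_injective (by
    rw [specMap_comp, hf₀, h.isPullback₀.lift_snd])
  have e2 : f₁.comp i₁ = polyMap x := specMap_injective (by
    rw [specMap_comp, hf₁, h.isPullback₁.lift_snd])
  have e3 : g₀.comp i = laurentMap x := specMap_injective (by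
    rw [specMap_comp, hg₀, h.isPullback.lift_snd])
  have e4 : g₁.comp i = laurentMap x := specMap_injective (by
    rw [specMap_comp, hg₁, h.isPullback.lift_snd])
  refine ⟨f₀, f₁, g₀, g₁, e1, e2, e3, e4, ?_, ?_, fun l b hb => ?_⟩
  · refine specMap_injective (h.isPullback₀.hom_ext ?_ ?_)
    · rw [specMap_comp, specMap_comp, Category.assoc, h.comp₀, hg₀, h.isPullback.lift_fst,
        Category.assoc, hf₀, h.isPullback₀.lift_fst]
    · rw [← specMap_comp, ← specMap_comp, AlgHom.comp_assoc, AlgHom.comp_assoc, h.comp_eq₀,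
        ← AlgHom.comp_assoc, e1, e3, laurentMap_comp_laurent]
  · refine specMap_injective (h.isPullback₁.hom_ext ?_ ?_)
    · rw [specMap_comp, specMap_comp, Category.assoc, h.comp₁, hg₁, h.isPullback.lift_fst,
        Category.assoc, hf₁, h.isPullback₁.lift_fst]
    · rw [← specMap_comp, ← specMap_comp, AlgHom.comp_assoc, AlgHom.comp_assoc, h.comp_eq₁,
        ← AlgHom.comp_assoc, e2, e4, laurentMap_comp_laurentInv]
  · rw [← chr_coweightPoint]
    refine eq_chr_mul (h.isPullback.hom_ext ?_ ?_) hb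
    · rw [(isModHom_iff _).1 h.isModHom, hg₀, hg₁, h.isPullback.lift_fst, h.isPullback.lift_fst, hg]
    · rw [h.principal.smul_comp, hg₀, hg₁, h.isPullback.lift_snd, h.isPullback.lift_snd]

end IsChartSystem

end ChartSystem

end

section

open Limits
open scoped MonObj LaurentPolynomial

/-! ### Vanishing of the obstruction for bundles of degree `σ` -/

section Cohomology

variable {X : Type} [AddCommGroup X] {R : Type} [CommRing R] [Algebra ℂ R]

namespace IsChartSystem

variable {B₀ B₁ B : Type} [CommRing B₀] [Algebra ℂ B₀] [CommRing B₁] [Algebra ℂ B₁] [CommRing B]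
  [Algebra ℂ B] {P : Over SpecC} [ModObj (Torus X) P] [ModObj (Torus X) (specOver B₀)]
  [ModObj (Torus X) (specOver B₁)] [ModObj (Torus X) (specOver B)] {π : P ⟶ P1 ⊗ specOver R}
  {i₀ : Polynomial R →ₐ[ℂ] B₀} {i₁ : Polynomial R →ₐ[ℂ] B₁} {i : R[T;T⁻¹] →ₐ[ℂ] B}
  {p₀ : specOver B₀ ⟶ P} {p₁ : specOver B₁ ⟶ P} {p : specOver B ⟶ P}
  {k₀ : B₀ →ₐ[ℂ] B} {k₁ : B₁ →ₐ[ℂ] B} (h : IsChartSystem X π i₀ i₁ i p₀ p₁ p k₀ k₁)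

include h

/-- The functions of weight `l` form a sheaf of degree `σ l` on the fibres. The factor `t^(-σ l)` on
the second chart makes it trivial on each closed fibre, and the factor `t` on the first lowers the
degree to `-1`, so `exists_eq_add_of_local` applies. -/
lemma exists_eq_add {σ : X →+ ℤ} (hσ : HasDegree σ π) {l : X} {b : B} (hb : b ∈ weightSpace B l) :
    ∃ y ∈ weightSpace B₀ l, ∃ z ∈ weightSpace B₁ l,
      b = i (LaurentPolynomial.T 1) * k₀ y + i (LaurentPolynomial.T (-σ l)) * k₁ z := by
  let : Algebra R[T;T⁻¹] B := i.toRingHom.toAlgebra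
  let : Algebra R B := (i.toRingHom.comp (algebraMap R R[T;T⁻¹])).toAlgebra
  have : IsScalarTower R R[T;T⁻¹] B := IsScalarTower.of_algebraMap_eq fun _ => rfl
  have hsmul : ∀ (q : R[T;T⁻¹]) (b : B), q • b = i q * b := fun _ _ => rfl
  have hCsmul : ∀ (r : R) (b : B), r • b = i (LaurentPolynomial.C r) * b := fun _ _ => rfl
  let W : Submodule R[T;T⁻¹] B :=
    { carrier := weightSpace B l
      add_mem' := fun ha hb => (weightSpace B l).add_mem ha hb
      zero_mem' := (weightSpace B l).zero_mem
      smul_mem' := fun q _ hx => h.principal.smul_mem_weightSpace q hx }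
  let M₀ : Submodule R W :=
    { carrier := {x | ∃ y ∈ weightSpace B₀ l, k₀ y = x}
      add_mem' := by
        rintro _ _ ⟨y, hy, hx⟩ ⟨y', hy', hx'⟩
        exact ⟨y + y', add_mem hy hy', by rw [map_add, hx, hx']; rfl⟩
      zero_mem' := ⟨0, zero_mem _, map_zero _⟩
      smul_mem' := by
        rintro r _ ⟨y, hy, hx⟩
        refine ⟨i₀ (Polynomial.C r) * y, h.principal₀.smul_mem_weightSpace _ hy, ?_⟩
        rw [map_mul, h.map_chart₀, hx, laurent_C]
        rfl }
  let M₁ : Submodule R W :=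
    { carrier := {x | ∃ z ∈ weightSpace B₁ l, i (LaurentPolynomial.T (-σ l)) * k₁ z = x}
      add_mem' := by
        rintro _ _ ⟨y, hy, hx⟩ ⟨y', hy', hx'⟩
        exact ⟨y + y', add_mem hy hy', by rw [map_add, mul_add, hx, hx']; rfl⟩
      zero_mem' := ⟨0, zero_mem _, by rw [map_zero, mul_zero]; rfl⟩
      smul_mem' := by
        rintro r _ ⟨y, hy, hx⟩
        refine ⟨i₁ (Polynomial.C r) * y, h.principal₁.smul_mem_weightSpace _ hy, ?_⟩
        rw [map_mul, h.map_chart₁, mul_left_comm, hx, laurentInv_C]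
        rfl }
  -- Invertibility of the weight spaces on both charts provides generators over the overlap; the `a'
  -- k` also serve as coordinate functionals in `hdec`.
  obtain ⟨n, a, a', ha, ha', haa⟩ := h.principal₀.exists_sum_eq_one l
  obtain ⟨n', c, c', hc, hc', hcc⟩ := h.principal₁.exists_sum_eq_one l
  have hka : ∀ k, k₀ (a k) ∈ weightSpace B l := fun k => h.map₀_mem (ha k)
  have hkaa : ∑ k, k₀ (a k) * k₀ (a' k) = 1 := by
    rw [← map_one k₀, ← haa, map_sum]
    exact Finset.sum_congr rfl fun k _ => (map_mul _ _ _).symm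
  have hkcc : ∑ k, k₁ (c k) * k₁ (c' k) = 1 := by
    rw [← map_one k₁, ← hcc, map_sum]
    exact Finset.sum_congr rfl fun k _ => (map_mul _ _ _).symm
  let α : Fin n → W := fun k => ⟨k₀ (a k), hka k⟩
  have hdec : ∀ w : W, ∃ d : Fin n → R[T;T⁻¹], w = ∑ k, d k • α k ∧
      ∀ k, i (d k) = k₀ (a' k) * w := by
    intro w
    obtain ⟨d, hd, hd'⟩ := h.principal.exists_eq_sum_of_eq_zero
      (fun k => h.map₀_mem (ha' k)) hkaa w.2
    refine ⟨d, Subtype.ext ?_, hd'⟩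
    rw [AddSubmonoidClass.coe_finsetSum]
    exact hd
  have hTT : ∀ d : ℤ, i (LaurentPolynomial.T d) * i (LaurentPolynomial.T (-d)) = 1 := fun d => by
    rw [← map_mul, ← LaurentPolynomial.T_add, add_neg_cancel, LaurentPolynomial.T_zero, map_one]
  suffices key : ∀ w : W, ∃ y ∈ M₀, ∃ z ∈ M₁, w = (LaurentPolynomial.T 1 : R[T;T⁻¹]) • y + z by
    obtain ⟨y, ⟨y', hy, hy'⟩, z, ⟨z', hz, hz'⟩, he⟩ := key ⟨b, hb⟩
    refine ⟨y', hy, z', hz, ?_⟩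
    rw [hy', hz']
    exact congrArg Subtype.val he
  refine exists_eq_add_of_local (a := α) ?_ ?_ ?_ ?_ ?_ ?_
  · rintro x ⟨y, hy, hx⟩
    refine ⟨i₀ Polynomial.X * y, h.principal₀.smul_mem_weightSpace _ hy, ?_⟩
    rw [map_mul, h.map_chart₀, hx, laurent_X]
    rfl
  · rintro x ⟨y, hy, hx⟩
    refine ⟨i₁ Polynomial.X * y, h.principal₁.smul_mem_weightSpace _ hy, ?_⟩
    rw [map_mul, h.map_chart₁, mul_left_comm, hx, laurentInv_X]
    rfl
  · exact fun k => ⟨a k, ha k, rfl⟩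
  · rw [eq_top_iff]
    rintro w -
    obtain ⟨d, hd, -⟩ := hdec w
    exact (Submodule.mem_span_range_iff_exists_fun _).2 ⟨d, hd.symm⟩
  · rw [eq_top_iff]
    rintro w -
    obtain ⟨d, hd, -⟩ := h.principal.exists_eq_sum_of_eq_zero
      (fun k => h.map₁_mem (hc' k)) hkcc w.2
    have hv : ∀ k, i (LaurentPolynomial.T (-σ l)) * k₁ (c k) ∈ weightSpace B l := fun k =>
      h.principal.smul_mem_weightSpace _ (h.map₁_mem (hc k))
    let v : Fin n' → W := fun k => ⟨i (LaurentPolynomial.T (-σ l)) * k₁ (c k), hv k⟩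
    have hw : w = ∑ k, (d k * LaurentPolynomial.T (σ l)) • v k := by
      refine Subtype.ext ?_
      rw [AddSubmonoidClass.coe_finsetSum, hd]
      refine Finset.sum_congr rfl fun k _ => ?_
      change _ = i (d k * LaurentPolynomial.T (σ l)) *
        (i (LaurentPolynomial.T (-σ l)) * k₁ (c k))
      rw [map_mul, mul_assoc, ← mul_assoc (i (LaurentPolynomial.T (σ l))), hTT, one_mul]
    rw [hw]
    exact Submodule.sum_mem _ fun k _ =>
      Submodule.smul_mem _ _ (Submodule.subset_span ⟨c k, hc k, rfl⟩)
  · intro m hm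
    let := Ideal.Quotient.field m
    let x : R →ₐ[ℂ] R ⧸ m := Ideal.Quotient.mkₐ ℂ m
    have hx : Function.Surjective x := Ideal.Quotient.mkₐ_surjective ℂ m
    obtain ⟨f₀, f₁, g₀, g₁, e₀, e₁, e₂, e₃, e₄, e₅, e₆⟩ := h.exists_fibre hσ x
    obtain ⟨u, hu, hu1⟩ := h.principal₀.exists_mem_eq_one (polyMap_surjective hx) e₀ l
    obtain ⟨v, hv, hv1⟩ := h.principal₁.exists_mem_eq_one (polyMap_surjective hx) e₁ l
    -- The coordinates of `w` are `a'_k w`. If `w` vanishes along the section of the fibre, so do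
    -- they, hence all their coefficients lie in `m`.
    have hker : ∀ w : W, g₀ w = 0 → w ∈ m • (⊤ : Submodule R W) := by
      intro w hw
      obtain ⟨d, hd, hd'⟩ := hdec w
      rw [hd]
      refine Submodule.sum_mem _ fun k _ => laurent_smul_mem (fun j => ?_) _
      have h1 := congrArg g₀ (hd' k)
      rw [map_mul, hw, mul_zero, ← AlgHom.comp_apply, e₂] at h1
      have h2 := congrArg (fun q => q.coeff j) h1
      simp only [laurentMap_coeff] at h2
      exact Ideal.Quotient.eq_zero_iff_mem.1 h2
    have hgu : g₀ (k₀ u) = 1 := by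
      have := congrArg (fun k => k u) e₄
      simp only [AlgHom.comp_apply, hu1, map_one] at this
      exact this
    -- The degree condition replaces `g₀` by `t^(σ l) g₁`, which cancels the twist. So `u` and the
    -- twisted `v` agree on the fibre.
    have hgv : g₀ (i (LaurentPolynomial.T (-σ l)) * k₁ v) = 1 := by
      rw [e₆ l _ (h.principal.smul_mem_weightSpace _ (h.map₁_mem hv)), map_mul,
        ← AlgHom.comp_apply, ← AlgHom.comp_apply, e₃, e₅, AlgHom.comp_apply, hv1, map_one, mul_one,
        laurentMap_T, ← LaurentPolynomial.T_add, add_neg_cancel, LaurentPolynomial.T_zero]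
    refine ⟨⟨k₀ u, h.map₀_mem hu⟩, ⟨u, hu, rfl⟩, ⟨i (LaurentPolynomial.T (-σ l)) * k₁ v,
      h.principal.smul_mem_weightSpace _ (h.map₁_mem hv)⟩, ⟨v, hv, rfl⟩, hker _ ?_, fun w => ?_⟩
    · change g₀ (k₀ u - i (LaurentPolynomial.T (-σ l)) * k₁ v) = 0
      rw [map_sub, hgu, hgv, sub_self]
    · obtain ⟨q, hq⟩ := laurentMap_surjective hx (g₀ w)
      refine ⟨q, hker _ ?_⟩
      change g₀ (w - i q * k₀ u) = 0
      rw [map_sub, map_mul, hgu, mul_one, ← AlgHom.comp_apply, e₂, hq, sub_self]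

end IsChartSystem

end Cohomology

end

section

open Limits
open scoped MonObj LaurentPolynomial

/-! ### Normalized weight vectors and the framing of a bundle -/

section Frames

variable {X : Type} [AddCommGroup X]

/-- A system of invertible weight vectors defines a section of an affine principal bundle. -/
lemma IsPrincipalBundle.exists_section_of_weights {D B : Type} [CommRing D] [Algebra ℂ D]
    [CommRing B] [Algebra ℂ B] [ModObj (Torus X) (specOver B)] {i : D →ₐ[ℂ] B}
    (hi : IsPrincipalBundle X (specMap i)) {u : X → B} (hu : ∀ l, u l ∈ weightSpace B l)
    (hu0 : u 0 = 1) (hadd : ∀ l m, u (l + m) = u l * u m) :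
    ∃ e : B →ₐ[ℂ] D, e.comp i = AlgHom.id ℂ D ∧ ∀ l, e (u l) = 1 := by
  -- A section with value `1` on all `u l` must send `b` to `u (-l) * b`, which has weight `0` and
  -- therefore descends.
  have hex : ∀ (l : X) (b : weightSpace B l), ∃ d, i d = u (-l) * b := fun l b =>
    hi.mem_range_of_mem (by
      have := weightSpace_mul_mem B (hu (-l)) b.2
      rwa [neg_add_cancel] at this)
  choose f hf using hex
  let F : ∀ l : X, weightSpace B l →ₗ[ℂ] D := fun l =>
    { toFun := f l
      map_add' := fun b b' => hi.injective (by
        rw [map_add, hf, hf, hf, ← mul_add]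
        rfl)
      map_smul' := fun r b => hi.injective (by
        rw [RingHom.id_apply, map_smul, hf, hf, ← mul_smul_comm]
        rfl) }
  have hF : ∀ l (b : weightSpace B l), i (F l b) = u (-l) * b := hf
  obtain ⟨e, he⟩ := exists_algHom_of_weights F
    (hi.injective (by rw [hF, neg_zero, hu0, map_one, one_mul]))
    (fun l m a b => hi.injective (by
      rw [hF, map_mul, hF, hF, neg_add, hadd]
      ring))
  refine ⟨e, AlgHom.ext fun d => hi.injective ?_, fun l => hi.injective ?_⟩
  · have := hF 0 ⟨i d, hi.map_mem_weightSpace_zero d⟩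
    rw [neg_zero, hu0, one_mul, ← he] at this
    exact this
  · have := hF l ⟨u l, hu l⟩
    rw [← hadd, neg_add_cancel, hu0, ← he] at this
    rw [map_one]
    exact this

variable {R : Type} [CommRing R] [Algebra ℂ R]

lemma evalZero_surjective : Function.Surjective (evalZero R) := fun r =>
  ⟨Polynomial.C r, by rw [evalZero_apply, Polynomial.coeff_C_zero]⟩

lemma eq_one_of_laurent_eq {f g : Polynomial R} (h : laurent R f = laurentInv R g)
    (h0 : f.coeff 0 = 1) : f = 1 ∧ g = 1 := by
  obtain ⟨hf, hg⟩ := eq_C_of_laurent_eq h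
  rw [h0, map_one] at hf hg
  exact ⟨hf, hg⟩

section ChartSystem

variable {B₀ B₁ B : Type} [CommRing B₀] [Algebra ℂ B₀] [CommRing B₁] [Algebra ℂ B₁] [CommRing B]
  [Algebra ℂ B] {P : Over SpecC} [ModObj (Torus X) P] [ModObj (Torus X) (specOver B₀)]
  [ModObj (Torus X) (specOver B₁)] [ModObj (Torus X) (specOver B)] {π : P ⟶ P1 ⊗ specOver R}
  {i₀ : Polynomial R →ₐ[ℂ] B₀} {i₁ : Polynomial R →ₐ[ℂ] B₁} {i : R[T;T⁻¹] →ₐ[ℂ] B}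
  {p₀ : specOver B₀ ⟶ P} {p₁ : specOver B₁ ⟶ P} {p : specOver B ⟶ P}
  {k₀ : B₀ →ₐ[ℂ] B} {k₁ : B₁ →ₐ[ℂ] B}

/-- A trivialization of the line bundle of weight `l` which is compatible with its degree and
normalized along `∞`. -/
structure IsWeightFrame (σ : X →+ ℤ) (i : R[T;T⁻¹] →ₐ[ℂ] B) (k₀ : B₀ →ₐ[ℂ] B) (k₁ : B₁ →ₐ[ℂ] B)
    (ε : B₀ →ₐ[ℂ] R) (l : X) (u : B₀) (v : B₁) : Prop where
  mem₀ : u ∈ weightSpace B₀ l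
  mem₁ : v ∈ weightSpace B₁ l
  eq_one : ε u = 1
  glue : k₀ u = i (LaurentPolynomial.T (-σ l)) * k₁ v

namespace IsWeightFrame

variable {σ : X →+ ℤ} {ε : B₀ →ₐ[ℂ] R} {l m : X} {u u' : B₀} {v v' : B₁}

omit [ModObj (Torus X) (specOver B)] in
lemma mul (hu : IsWeightFrame σ i k₀ k₁ ε l u v) (hu' : IsWeightFrame σ i k₀ k₁ ε m u' v') :
    IsWeightFrame σ i k₀ k₁ ε (l + m) (u * u') (v * v') where
  mem₀ := weightSpace_mul_mem _ hu.mem₀ hu'.mem₀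
  mem₁ := weightSpace_mul_mem _ hu.mem₁ hu'.mem₁
  eq_one := by rw [map_mul, hu.eq_one, hu'.eq_one, one_mul]
  glue := by
    rw [map_mul, map_mul, hu.glue, hu'.glue, map_add, neg_add, LaurentPolynomial.T_add, map_mul]
    ring

/-- In weight `0` a frame is a global function on `ℙ¹ × Spec R`, hence constant, with value `1` at
`∞`. -/
lemma eq_one_of_zero (h : IsChartSystem X π i₀ i₁ i p₀ p₁ p k₀ k₁) (hε : ε.comp i₀ = evalZero R)
    (hu : IsWeightFrame σ i k₀ k₁ ε (0 : X) u v) : u = 1 ∧ v = 1 := by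
  obtain ⟨f, rfl⟩ := h.principal₀.mem_range_of_mem hu.mem₀
  obtain ⟨g, rfl⟩ := h.principal₁.mem_range_of_mem hu.mem₁
  have h1 := hu.glue
  rw [map_zero, neg_zero, LaurentPolynomial.T_zero, map_one, one_mul, h.map_chart₀,
    h.map_chart₁] at h1
  have h2 := hu.eq_one
  rw [← AlgHom.comp_apply, hε, evalZero_apply] at h2
  obtain ⟨rfl, rfl⟩ := eq_one_of_laurent_eq (h.principal.injective h1) h2
  exact ⟨map_one _, map_one _⟩

/-- Start with a weight vector `b` on the first chart with value `1` at `∞` and split it as `t y +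
t^(-σ l) z`. Then `b - t y` has the same value at `t = 0` and extends to the second chart as `z`. -/
lemma exists_frame (h : IsChartSystem X π i₀ i₁ i p₀ p₁ p k₀ k₁) (hε : ε.comp i₀ = evalZero R)
    (hσ : HasDegree σ π) (l : X) : ∃ u v, IsWeightFrame σ i k₀ k₁ ε l u v := by
  obtain ⟨b, hb, hb1⟩ := h.principal₀.exists_mem_eq_one evalZero_surjective hε l
  obtain ⟨y, hy, z, hz, he⟩ := h.exists_eq_add hσ (h.map₀_mem hb)
  refine ⟨b - i₀ Polynomial.X * y, z, sub_mem hb (h.principal₀.smul_mem_weightSpace _ hy), hz, ?_,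
    ?_⟩
  · have : ε (i₀ Polynomial.X) = 0 := by
      rw [← AlgHom.comp_apply, hε, evalZero_apply, Polynomial.coeff_X_zero]
    rw [map_sub, map_mul, this, zero_mul, sub_zero, hb1]
  · rw [map_sub, map_mul, h.map_chart₀, laurent_X, he, add_sub_cancel_left]

/-- Both frames are inverse to any frame of weight `-l`, as their products with it have weight `0`.
-/
lemma unique (h : IsChartSystem X π i₀ i₁ i p₀ p₁ p k₀ k₁) (hε : ε.comp i₀ = evalZero R)
    (hσ : HasDegree σ π) (hu : IsWeightFrame σ i k₀ k₁ ε l u v)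
    (hu' : IsWeightFrame σ i k₀ k₁ ε l u' v') : u = u' ∧ v = v' := by
  obtain ⟨w, z, hw⟩ := exists_frame h hε hσ (-l)
  have h1 := hu.mul hw
  have h2 := hw.mul hu'
  rw [add_neg_cancel] at h1
  rw [neg_add_cancel] at h2
  obtain ⟨h1, h1'⟩ := h1.eq_one_of_zero h hε
  obtain ⟨h2, h2'⟩ := h2.eq_one_of_zero h hε
  constructor
  · rw [← mul_one u, ← h2, ← mul_assoc, h1, one_mul]
  · rw [← mul_one v, ← h2', ← mul_assoc, h1', one_mul]

end IsWeightFrame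

end ChartSystem

/-- A bundle of degree `σ` which is trivialized along `∞` has a normalized framing. -/
theorem IsPrincipalBundle.exists_framing {P : Over SpecC} [ModObj (Torus X) P]
    {π : P ⟶ P1 ⊗ specOver R} (hπ : IsPrincipalBundle X π) {σ : X →+ ℤ} (hσ : HasDegree σ π)
    {e : specOver R ⟶ P} (he : e ≫ π = inftySection R) :
    ∃ e₀ e₁, IsFraming π (specMap (laurent R)) (specMap (laurentInv R)) (chart₀ R) (chart₁ R)
      (coweightPoint σ (tUnit R)) e₀ e₁ ∧ specMap (evalZero R) ≫ e₀ = e := by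
  obtain ⟨B₀, B₁, B, _, _, _, _, _, _, _, _, _, i₀, i₁, i, p₀, p₁, p, k₀, k₁, h⟩ :=
    hπ.exists_chartSystem
  rw [← evalZero_chart₀] at he
  obtain ⟨ε, hε⟩ := exists_specMap_eq (h.isPullback₀.lift e _ he)
  have hεp : specMap ε ≫ p₀ = e := by rw [hε, h.isPullback₀.lift_fst]
  have hεi : ε.comp i₀ = evalZero R :=
    specMap_injective (by rw [specMap_comp, hε, h.isPullback₀.lift_snd])
  choose u v huv using IsWeightFrame.exists_frame h hεi hσ
  -- The frames are chosen independently for each character; uniqueness makes them multiplicative.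
  have hadd : ∀ l m, u (l + m) = u l * u m ∧ v (l + m) = v l * v m := fun l m =>
    (huv (l + m)).unique h hεi hσ ((huv l).mul (huv m))
  have hzero := (huv 0).eq_one_of_zero h hεi
  obtain ⟨s₀, hs₀, hs₀u⟩ := h.principal₀.exists_section_of_weights (fun l => (huv l).mem₀) hzero.1
    fun l m => (hadd l m).1
  obtain ⟨s₁, hs₁, hs₁v⟩ := h.principal₁.exists_section_of_weights (fun l => (huv l).mem₁) hzero.2
    fun l m => (hadd l m).2
  have hp₀ : (specMap s₀ ≫ p₀) ≫ π = chart₀ R := by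
    rw [Category.assoc, h.isPullback₀.w, ← Category.assoc, ← specMap_comp, hs₀, specMap_id,
      Category.id_comp]
  have hp₁ : (specMap s₁ ≫ p₁) ≫ π = chart₁ R := by
    rw [Category.assoc, h.isPullback₁.w, ← Category.assoc, ← specMap_comp, hs₁, specMap_id,
      Category.id_comp]
  refine ⟨specMap s₀ ≫ p₀, specMap s₁ ≫ p₁, ⟨hp₀, hp₁, ?_⟩, ?_⟩
  · obtain ⟨g₀, hg₀⟩ := exists_specMap_eq (h.isPullback.lift (specMap (laurent R) ≫ specMap s₀ ≫ p₀)
      (𝟙 _) (by rw [Category.assoc, hp₀, Category.id_comp]))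
    obtain ⟨g₁, hg₁⟩ := exists_specMap_eq (h.isPullback.lift
      (specMap (laurentInv R) ≫ specMap s₁ ≫ p₁) (𝟙 _)
      (by rw [Category.assoc, hp₁, Category.id_comp, laurent_comp_chart]))
    have e₀ : g₀.comp i = AlgHom.id ℂ _ := specMap_injective (by
      rw [specMap_comp, hg₀, h.isPullback.lift_snd, specMap_id])
    have e₁ : g₁.comp i = AlgHom.id ℂ _ := specMap_injective (by
      rw [specMap_comp, hg₁, h.isPullback.lift_snd, specMap_id])
    have e₂ : g₀.comp k₀ = (laurent R).comp s₀ := specMap_injective (h.isPullback₀.hom_ext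
      (by rw [specMap_comp, specMap_comp, Category.assoc, Category.assoc, h.comp₀, hg₀,
        h.isPullback.lift_fst])
      (by rw [← specMap_comp, ← specMap_comp, AlgHom.comp_assoc, AlgHom.comp_assoc, h.comp_eq₀,
        ← AlgHom.comp_assoc, e₀, hs₀]; rfl))
    have e₃ : g₁.comp k₁ = (laurentInv R).comp s₁ := specMap_injective (h.isPullback₁.hom_ext
      (by rw [specMap_comp, specMap_comp, Category.assoc, Category.assoc, h.comp₁, hg₁,
        h.isPullback.lift_fst])
      (by rw [← specMap_comp, ← specMap_comp, AlgHom.comp_assoc, AlgHom.comp_assoc, h.comp_eq₁,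
        ← AlgHom.comp_assoc, e₁, hs₁]; rfl))
    -- Over the overlap the two sections differ by a torus point `t`. Evaluating on the frames,
    -- where both sections take the value `1`, gives `χ^l(t) = T^(σ l)`.
    obtain ⟨t, ht⟩ := h.principal.exists_chr (f := g₁) (g := g₀) (by rw [e₀, e₁])
    have htσ : t = coweightPoint σ (tUnit R) := by
      refine chr_ext fun l => ?_
      have h1 := eq_chr_mul ht (h.map₀_mem (huv l).mem₀)
      rw [← AlgHom.comp_apply, e₂, AlgHom.comp_apply, hs₀u, map_one, (huv l).glue, map_mul,
        ← AlgHom.comp_apply, ← AlgHom.comp_apply, e₁, e₃, AlgHom.comp_apply, hs₁v, map_one, mul_one,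
        AlgHom.id_apply] at h1
      rw [chr_coweightPoint]
      calc chr t l = chr t l * (LaurentPolynomial.T (-σ l) * LaurentPolynomial.T (σ l)) := by
            rw [← LaurentPolynomial.T_add, neg_add_cancel, LaurentPolynomial.T_zero, mul_one]
        _ = _ := by rw [← mul_assoc, ← h1, one_mul]
    have h2 := congrArg (· ≫ p) ht
    simp only [(isModHom_iff _).1 h.isModHom, hg₀, hg₁, h.isPullback.lift_fst] at h2
    rw [← h2, htσ]
  · rw [← hεp, ← Category.assoc, ← specMap_comp]
    congr 1
    -- At `∞` the new section and the given trivialization both take the value `1` on every `u l`,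
    -- so the torus point between them is trivial.
    obtain ⟨t, ht⟩ := h.principal₀.exists_chr (f := (evalZero R).comp s₀) (g := ε)
      (by rw [AlgHom.comp_assoc, hs₀, hεi]; rfl)
    have ht1 : t = 1 := chr_ext fun l => by
      have h1 := eq_chr_mul ht (huv l).mem₀
      rw [(huv l).eq_one, AlgHom.comp_apply, hs₀u, map_one, mul_one] at h1
      rw [chr_one, h1]
    rw [← ht, ht1, one_smul_point]

end Frames

end

section

open Limits
open scoped MonObj LaurentPolynomial

/-! ### Uniqueness of framings, and based homomorphisms as equivariant maps -/

section FramedBundles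

variable {X : Type} [AddCommGroup X] {R R' : Type} [CommRing R] [Algebra ℂ R] [CommRing R']

lemma polyMap_comp {C C' C'' : Type} [CommRing C] [Algebra ℂ C] [CommRing C'] [Algebra ℂ C']
    [CommRing C''] [Algebra ℂ C''] (g : C' →ₐ[ℂ] C'') (f : C →ₐ[ℂ] C') :
    (polyMap g).comp (polyMap f) = polyMap (g.comp f) :=
  AlgHom.ext fun p => Polynomial.ext fun i => by
    rw [AlgHom.comp_apply, polyMap_coeff, polyMap_coeff, polyMap_coeff, AlgHom.comp_apply]

/-- As the torus is commutative, the ratios of two framings agree on the overlap and form a map from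
`ℙ¹ × Spec R` to `T`. Its characters are constant, and equal to `1` at `∞`. -/
lemma IsPrincipalBundle.eq_of_glue {P S : Over SpecC} [ModObj (Torus X) P] {π : P ⟶ S}
    (hπ : IsPrincipalBundle X π) {e₀ e₁ e₀' e₁' : specOver (Polynomial R) ⟶ P}
    (h₀ : e₀ ≫ π = e₀' ≫ π) (h₁ : e₁ ≫ π = e₁' ≫ π) {τ : specOver R[T;T⁻¹] ⟶ Torus X}
    (hg : specMap (laurent R) ≫ e₀ = τ • (specMap (laurentInv R) ≫ e₁))
    (hg' : specMap (laurent R) ≫ e₀' = τ • (specMap (laurentInv R) ≫ e₁'))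
    (hz : specMap (evalZero R) ≫ e₀ = specMap (evalZero R) ≫ e₀') : e₀ = e₀' ∧ e₁ = e₁' := by
  obtain ⟨s₀, rfl⟩ := hπ.exists_smul_eq h₀
  obtain ⟨s₁, rfl⟩ := hπ.exists_smul_eq h₁
  have hs : specMap (laurent R) ≫ s₀ = specMap (laurentInv R) ≫ s₁ := by
    rw [comp_smul, hg, comp_smul, smul_smul_point, smul_smul_point] at hg'
    have h1 := hπ.smul_left_cancel hg'
    obtain ⟨τ', hτ⟩ := torus_exists_inv τ
    rw [torus_mul_comm] at h1
    have h2 := congrArg (τ' * ·) h1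
    simpa only [← mul_assoc, hτ, one_mul] using h2
  have hz' : specMap (evalZero R) ≫ s₀ = 1 := by
    rw [comp_smul] at hz
    refine hπ.smul_left_cancel (p := specMap (evalZero R) ≫ e₀) ?_
    rw [← hz, one_smul_point]
  have key : ∀ l, chr s₀ l = 1 ∧ chr s₁ l = 1 := fun l => by
    have h1 := congrArg (fun t => chr t l) hs
    have h2 := congrArg (fun t => chr t l) hz'
    simp only [chr_comp, chr_one, evalZero_apply] at h1 h2
    exact eq_one_of_laurent_eq h1 h2
  have e₀ : s₀ = 1 := chr_ext fun l => by rw [(key l).1, chr_one]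
  have e₁ : s₁ = 1 := chr_ext fun l => by rw [(key l).2, chr_one]
  rw [e₀, e₁, one_smul_point, one_smul_point]
  exact ⟨rfl, rfl⟩

variable [Algebra ℂ R'] {σ : X →+ ℤ}

lemma laurentMap_coweightPoint (φ : R →ₐ[ℂ] R') :
    specMap (laurentMap φ) ≫ coweightPoint σ (tUnit R) = coweightPoint σ (tUnit R') :=
  chr_ext fun l => by rw [chr_comp, chr_coweightPoint, chr_coweightPoint, laurentMap_T]

lemma glue_baseChange {P : Over SpecC} [ModObj (Torus X) P]
    {e₀ e₁ : specOver (Polynomial R) ⟶ P} (φ : R →ₐ[ℂ] R')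
    (hg : specMap (laurent R) ≫ e₀ = coweightPoint σ (tUnit R) • (specMap (laurentInv R) ≫ e₁)) :
    specMap (laurent R') ≫ specMap (polyMap φ) ≫ e₀ =
      coweightPoint σ (tUnit R') • (specMap (laurentInv R') ≫ specMap (polyMap φ) ≫ e₁) := by
  rw [← Category.assoc, ← Category.assoc, ← specMap_comp, ← specMap_comp, ← laurentMap_comp_laurent,
    ← laurentMap_comp_laurentInv, specMap_comp, specMap_comp, Category.assoc, Category.assoc, hg,
    comp_smul, laurentMap_coweightPoint]

lemma IsFraming.hasDegree {P : Over SpecC} [ModObj (Torus X) P] {π : P ⟶ P1 ⊗ specOver R}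
    {e₀ e₁ : specOver (Polynomial R) ⟶ P}
    (he : IsFraming π (specMap (laurent R)) (specMap (laurentInv R)) (chart₀ R) (chart₁ R)
      (coweightPoint σ (tUnit R)) e₀ e₁) : HasDegree σ π := by
  intro K _ _ x
  refine ⟨specMap (polyMap x) ≫ e₀, specMap (polyMap x) ≫ e₁, ?_, ?_, glue_baseChange x he.glue⟩
  · rw [Category.assoc, he.proj₀, fibreChart_eq₀]
  · rw [Category.assoc, he.proj₁, fibreChart_eq₁]

variable {A : Type} [CommRing A] [Algebra ℂ A] [ModObj (Torus X) (specOver A)]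

lemma glue_specMap_iff {φ₀ φ₁ : A →ₐ[ℂ] Polynomial R} :
    specMap (laurent R) ≫ specMap φ₀ =
      coweightPoint σ (tUnit R) • (specMap (laurentInv R) ≫ specMap φ₁) ↔
    ∀ (l : X), ∀ a ∈ weightSpace A l,
      laurent R (φ₀ a) = LaurentPolynomial.T (σ l) * laurentInv R (φ₁ a) := by
  rw [← specMap_comp, ← specMap_comp]
  constructor
  · intro h l a ha
    rw [← chr_coweightPoint]
    exact eq_chr_mul h.symm ha
  · intro h
    obtain ⟨g, hg⟩ := exists_specMap_eq
      (coweightPoint σ (tUnit R) • specMap ((laurentInv R).comp φ₁))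
    rw [← hg]
    congr 1
    refine algHom_ext_weight (X := X) fun l a ha => ?_
    rw [eq_chr_mul hg.symm ha, chr_coweightPoint]
    exact h l a ha

/-- The values of an equivariant morphism on a framing determine each other. -/
lemma eq_of_glue_specMap {w w₁ w₁' : specOver (Polynomial R) ⟶ specOver A}
    (h : specMap (laurent R) ≫ w = coweightPoint σ (tUnit R) • (specMap (laurentInv R) ≫ w₁))
    (h' : specMap (laurent R) ≫ w = coweightPoint σ (tUnit R) • (specMap (laurentInv R) ≫ w₁')) :
    w₁ = w₁' := by
  obtain ⟨τ', hτ⟩ := torus_exists_inv (coweightPoint σ (tUnit R))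
  have h1 := congrArg (τ' • ·) (h.symm.trans h')
  simp only [smul_smul_point, hτ, one_smul_point] at h1
  obtain ⟨f, rfl⟩ := exists_specMap_eq w₁
  obtain ⟨g, rfl⟩ := exists_specMap_eq w₁'
  rw [← specMap_comp, ← specMap_comp] at h1
  congr 1
  exact AlgHom.ext fun a => laurentInv_injective (congrArg (fun k => k a) (specMap_injective h1))

variable {c : A →ₐ[ℂ] ℂ}

/-- On a vector of weight `l`, the gluing writes `φ₀` as `t^(σ l)` times a polynomial in `t⁻¹`,
which bounds the degree. -/
lemma isBased_of_glue {φ₀ : A →ₐ[ℂ] Polynomial R} {w₁ : specOver (Polynomial R) ⟶ specOver A}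
    (h : specMap (laurent R) ≫ specMap φ₀ =
      coweightPoint σ (tUnit R) • (specMap (laurentInv R) ≫ w₁))
    (hc : specMap (evalZero R) ≫ specMap φ₀ = constMap c R) : IsBased σ c φ₀ := by
  obtain ⟨φ₁, rfl⟩ := exists_specMap_eq w₁
  refine ⟨fun l a ha i hi => coeff_eq_zero_of_laurent_eq (glue_specMap_iff.1 h l a ha) hi,
    fun a => ?_⟩
  rw [← specMap_comp] at hc
  rw [← evalZero_apply]
  exact congrArg (fun k => k a) (specMap_injective hc)

/-- The degree bound allows each `φ₀ a` to be reversed. The reversed polynomials are unique because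
`T^(σ l)` is a unit, and therefore linear and multiplicative in `a`. -/
lemma IsBased.exists_glue {φ₀ : A →ₐ[ℂ] Polynomial R} (h : IsBased σ c φ₀) :
    ∃ w₁ : specOver (Polynomial R) ⟶ specOver A, specMap (laurent R) ≫ specMap φ₀ =
      coweightPoint σ (tUnit R) • (specMap (laurentInv R) ≫ w₁) := by
  have hex : ∀ (l : X) (a : weightSpace A l), ∃ g,
      laurent R (φ₀ a) = LaurentPolynomial.T (σ l) * laurentInv R g := fun l a =>
    exists_reverse _ _ fun i hi => h.degree l a a.2 i hi
  choose f hf using hex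
  have hT : ∀ d : ℤ, LaurentPolynomial.T (-d) * LaurentPolynomial.T d = (1 : R[T;T⁻¹]) := fun d => by
    rw [← LaurentPolynomial.T_add, neg_add_cancel, LaurentPolynomial.T_zero]
  have hcancel : ∀ (d : ℤ) (g g' : Polynomial R), LaurentPolynomial.T d * laurentInv R g =
      LaurentPolynomial.T d * laurentInv R g' → g = g' := fun d g g' hgg => by
    have := congrArg (LaurentPolynomial.T (-d) * ·) hgg
    simp only [← mul_assoc, hT, one_mul] at this
    exact laurentInv_injective this
  let F : ∀ l : X, weightSpace A l →ₗ[ℂ] Polynomial R := fun l =>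
    { toFun := f l
      map_add' := fun a a' => hcancel (σ l) _ _ (by
        rw [map_add, mul_add, ← hf, ← hf, ← hf, ← map_add, ← map_add]
        rfl)
      map_smul' := fun r a => hcancel (σ l) _ _ (by
        rw [RingHom.id_apply, map_smul, mul_smul_comm, ← hf, ← hf, ← map_smul, ← map_smul]
        rfl) }
  have hF : ∀ l (a : weightSpace A l), laurent R (φ₀ a) = LaurentPolynomial.T (σ l) * laurentInv R (F l a) := hf
  obtain ⟨φ₁, hφ₁⟩ := exists_algHom_of_weights F
    (hcancel (σ 0) _ _ (by
      rw [← hF, map_one (laurentInv R)]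
      change laurent R (φ₀ 1) = _
      rw [map_one, map_one, map_zero, LaurentPolynomial.T_zero, mul_one]))
    (fun l m a b => hcancel (σ (l + m)) _ _ (by
      rw [← hF, map_mul (laurentInv R)]
      change laurent R (φ₀ (a * b)) = _
      rw [map_mul, map_mul, hF, hF, map_add, LaurentPolynomial.T_add]
      ring))
  refine ⟨specMap φ₁, glue_specMap_iff.2 fun l a ha => ?_⟩
  rw [hφ₁ l ⟨a, ha⟩]
  exact hF l ⟨a, ha⟩

end FramedBundles

/-! ### The equivalence between based quasimaps and points of `Spec A^σ_c` -/

section Classification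

attribute [local instance] instCommRingAsigma instAlgebraAsigma instCommRingAsigmaC
  instAlgebraAsigmaC instSemiringAsigmaC instAddCommMonoidAsigmaC instModuleAsigmaC

variable {X : Type} [AddCommGroup X] {σ : X →+ ℤ} {A : Type} [CommRing A] [Algebra ℂ A]
  [ModObj (Torus X) (specOver A)] {c : A →ₐ[ℂ] ℂ}

/-- A framing of the bundle of a based quasimap which is compatible with its trivialization. -/
structure BasedQM.IsFrame (q : BasedQM σ A c)
    (e₀ e₁ : specOver (Polynomial q.base.unop) ⟶ q.P) : Prop where
  framing : IsFraming q.π (specMap (laurent q.base.unop)) (specMap (laurentInv q.base.unop))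
    (chart₀ q.base.unop) (chart₁ q.base.unop) (coweightPoint σ (tUnit q.base.unop)) e₀ e₁
  base : specMap (evalZero q.base.unop) ≫ e₀ = q.e

namespace BasedQM

lemma exists_isFrame (q : BasedQM σ A c) : ∃ e₀ e₁, q.IsFrame e₀ e₁ := by
  obtain ⟨e₀, e₁, h, h'⟩ := q.principal.exists_framing q.degree q.e_π
  exact ⟨e₀, e₁, h, h'⟩

variable {q q' : BasedQM σ A c} {e₀ e₁ : specOver (Polynomial q.base.unop) ⟶ q.P}
  {e₀' e₁' : specOver (Polynomial q'.base.unop) ⟶ q'.P}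

lemma IsFrame.comp_s_glue (h : q.IsFrame e₀ e₁) :
    specMap (laurent q.base.unop) ≫ e₀ ≫ q.s =
      coweightPoint σ (tUnit q.base.unop) • (specMap (laurentInv q.base.unop) ≫ e₁ ≫ q.s) := by
  rw [← Category.assoc, h.framing.glue, (isModHom_iff _).1 q.equivariant, Category.assoc]

/-- The image of one frame and the base change of the other satisfy the same gluing and
normalization, so they coincide by uniqueness. -/
lemma IsFrame.map_eq (h : q.IsFrame e₀ e₁) (h' : q'.IsFrame e₀' e₁') (f : q ⟶ q') :
    e₀ ≫ f.map = specMap (polyMap f.base.unop.hom) ≫ e₀' ∧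
      e₁ ≫ f.map = specMap (polyMap f.base.unop.hom) ≫ e₁' := by
  refine q'.principal.eq_of_glue (τ := coweightPoint σ (tUnit q.base.unop)) ?_ ?_ ?_ ?_ ?_
  · rw [Category.assoc, f.map_π, ← Category.assoc, h.framing.proj₀, Category.assoc,
      h'.framing.proj₀, specMap_polyMap_chart₀]
  · rw [Category.assoc, f.map_π, ← Category.assoc, h.framing.proj₁, Category.assoc,
      h'.framing.proj₁, specMap_polyMap_chart₁]
  · rw [← Category.assoc, h.framing.glue, (isModHom_iff _).1 f.equivariant, Category.assoc]
  · exact glue_baseChange _ h'.framing.glue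
  · rw [← Category.assoc, h.base, f.e_map, ← Category.assoc, ← specMap_comp, evalZero_comp_polyMap,
      specMap_comp, Category.assoc, h'.base]

variable {Φ : A →ₐ[ℂ] Polynomial (AsigmaC σ c)}

/-- The homomorphism `A^σ_c → R` classifies a based quasimap over `Spec R`. -/
def IsClassifiedBy (Φ : A →ₐ[ℂ] Polynomial (AsigmaC σ c)) (q : BasedQM σ A c)
    (f : AsigmaC σ c →ₐ[ℂ] q.base.unop) : Prop :=
  ∃ e₀ e₁, q.IsFrame e₀ e₁ ∧ e₀ ≫ q.s = specMap ((polyMap f).comp Φ)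

lemma exists_isClassifiedBy (hΦ : IsUniversal σ c (gen σ c) Φ) (q : BasedQM σ A c) :
    ∃ f, IsClassifiedBy Φ q f := by
  obtain ⟨e₀, e₁, h⟩ := q.exists_isFrame
  obtain ⟨φ₀, hφ₀⟩ := exists_specMap_eq (e₀ ≫ q.s)
  have hb : IsBased σ c φ₀ := isBased_of_glue (by rw [hφ₀]; exact h.comp_s_glue)
    (by rw [hφ₀, ← Category.assoc, h.base, q.e_s])
  obtain ⟨f, hf, -⟩ := hΦ.exists_lift φ₀ hb
  exact ⟨f, e₀, e₁, h, by rw [hf, hφ₀]⟩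

lemma IsClassifiedBy.eq_comp (hΦ : IsUniversal σ c (gen σ c) Φ)
    {f : AsigmaC σ c →ₐ[ℂ] q.base.unop} {f' : AsigmaC σ c →ₐ[ℂ] q'.base.unop}
    (hf : IsClassifiedBy Φ q f) (hf' : IsClassifiedBy Φ q' f') (g : q ⟶ q') :
    f = g.base.unop.hom.comp f' := by
  obtain ⟨e₀, e₁, h, hs⟩ := hf
  obtain ⟨e₀', e₁', h', hs'⟩ := hf'
  refine hΦ.hom_ext (specMap_injective ?_)
  rw [← hs, ← g.map_s, ← Category.assoc, (h.map_eq h' g).1, Category.assoc, hs', ← specMap_comp,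
    ← AlgHom.comp_assoc, polyMap_comp]

/-- An equivariant morphism is determined by its values on a frame, and these depend only on the
base morphism. In particular, there are no nontrivial automorphisms over the identity. -/
lemma hom_ext_of_base {f g : q ⟶ q'} (h : f.base = g.base) : f = g := by
  obtain ⟨e₀, e₁, he⟩ := q.exists_isFrame
  obtain ⟨e₀', e₁', he'⟩ := q'.exists_isFrame
  refine BasedQM.Hom.ext h (he.framing.equivariant_ext (isTwoCover_chart _) q.principal
    f.equivariant g.equivariant ?_ ?_)
  · rw [(he.map_eq he' f).1, (he.map_eq he' g).1, h]
  · rw [(he.map_eq he' f).2, (he.map_eq he' g).2, h]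

/-- The morphism is forced on frames, and both frames have the same transition function `σ(t)`. The
hypothesis on classifying homomorphisms gives compatibility with the maps to `Spec A`. -/
lemma IsClassifiedBy.exists_hom {f : AsigmaC σ c →ₐ[ℂ] q.base.unop}
    {f' : AsigmaC σ c →ₐ[ℂ] q'.base.unop} (hf : IsClassifiedBy Φ q f)
    (hf' : IsClassifiedBy Φ q' f') (b : q.base ⟶ q'.base) (hb : f = b.unop.hom.comp f') :
    ∃ g : q ⟶ q', g.base = b := by
  obtain ⟨e₀, e₁, h, hs⟩ := hf
  obtain ⟨e₀', e₁', h', hs'⟩ := hf'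
  have hcover := isTwoCover_chart q.base.unop
  obtain ⟨g, hg, hg₀, hg₁⟩ := h.framing.exists_equivariant hcover q.principal
    (specMap (polyMap b.unop.hom) ≫ e₀') (specMap (polyMap b.unop.hom) ≫ e₁')
    (glue_baseChange _ h'.framing.glue)
  have hg' := (isModHom_iff _).1 hg
  have hs₀ : e₀ ≫ g ≫ q'.s = e₀ ≫ q.s := by
    rw [← Category.assoc, hg₀, Category.assoc, hs', hs, ← specMap_comp, hb, ← AlgHom.comp_assoc,
      polyMap_comp]
  have hgs : IsModHom (Torus X) (g ≫ q'.s) := by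
    have := q'.equivariant
    infer_instance
  refine ⟨⟨b, g, hg, ?_, ?_, ?_⟩, rfl⟩
  · refine h.framing.hom_ext hcover q.principal (fun V t u => ?_) fun V t u => ?_
    · rw [← Category.assoc, hg', q'.principal.smul_comp, Category.assoc, Category.assoc,
        reassoc_of% hg₀, h'.framing.proj₀, ← Category.assoc (t • _), q.principal.smul_comp,
        Category.assoc u, h.framing.proj₀, specMap_polyMap_chart₀, Category.assoc]
    · rw [← Category.assoc, hg', q'.principal.smul_comp, Category.assoc, Category.assoc,
        reassoc_of% hg₁, h'.framing.proj₁, ← Category.assoc (t • _), q.principal.smul_comp,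
        Category.assoc u, h.framing.proj₁, specMap_polyMap_chart₁, Category.assoc]
  · refine h.framing.equivariant_ext hcover q.principal hgs q.equivariant hs₀ ?_
    -- Agreement on `e₁` follows from agreement on `e₀`, since restriction to the overlap loses no
    -- information.
    refine eq_of_glue_specMap (σ := σ) (w := e₀ ≫ q.s) ?_ h.comp_s_glue
    rw [← hs₀, ← Category.assoc, h.framing.glue, (isModHom_iff _).1 hgs, Category.assoc]
  · rw [← h.base, Category.assoc, hg₀, ← Category.assoc, ← specMap_comp, evalZero_comp_polyMap,
      specMap_comp, Category.assoc, h'.base]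

/-- The bundle is glued from two trivial ones by `σ(t)`, and the map to `Spec A` is given in the
frame by the specialized universal homomorphism and its reversal. -/
lemma exists_of_algHom (hΦ : IsUniversal σ c (gen σ c) Φ) (S : AffC)
    (f : AsigmaC σ c →ₐ[ℂ] S.unop) : ∃ (P : Over SpecC) (_ : ModObj (Torus X) P)
      (π : P ⟶ P1 ⊗ specOver S.unop) (hπ : IsPrincipalBundle X π) (hσ : HasDegree σ π)
      (s : P ⟶ specOver A) (hs : IsModHom (Torus X) s) (e : specOver S.unop ⟶ P)
      (he : e ≫ π = inftySection S.unop) (hes : e ≫ s = constMap c S.unop),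
      IsClassifiedBy Φ ⟨S, P, π, hπ, hσ, s, hs, e, he, hes⟩ f := by
  have hcover := isTwoCover_chart S.unop
  obtain ⟨P, inst, π, e₀, e₁, hπ, he⟩ := hcover.exists_framed (coweightPoint σ (tUnit S.unop))
  have hb := hΦ.based.map f
  obtain ⟨w₁, hw₁⟩ := hb.exists_glue
  obtain ⟨s, hs, hs₀, hs₁⟩ := he.exists_equivariant hcover hπ _ w₁ hw₁
  refine ⟨P, inst, π, hπ, he.hasDegree, s, hs, specMap (evalZero S.unop) ≫ e₀, ?_, ?_, e₀, e₁,
    ⟨he, rfl⟩, hs₀⟩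
  · rw [Category.assoc, he.proj₀, evalZero_chart₀]
  · rw [Category.assoc, hs₀, ← specMap_comp, constMap]
    congr 1
    refine AlgHom.ext fun a => ?_
    rw [AlgHom.comp_apply, evalZero_apply, hb.base]
    rfl

variable (σ A c) in
/-- The functor which sends a based quasimap to its classifying morphism. -/
theorem isoOfStacks : IsoOfStacks (QMStack σ A c) (affineStack (AsigmaC σ c)) := by
  obtain ⟨Φ, hΦ⟩ := exists_isUniversal σ c
  choose f hf using fun q : BasedQM σ A c => exists_isClassifiedBy hΦ q
  let F : BasedQM σ A c ⥤ Over (Opposite.op (CommAlgCat.of ℂ (AsigmaC σ c)) : AffC) :=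
    { obj := fun q => Over.mk (Y := q.base) (CommAlgCat.ofHom (f q)).op
      map := fun {q q'} g => Over.homMk g.base (by
        refine Quiver.Hom.unop_inj (CommAlgCat.hom_ext ?_)
        exact ((hf q).eq_comp hΦ (hf q') g).symm)
      map_id := fun q => Over.OverMorphism.ext rfl
      map_comp := fun g g' => Over.OverMorphism.ext rfl }
  have faithful : F.Faithful :=
    ⟨fun {q q' g g'} h => hom_ext_of_base (congrArg (fun k => Over.Hom.left k) h)⟩
  have full : F.Full := ⟨fun {q q'} g => by
    have hg : f q = g.left.unop.hom.comp (f q') :=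
      (congrArg (fun k => k.unop.hom) (Over.w g)).symm
    obtain ⟨k, hk⟩ := (hf q).exists_hom (hf q') g.left hg
    exact ⟨k, Over.OverMorphism.ext hk⟩⟩
  have surj : F.EssSurj := ⟨fun Y => by
    obtain ⟨P, _, π, hπ, hσ, s, hs, e, he, hes, hq⟩ := exists_of_algHom hΦ Y.left Y.hom.unop.hom
    let q : BasedQM σ A c := ⟨Y.left, P, π, hπ, hσ, s, hs, e, he, hes⟩
    -- The homomorphism chosen for `q` agrees with the given one, as the classifying homomorphism
    -- does not depend on the frame.
    have h := (hf q).eq_comp hΦ hq (𝟙 q)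
    refine ⟨q, ⟨Over.isoMk (Iso.refl _) ?_⟩⟩
    refine Quiver.Hom.unop_inj (CommAlgCat.hom_ext ?_)
    exact h.symm⟩
  exact ⟨{ toFunctor := F, w := rfl }, ⟨faithful, full, surj⟩⟩

end BasedQM

end Classification

end

end BasedQuasimap

end

theorem theorem9p5 {X : Type} [AddCommGroup X] [Module.Free ℤ X] [Module.Finite ℤ X]
    (σ : X →+ ℤ) (A : Type) [CommRing A] [Algebra ℂ A] [Algebra.FiniteType ℂ A]
    [ModObj (Torus X) (specOver A)] (c : A →ₐ[ℂ] ℂ)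
    (hc : TrivialStabilizer X c) :
    IsoOfStacks (QMStack σ A c) (affineStack (AsigmaC σ c)) ∧
    ((∀ (l : X) (a : A), a ∈ weightSpace A l → σ l < 0 → c a = 0) →
      ∃ z : AsigmaC σ c →ₐ[ℂ] ℂ,
        (∀ (n : ℕ) (a : degreePart σ A n) (β : homogDual n),
          z (gen σ c n a β) = c a * β (yPow n)) ∧
        ∃ _ : ModObj (Torus ℤ) (specOver (AsigmaC σ c)),
          (∀ (n : ℤ) (a : degreePart σ A n) (i j : ℕ),
            gen σ c n a (monomialDual n i j) ∈ weightSpace (AsigmaC σ c) (i : ℤ)) ∧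
          ContractsTo (AsigmaC σ c) z) :=
  ⟨BasedQM.isoOfStacks σ A c, fun h => asigmaC_contraction σ A c h⟩
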